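/- For $|z|<1$ let $\mathrm{Li}_n(z)=\sum_{k>0}z^k/k^n$; let $\zeta(n)=\sum_{k>0}k^{-n}$, $\beta(n)=\sum_{k\ge0}(-1)^k(2k+1)^{-n}$, and let $L_n=(-\log2)^n/n!$ for $n\ge0$, $L_n=0$ for $n<0$. Define $$A_n=\mathrm{Li}_n(\tfrac12),\qquad B_n+iF_n=2^{n-1}\,\mathrm{Li}_n(\tfrac{1+i}2),$$ $$C_n=\Re\{(2/3)^{n-1}\,\mathrm{Li}_n(\tfrac{i}{\sqrt8})-2^n\,\mathrm{Li}_n(\tfrac{-i}{\sqrt2})\},$$ $$D_n+iG_n=(2/3)^{n-1}\,\mathrm{Li}_n(\tfrac{1+i}4)-\mathrm{Li}_n(\tfrac{-i}2),\qquad E_n+iH_n=(2/5)^{n-1}\,\mathrm{Li}_n(\tfrac{1-i}8)-2\,\mathrm{Li}_n(\tfrac{-i}2),$$ where $B_n,D_n,E_n,F_n,G_n,H_n$ are real, and put $\overline A_n=A_n+L_n-\tfrac12\zeta(2)L_{n-2}$; $\overline X_n=X_n+\tfrac12L_n-c_X\,\zeta(2)L_{n-2}$ for $X=B,C,D,E$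 with $c_B=\tfrac58$, $c_C=\tfrac13$, $c_D=\tfrac5{24}$, $c_E=\tfrac7{40}$; and $\overline X_n=X_n-\tfrac{\pi}{4}L_{n-1}$ for $X=F,G,H$. For integers $a_1,\dots,a_8$, extended to a sequence $(a_k)_{k\ge1}$ of period 8, let $$S_{n,p}(a_1,\dots,a_8)=\sum_{k>0}\frac{a_k}{2^{\lfloor(pk+p)/2\rfloor}\,k^n}.$$ A real number $x\ge0$ is said to be in $\mathrm{SC}^*$ if its $d$th hexadecimal digit can be computed simultaneously in time $O(d\log^{O(1)}d)$ and space $O(\log^{O(1)}d)$, where either of the digit strings $a\,\mathrm{FF}\ldots\mathrm F$ and $(a{+}1)\,00\ldots0$ is acceptable when they cannot be told apart within a prescribed power of $\log d$ digits. Precisely: for every $c\in\mathbb N$ there are a register machine (finitely many registers holding natural numbers; assignment of constants, $+$, truncated $-$, $\times$, integer division and remainder, tests for zero; an arithmetic instruction is charged the product of the incremented bit lengths of its operands, and space is the largest total bit length of the registers during the run) and constants $K,k$ such that, for every $d\ge1$, the machine on input $d$ halts in time at most $K\,d\,\lfloor\log_2(d+1)\rfloor^k$ and space at most $K\lfloor\log_2(d+1)\rfloor^k$,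 and its output is the $d$th hexadecimal digit $\lfloor16^dy\rfloor\bmod16$ of some real $y\ge0$ with $|y-x|<16^{-(d+m)}$, where $m=\lfloor\log_2(d+1)\rfloor^c$. (The output can thus differ from the $d$th digit of $x$ only if the next $m$ digits of $x$ are all $0$ or all $\mathrm F$.) Then the following hold. (1) Ladder relations of order 4: $$\overline B_4-\tfrac52\overline A_4=\tfrac{343}{128}\zeta(4),\qquad \overline C_4-\tfrac79\overline A_4=\tfrac5{54}\zeta(4),$$ $$\overline D_4-\tfrac13\overline A_4=-\tfrac{313}{3456}\zeta(4),\qquad \overline E_4-\tfrac6{25}\overline A_4=-\tfrac{1547}{16000}\zeta(4),$$ $$\overline G_4-\tfrac23\overline F_4-\beta(3)\log2=-\tfrac{80}{27}\beta(4),\qquad \overline H_4-\tfrac45\overline F_4-\tfrac{23}{25}\beta(3)\log2=-\tfrac{384}{125}\beta(4).$$ (2) BBP-type formulas: $$\tfrac{615}{256}\log^42=3\,S_{4,1}(73,-2617,-73,-5066,-73,-2617,73,-27564)+S_{4,3}(1258,-761,-1258,-497,-1258,-761,1258,2019),$$ $$\tfrac{41}{9216}\pi^4=3\,S_{4,1}(1,-19,-1,-2,-1,-19,1,-108)+2\,S_{4,3}(3,-1,-3,-2,-3,-1,3,4).$$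 (3) $\pi^4$, $\pi^2\log^22$ and $\log^42$ are in $\mathrm{SC}^*$. -/

import Mathlib

namespace Ladder

noncomputable section

/-! ### Polylogarithms and the constants -/

/-- `Li_n(z) = ∑_{k>0} z^k / k^n`. -/
def Li (n : ℕ) (z : ℂ) : ℂ := ∑' k : ℕ, z ^ (k + 1) / ((k + 1 : ℕ) : ℂ) ^ n

/-- `ζ(n) = ∑_{k>0} k^{-n}` (used for `n = 2, 4`). -/
def zeta (n : ℕ) : ℝ := ∑' k : ℕ, 1 / ((k + 1 : ℕ) : ℝ) ^ n

/-- `β(n) = ∑_{k≥0} (-1)^k (2k+1)^{-n}`. Used for `n = 3, 4` only; the series for `β(1)` is merely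
conditionally convergent, so that `β(1)` is written as `π / 4` below. -/
def beta (n : ℕ) : ℝ := ∑' k : ℕ, (-1 : ℝ) ^ k / ((2 * k + 1 : ℕ) : ℝ) ^ n

/-- `L_n = (-log 2)^n / n!`, with `L_n = 0` for `n < 0`. -/
def L (n : ℤ) : ℝ := if n < 0 then 0 else (-Real.log 2) ^ n.toNat / (n.toNat.factorial : ℝ)

/-- `S_{n,p}(a_1, …, a_8) = ∑_{k>0} a_k / (2^⌊(pk+p)/2⌋ k^n)`, where `a` has period 8. The entry
`a_k` is `a (k - 1)` in the zero-based indexing of `Fin 8`; the summation index is `k - 1`. -/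
def S (n p : ℕ) (a : Fin 8 → ℤ) : ℝ :=
  ∑' j : ℕ, (a (Fin.ofNat 8 j) : ℝ) / ((2 : ℝ) ^ ((p * (j + 1) + p) / 2) * ((j + 1 : ℕ) : ℝ) ^ n)

/-- The series for `Li_n(z)` converges for `|z| < 1`. -/
theorem summable_Li (n : ℕ) {z : ℂ} (hz : ‖z‖ < 1) :
    Summable fun k : ℕ => z ^ (k + 1) / ((k + 1 : ℕ) : ℂ) ^ n := by
  refine Summable.of_norm_bounded (summable_geometric_of_lt_one (norm_nonneg z) hz) fun k => ?_
  rw [norm_div, norm_pow, norm_pow, Complex.norm_natCast]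
  have h1 : (1 : ℝ) ≤ ((k + 1 : ℕ) : ℝ) ^ n := one_le_pow₀ (by push_cast; linarith [k.cast_nonneg (α := ℝ)])
  calc ‖z‖ ^ (k + 1) / ((k + 1 : ℕ) : ℝ) ^ n ≤ ‖z‖ ^ (k + 1) := div_le_self (by positivity) h1
    _ ≤ ‖z‖ ^ k := pow_le_pow_of_le_one (norm_nonneg z) hz.le (Nat.le_succ k)

/-- The series `S_{n,p}` converges for `n ≥ 2`. -/
theorem summable_S (n p : ℕ) (hn : 2 ≤ n) (a : Fin 8 → ℤ) :
    Summable fun j : ℕ => (a (Fin.ofNat 8 j) : ℝ) /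
      ((2 : ℝ) ^ ((p * (j + 1) + p) / 2) * ((j + 1 : ℕ) : ℝ) ^ n) := by
  have h0 : Summable fun j : ℕ => 1 / ((j + 1 : ℕ) : ℝ) ^ n :=
    (summable_nat_add_iff 1).2 (Real.summable_one_div_nat_pow.2 hn)
  refine Summable.of_norm_bounded (h0.mul_left (∑ i, |(a i : ℝ)|)) fun j => ?_
  have hk : (0 : ℝ) < ((j + 1 : ℕ) : ℝ) ^ n := by positivity
  have h2 : (1 : ℝ) ≤ (2 : ℝ) ^ ((p * (j + 1) + p) / 2) := one_le_pow₀ (by norm_num)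
  rw [Real.norm_eq_abs, abs_div,
    abs_of_pos (a := (2 : ℝ) ^ ((p * (j + 1) + p) / 2) * ((j + 1 : ℕ) : ℝ) ^ n) (by positivity),
    mul_one_div]
  exact div_le_div₀ (Finset.sum_nonneg fun i _ => abs_nonneg _)
    (Finset.single_le_sum (f := fun i => |(a i : ℝ)|) (fun i _ => abs_nonneg _) (Finset.mem_univ _))
    hk (le_mul_of_one_le_left hk.le h2)

/-! ### The eight ladders -/

def A (n : ℕ) : ℝ := (Li n (1 / 2)).re

def B (n : ℕ) : ℝ := ((2 : ℂ) ^ ((n : ℤ) - 1) * Li n ((1 + Complex.I) / 2)).re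

def C (n : ℕ) : ℝ :=
  ((2 / 3 : ℂ) ^ ((n : ℤ) - 1) * Li n (Complex.I / (√8 : ℝ))
    - (2 : ℂ) ^ n * Li n (-Complex.I / (√2 : ℝ))).re

def D (n : ℕ) : ℝ :=
  ((2 / 3 : ℂ) ^ ((n : ℤ) - 1) * Li n ((1 + Complex.I) / 4) - Li n (-Complex.I / 2)).re

def E (n : ℕ) : ℝ :=
  ((2 / 5 : ℂ) ^ ((n : ℤ) - 1) * Li n ((1 - Complex.I) / 8) - 2 * Li n (-Complex.I / 2)).re

def F (n : ℕ) : ℝ := ((2 : ℂ) ^ ((n : ℤ) - 1) * Li n ((1 + Complex.I) / 2)).im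

def G (n : ℕ) : ℝ :=
  ((2 / 3 : ℂ) ^ ((n : ℤ) - 1) * Li n ((1 + Complex.I) / 4) - Li n (-Complex.I / 2)).im

def H (n : ℕ) : ℝ :=
  ((2 / 5 : ℂ) ^ ((n : ℤ) - 1) * Li n ((1 - Complex.I) / 8) - 2 * Li n (-Complex.I / 2)).im

def Abar (n : ℕ) : ℝ := A n + L n - 1 / 2 * zeta 2 * L ((n : ℤ) - 2)
def Bbar (n : ℕ) : ℝ := B n + 1 / 2 * L n - 5 / 8 * zeta 2 * L ((n : ℤ) - 2)
def Cbar (n : ℕ) : ℝ := C n + 1 / 2 * L n - 1 / 3 * zeta 2 * L ((n : ℤ) - 2)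
def Dbar (n : ℕ) : ℝ := D n + 1 / 2 * L n - 5 / 24 * zeta 2 * L ((n : ℤ) - 2)
def Ebar (n : ℕ) : ℝ := E n + 1 / 2 * L n - 7 / 40 * zeta 2 * L ((n : ℤ) - 2)
def Fbar (n : ℕ) : ℝ := F n - Real.pi / 4 * L ((n : ℤ) - 1)
def Gbar (n : ℕ) : ℝ := G n - Real.pi / 4 * L ((n : ℤ) - 1)
def Hbar (n : ℕ) : ℝ := H n - Real.pi / 4 * L ((n : ℤ) - 1)

end

/-! ### The machine model

A register machine with finitely many registers, each holding a natural number, under a logarithmic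
(bit) cost measure. Every arithmetic instruction is charged the product of the (incremented) bit
lengths of its operands, which bounds the schoolbook cost of that instruction on a multitape Turing
machine; space is the total bit length of all registers, at its largest during the run. Time and
space bounded by this measure are therefore, up to constant factors, time and space bounds for a
multitape Turing machine. -/

/-- Arithmetic instructions. -/
inductive Op
  | add | sub | mul | div | mod

/-- Truncated subtraction; division with remainder (with `y / 0 = 0` and `y mod 0 = y`). -/
def Op.eval : Op → ℕ → ℕ → ℕ
  | .add, y, z => y + z
  | .sub, y, z => y - z
  | .mul, y, z => y * z
  | .div, y, z => y / z
  | .mod, y, z => y % z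

/-- Programs with `r` registers. -/
inductive Prog (r : ℕ)
  /-- `x := n` -/
  | const (x : Fin r) (n : ℕ)
  /-- `x := y o z` -/
  | arith (o : Op) (x y z : Fin r)
  /-- `p; q` -/
  | seq (p q : Prog r)
  /-- `if x = 0 then p else q` -/
  | ifZero (x : Fin r) (p q : Prog r)
  /-- `while x ≠ 0 do p` -/
  | while (x : Fin r) (p : Prog r)

/-- The total bit length of the registers. -/
def bits {r : ℕ} (σ : Fin r → ℕ) : ℕ := ∑ i, (σ i).size

/-- `Runs p σ τ t s`: started with register contents `σ`, the program `p` halts with register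
contents `τ`, after time `t`, using space `s`. -/
inductive Runs {r : ℕ} : Prog r → (Fin r → ℕ) → (Fin r → ℕ) → ℕ → ℕ → Prop
  | const (x : Fin r) (n : ℕ) (σ : Fin r → ℕ) :
      Runs (.const x n) σ (Function.update σ x n) (1 + n.size)
        (max (bits σ) (bits (Function.update σ x n)))
  | arith (o : Op) (x y z : Fin r) (σ : Fin r → ℕ) :
      Runs (.arith o x y z) σ (Function.update σ x (o.eval (σ y) (σ z)))
        ((1 + (σ y).size) * (1 + (σ z).size))
        (max (bits σ) (bits (Function.update σ x (o.eval (σ y) (σ z)))))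
  | seq {p q : Prog r} {σ τ ρ : Fin r → ℕ} {t t' s s' : ℕ} :
      Runs p σ τ t s → Runs q τ ρ t' s' → Runs (.seq p q) σ ρ (t + t') (max s s')
  | ifZero_zero {x : Fin r} {p q : Prog r} {σ τ : Fin r → ℕ} {t s : ℕ} :
      σ x = 0 → Runs p σ τ t s → Runs (.ifZero x p q) σ τ (1 + t) s
  | ifZero_ne {x : Fin r} {p q : Prog r} {σ τ : Fin r → ℕ} {t s : ℕ} :
      σ x ≠ 0 → Runs q σ τ t s → Runs (.ifZero x p q) σ τ (1 + t) s
  | while_zero {x : Fin r} {p : Prog r} {σ : Fin r → ℕ} :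
      σ x = 0 → Runs (.while x p) σ σ 1 (bits σ)
  | while_ne {x : Fin r} {p : Prog r} {σ τ ρ : Fin r → ℕ} {t t' s s' : ℕ} :
      σ x ≠ 0 → Runs p σ τ t s → Runs (.while x p) τ ρ t' s' →
      Runs (.while x p) σ ρ (1 + t + t') (max s s')

/-! ### The class SC* -/

/-- `a` is an acceptable value for the `d`-th base-`b` digit `⌊b^d x⌋ mod b` of `x ≥ 0` (`d ≥ 1`),
up to ambiguities of length `m`: it is the `d`-th digit of a number `y ≥ 0` at distance less than
`b^{-(d+m)}` from `x`. It can differ from the true digit only if the `m` digits of `x` that follow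
the `d`-th one are all `0` or all `b - 1`, that is, if the computation would have to tell
`a (b-1) (b-1) … (b-1)` from `(a+1) 0 0 … 0`; then both `a` and `a + 1` are acceptable. -/
def AcceptableDigit (b : ℕ) [NeZero b] (x : ℝ) (d m a : ℕ) : Prop :=
  ∃ y : ℝ, 0 ≤ y ∧ |y - x| < 1 / (b : ℝ) ^ (d + m) ∧ a = (Real.digits y b (d - 1) : ℕ)

/-- `x ≥ 0` is in SC* for the base `b`: its `d`-th base-`b` digit can be computed in simultaneous
time `O(d log^{O(1)} d)` and space `O(log^{O(1)} d)`. The number `d` is the content of register `0`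
at the start, where all other registers are `0`, and the digit is the content of register `0` at the
end. Ambiguities between digit strings `a (b-1) (b-1) …` and `(a+1) 0 0 …` are resolved up to an
arbitrarily high power of `log d`. -/
def SCStar (b : ℕ) [NeZero b] (x : ℝ) : Prop :=
  ∀ c : ℕ, ∃ (r : ℕ) (p : Prog (r + 1)) (K k : ℕ), ∀ d : ℕ, 1 ≤ d →
    ∃ (τ : Fin (r + 1) → ℕ) (t s : ℕ),
      Runs p (Function.update 0 0 d) τ t s ∧
      t ≤ K * (d * Nat.log 2 (d + 1) ^ k) ∧
      s ≤ K * Nat.log 2 (d + 1) ^ k ∧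
      AcceptableDigit b x d (Nat.log 2 (d + 1) ^ c) (τ 0)

end Ladder

open Ladder

section

open scoped ComplexConjugate
open Complex Set Filter Topology MeasureTheory

/-! ### Primitives on star-shaped domains and the continued polylogarithm -/

/-! The relations are specializations of Kummer's functional equation for the tetralogarithm. It
says that an explicit integer combination of Li_4 at twenty rational functions of x and y equals 3/2
log²(1-x) log²(1-y). Along a ray (tx, ty) each argument z is a constant times t^n (1-tx)^ξ (1-ty)^η.
Differentiating Li_{m+1}(z) therefore gives Li_m(z) times n/t + ξ u' + η v', with u = log(1-tx) and
v = log(1-ty). Three such steps lead down to the logarithms log(1-z), and every 1-z is a product of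
powers of only six polynomials. What remains is a finite set of identities between integer sums,
which `decide` checks (`kummer_tetralog`).

At (i, i), (i, -1) and (-1, 1+i), and in the limit (-1, -1), all arguments are units times powers of
1+i. Inversion (`polylog_three_inversion`) moves those outside the unit disc inside. Duplication
(`Li_sq`) and conjugation reduce the rest to the values occurring in the ladders. Real and imaginary
parts of the four equations give the six relations (`ladder_relations`).

The relations for B, C and D are linear in π⁴, π² log² 2 and log⁴ 2. Solving for these gives
combinations of Re Li_4 at 1/2, -1/2, -1/8, i/2, (1+i)/2 and (1+i)/4. Their eighth or fourth powers
are powers of 1/16, so their series have coefficients of period 8 (`S_four_one`, `S_four_three`).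

For SC*, the series are summed in fixed point modulo V, a power of 16. Multiplied by 16^E, a term is
16^(E - wn) / M with M small. The floor of this modulo V is (16^(E - wn) mod MV) / M, which repeated
squaring finds using numbers of polylogarithmic length. There are O(d) terms up to polylogarithmic
factors, each contributes a bounded error, and guard digits absorb the total (`scStar_of_sum`). A
small Hoare logic carries correctness, time and space together. -/

/-- On an open set that is star-shaped about `0`, integration along rays gives a primitive of a
holomorphic function. -/
theorem hasDerivAt_ray_integral {U : Set ℂ} (hU : IsOpen U)
    (hstar : ∀ z ∈ U, ∀ t ∈ Icc (0 : ℝ) 1, (t : ℂ) * z ∈ U) {g : ℂ → ℂ}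
    (hg : DifferentiableOn ℂ g U) {z : ℂ} (hz : z ∈ U) :
    HasDerivAt (fun z : ℂ => ∫ t in (0 : ℝ)..1, z * g (t * z)) (g z) z := by
  obtain ⟨ε, hε, hball⟩ := Metric.nhds_basis_closedBall.mem_iff.1 (hU.mem_nhds hz)
  have hg' : ContinuousOn (deriv g) U := (hg.deriv hU).continuousOn
  have hmaps : ∀ p ∈ Metric.closedBall z ε ×ˢ Icc (0 : ℝ) 1, (p.2 : ℂ) * p.1 ∈ U :=
    fun p hp => hstar _ (hball hp.1) _ hp.2
  have hcm : Continuous fun p : ℂ × ℝ => (p.2 : ℂ) * p.1 := by fun_prop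
  have hF' : ContinuousOn
      (fun p : ℂ × ℝ => g (p.2 * p.1) + p.1 * (p.2 * deriv g (p.2 * p.1)))
      (Metric.closedBall z ε ×ˢ Icc (0 : ℝ) 1) := by
    have h1 : ContinuousOn (fun p : ℂ × ℝ => g (p.2 * p.1))
        (Metric.closedBall z ε ×ˢ Icc (0 : ℝ) 1) :=
      hg.continuousOn.comp hcm.continuousOn hmaps
    have h2 : ContinuousOn (fun p : ℂ × ℝ => deriv g (p.2 * p.1))
        (Metric.closedBall z ε ×ˢ Icc (0 : ℝ) 1) := hg'.comp hcm.continuousOn hmaps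
    exact h1.add (continuousOn_fst.mul
      ((Complex.continuous_ofReal.comp continuous_snd).continuousOn.mul h2))
  obtain ⟨C, hC⟩ := ((isCompact_closedBall z ε).prod isCompact_Icc).exists_bound_of_continuousOn hF'
  have hslice : ∀ w ∈ Metric.closedBall z ε,
      ContinuousOn (fun t : ℝ => w * g (t * w)) (Icc 0 1) := fun w hw =>
    continuousOn_const.mul (hg.continuousOn.comp (by fun_prop) fun t ht => hmaps (w, t) ⟨hw, ht⟩)
  have hslice' : ContinuousOn (fun t : ℝ => g (t * z) + z * (t * deriv g (t * z))) (Icc 0 1) :=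
    hF'.comp (f := fun t : ℝ => (z, t)) (by fun_prop)
      fun t ht => ⟨Metric.mem_closedBall_self hε.le, ht⟩
  have hsub : uIoc (0 : ℝ) 1 ⊆ Icc 0 1 := by
    rw [uIoc_of_le zero_le_one]; exact Ioc_subset_Icc_self
  have hmain := (intervalIntegral.hasDerivAt_integral_of_dominated_loc_of_deriv_le
    (μ := volume) (a := 0) (b := 1) (F := fun (w : ℂ) (t : ℝ) => w * g (t * w))
    (F' := fun (w : ℂ) (t : ℝ) => g (t * w) + w * (t * deriv g (t * w)))
    (bound := fun _ => C) (Metric.closedBall_mem_nhds z hε)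
    (by
      filter_upwards [Metric.closedBall_mem_nhds z hε] with w hw
      exact ((hslice w hw).mono hsub).aestronglyMeasurable measurableSet_uIoc)
    ((hslice z (Metric.mem_closedBall_self hε.le)).intervalIntegrable_of_Icc zero_le_one)
    ((hslice'.mono hsub).aestronglyMeasurable measurableSet_uIoc)
    (Eventually.of_forall fun t ht w hw => hC (w, t) ⟨hw, hsub ht⟩)
    intervalIntegrable_const
    (Eventually.of_forall fun t ht w hw => by
      have hgd : HasDerivAt g (deriv g (t * w)) (t * w) :=
        (hg.differentiableAt (hU.mem_nhds (hmaps (w, t) ⟨hw, hsub ht⟩))).hasDerivAt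
      have h1 : HasDerivAt (fun w : ℂ => (t : ℂ) * w) t w := by
        simpa using (hasDerivAt_id w).const_mul (t : ℂ)
      have := (hasDerivAt_id w).mul (hgd.comp w h1)
      refine this.congr_deriv ?_
      simp only [Function.comp_apply, id, one_mul]
      ring)).2
  -- The integrand is the t-derivative of t g(tz), so the integral is g(z).
  have hint : ∫ t in (0 : ℝ)..1, (g (t * z) + z * (t * deriv g (t * z))) = g z := by
    have hd : ∀ t ∈ uIcc (0 : ℝ) 1, HasDerivAt (fun t : ℝ => (t : ℂ) * g (t * z))
        (g (t * z) + z * (t * deriv g (t * z))) t := by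
      intro t ht
      rw [uIcc_of_le zero_le_one] at ht
      have hgd : HasDerivAt g (deriv g (t * z)) (t * z) :=
        (hg.differentiableAt (hU.mem_nhds (hstar z hz t ht))).hasDerivAt
      have h0 : HasDerivAt (fun t : ℝ => (t : ℂ)) 1 t := Complex.ofRealCLM.hasDerivAt
      have h1 : HasDerivAt (fun t : ℝ => (t : ℂ) * z) z t := by simpa using h0.mul_const z
      refine (h0.mul (hgd.comp t h1)).congr_deriv ?_
      simp; ring
    rw [intervalIntegral.integral_eq_sub_of_hasDerivAt hd
      (hslice'.intervalIntegrable_of_Icc zero_le_one)]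
    simp
  rwa [hint] at hmain

/-- The plane cut along `[1, ∞)`. -/
def cutPlane : Set ℂ := {z | 1 - z ∈ slitPlane}

theorem isOpen_cutPlane : IsOpen cutPlane :=
  isOpen_slitPlane.preimage (continuous_const.sub continuous_id)

theorem mem_cutPlane_iff {z : ℂ} : z ∈ cutPlane ↔ z.re < 1 ∨ z.im ≠ 0 := by
  simp [cutPlane, mem_slitPlane_iff]

theorem mem_cutPlane_of_norm_lt_one {z : ℂ} (hz : ‖z‖ < 1) : z ∈ cutPlane :=
  mem_cutPlane_iff.2 (Or.inl ((re_le_norm z).trans_lt hz))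

theorem zero_mem_cutPlane : (0 : ℂ) ∈ cutPlane := mem_cutPlane_of_norm_lt_one (by simp)

theorem cutPlane_star (z : ℂ) (hz : z ∈ cutPlane) (t : ℝ) (ht : t ∈ Icc (0 : ℝ) 1) :
    (t : ℂ) * z ∈ cutPlane := by
  rw [mem_cutPlane_iff] at hz ⊢
  rcases ht.1.eq_or_lt with rfl | h0
  · left; simp
  · rcases hz with h | h
    · left
      simp only [re_ofReal_mul]
      rcases le_or_gt z.re 0 with h' | h'
      · exact (mul_nonpos_of_nonneg_of_nonpos h0.le h').trans_lt one_pos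
      · exact (mul_le_of_le_one_left h'.le ht.2).trans_lt h
    · right
      simp [h0.ne', h]

/-- The polylogarithm `Li_{n+1}`, continued to the plane cut along `[1, ∞)`. -/
noncomputable def polylog : ℕ → ℂ → ℂ
  | 0, z => -log (1 - z)
  | n + 1, z => ∫ t in (0 : ℝ)..1, z * dslope (polylog n) 0 (t * z)

theorem polylog_apply_zero (n : ℕ) : polylog n 0 = 0 := by
  cases n <;> simp [polylog]

theorem differentiableOn_polylog (n : ℕ) : DifferentiableOn ℂ (polylog n) cutPlane := by
  induction n with
  | zero =>
    intro z hz
    exact ((differentiableAt_const _).sub differentiableAt_id).clog hz |>.neg.differentiableWithinAt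
  | succ n ih =>
    -- As `polylog n` vanishes at 0, this `dslope` is `polylog n z / z` with its removable
    -- singularity filled in, so it is holomorphic on the whole cut plane.
    have hds : DifferentiableOn ℂ (dslope (polylog n) 0) cutPlane :=
      (differentiableOn_dslope (isOpen_cutPlane.mem_nhds zero_mem_cutPlane)).2 ih
    exact fun z hz => (hasDerivAt_ray_integral isOpen_cutPlane cutPlane_star hds
      hz).differentiableAt.differentiableWithinAt

theorem hasDerivAt_polylog_succ (n : ℕ) {z : ℂ} (hz : z ∈ cutPlane) (h0 : z ≠ 0) :
    HasDerivAt (polylog (n + 1)) (polylog n z / z) z := by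
  have hds : DifferentiableOn ℂ (dslope (polylog n) 0) cutPlane :=
    (differentiableOn_dslope (isOpen_cutPlane.mem_nhds zero_mem_cutPlane)).2
      (differentiableOn_polylog n)
  have h := hasDerivAt_ray_integral isOpen_cutPlane cutPlane_star hds hz
  rw [dslope_of_ne _ h0, slope_def_field, polylog_apply_zero, sub_zero,
    sub_zero] at h
  exact h

theorem continuousAt_polylog (n : ℕ) {z : ℂ} (hz : z ∈ cutPlane) : ContinuousAt (polylog n) z :=
  ((differentiableOn_polylog n).differentiableAt (isOpen_cutPlane.mem_nhds hz)).continuousAt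

/-- Inside the unit disc the continued polylogarithm is the sum of the series. -/
theorem polylog_eq_Li (n : ℕ) {z : ℂ} (hz : ‖z‖ < 1) : polylog n z = Li (n + 1) z := by
  induction n generalizing z with
  | zero =>
    have h := (hasSum_taylorSeries_neg_log hz)
    rw [← hasSum_nat_add_iff' 1] at h
    simpa [polylog, Li] using h.tsum_eq.symm
  | succ n ih =>
    rcases eq_or_ne z 0 with rfl | hz0
    · simp [polylog_apply_zero, Li]
    have hlt : ∀ t ∈ uIoc (0 : ℝ) 1, ‖(t : ℂ) * z‖ < 1 ∧ (t : ℂ) * z ≠ 0 := by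
      intro t ht
      rw [uIoc_of_le zero_le_one] at ht
      refine ⟨?_, mul_ne_zero (by exact_mod_cast ht.1.ne') hz0⟩
      rw [norm_mul, norm_real, Real.norm_eq_abs, abs_of_pos ht.1]
      exact (mul_le_of_le_one_left (norm_nonneg z) ht.2).trans_lt hz
    -- Termwise integration of the power series along the ray, dominated by the geometric series in
    -- ‖z‖.
    have hsum : HasSum (fun k : ℕ => ∫ t in (0 : ℝ)..1,
        (z ^ (k + 1) / ((k + 1 : ℕ) : ℂ) ^ (n + 1)) * (t : ℂ) ^ k)
        (∫ t in (0 : ℝ)..1, z * dslope (polylog n) 0 (t * z)) := by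
      refine intervalIntegral.hasSum_integral_of_dominated_convergence
        (fun k _ => ‖z‖ ^ (k + 1)) (fun k => ?_) (fun k => ?_) ?_ ?_ ?_
      · exact (by fun_prop : Continuous fun t : ℝ =>
          (z ^ (k + 1) / ((k + 1 : ℕ) : ℂ) ^ (n + 1)) * (t : ℂ) ^ k).aestronglyMeasurable
      · refine Eventually.of_forall fun t ht => ?_
        rw [uIoc_of_le zero_le_one] at ht
        rw [norm_mul, norm_div, norm_pow, norm_pow, norm_pow, norm_natCast, norm_real,
          Real.norm_eq_abs, abs_of_pos ht.1]
        have h1 : (1 : ℝ) ≤ ((k + 1 : ℕ) : ℝ) ^ (n + 1) :=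
          one_le_pow₀ (by push_cast; linarith [k.cast_nonneg (α := ℝ)])
        calc ‖z‖ ^ (k + 1) / ((k + 1 : ℕ) : ℝ) ^ (n + 1) * t ^ k
            ≤ ‖z‖ ^ (k + 1) * 1 := mul_le_mul (div_le_self (by positivity) h1)
              (pow_le_one₀ ht.1.le ht.2) (pow_nonneg ht.1.le _) (by positivity)
          _ = _ := mul_one _
      · exact Eventually.of_forall fun t _ =>
          (summable_nat_add_iff 1).2 (summable_geometric_of_lt_one (norm_nonneg z) hz)
      · exact intervalIntegrable_const
      · refine Eventually.of_forall fun t ht => ?_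
        obtain ⟨h1, h2⟩ := hlt t ht
        have ht0 : (t : ℂ) ≠ 0 := left_ne_zero_of_mul h2
        rw [dslope_of_ne _ h2, slope_def_field, polylog_apply_zero, ih h1, sub_zero, sub_zero]
        have := ((summable_Li (n + 1) h1).hasSum.div_const ((t : ℂ) * z)).mul_left z
        refine this.congr_fun fun k => ?_
        rw [mul_pow]
        field_simp
        ring
    rw [polylog, Li, ← hsum.tsum_eq]
    refine tsum_congr fun k => ?_
    rw [intervalIntegral.integral_const_mul]
    have : ∫ t in (0 : ℝ)..1, (t : ℂ) ^ k = 1 / ((k + 1 : ℕ) : ℂ) := by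
      have := integral_pow (a := 0) (b := 1) k
      have h2 : ∫ t in (0 : ℝ)..1, (t : ℂ) ^ k = ((∫ t in (0 : ℝ)..1, t ^ k : ℝ) : ℂ) := by
        rw [← intervalIntegral.integral_ofReal]; simp
      rw [h2, this]; simp
    rw [this, pow_succ _ (n + 1), mul_one_div, div_div]

theorem continuousOn_Li {n : ℕ} (hn : 2 ≤ n) : ContinuousOn (Li n) (Metric.closedBall 0 1) := by
  have h0 : Summable fun k : ℕ => 1 / ((k + 1 : ℕ) : ℝ) ^ n :=
    (summable_nat_add_iff 1).2 (Real.summable_one_div_nat_pow.2 hn)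
  refine continuousOn_tsum (fun k => by fun_prop) h0 fun k z hz => ?_
  rw [norm_div, norm_pow, norm_pow, norm_natCast]
  have : ‖z‖ ≤ 1 := by simpa using hz
  gcongr
  exact pow_le_one₀ (norm_nonneg z) this

theorem summable_Li_closedBall {n : ℕ} (hn : 2 ≤ n) {z : ℂ} (hz : ‖z‖ ≤ 1) :
    Summable fun k : ℕ => z ^ (k + 1) / ((k + 1 : ℕ) : ℂ) ^ n := by
  refine Summable.of_norm_bounded (g := fun k : ℕ => 1 / ((k + 1 : ℕ) : ℝ) ^ n)
    ((summable_nat_add_iff 1).2 (Real.summable_one_div_nat_pow.2 hn)) fun k => ?_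
  rw [norm_div, norm_pow, norm_pow, norm_natCast]
  gcongr
  exact pow_le_one₀ (norm_nonneg z) hz

/-- The continued polylogarithm agrees with the series on the closed disc, away from `1`. -/
theorem polylog_eq_Li_of_norm_le_one {n : ℕ} (hn : 1 ≤ n) {z : ℂ} (hz : ‖z‖ ≤ 1)
    (hz1 : z ∈ cutPlane) : polylog n z = Li (n + 1) z := by
  -- Radial limit: the continuation is continuous at z because z is off the cut, the series because
  -- it converges uniformly on the closed disc. Inside the disc the two agree.
  have h1 : Tendsto (fun t : ℝ => polylog n (t * z)) (𝓝[<] 1) (𝓝 (polylog n z)) := by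
    have : Tendsto (fun t : ℝ => (t : ℂ) * z) (𝓝[<] 1) (𝓝 z) := by
      have h : Continuous fun t : ℝ => (t : ℂ) * z := by fun_prop
      simpa using (h.tendsto 1).mono_left nhdsWithin_le_nhds
    exact (continuousAt_polylog n hz1).tendsto.comp this
  have hmem : ∀ᶠ t : ℝ in 𝓝[<] 1, ‖(t : ℂ) * z‖ < 1 := by
    filter_upwards [Ioo_mem_nhdsLT (zero_lt_one' ℝ)] with t ht
    rw [norm_mul, norm_real, Real.norm_eq_abs, abs_of_pos ht.1]
    exact (mul_le_of_le_one_right ht.1.le hz).trans_lt ht.2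
  have h2 : Tendsto (fun t : ℝ => Li (n + 1) (t * z)) (𝓝[<] 1) (𝓝 (Li (n + 1) z)) := by
    have hc := continuousOn_Li (n := n + 1) (by omega) z (by simpa using hz)
    refine hc.tendsto.comp (tendsto_nhdsWithin_iff.2 ⟨?_, ?_⟩)
    · have h : Continuous fun t : ℝ => (t : ℂ) * z := by fun_prop
      simpa using (h.tendsto 1).mono_left nhdsWithin_le_nhds
    · filter_upwards [hmem] with t ht
      simpa using ht.le
  refine tendsto_nhds_unique (h1.congr' ?_) h2
  filter_upwards [hmem] with t ht
  exact polylog_eq_Li n ht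

/-! ### Kummer's functional equation for the tetralogarithm -/

/-- Derivatives are required only in the open interval: along a ray from the origin the derivatives
of polylogarithms are found through n/t, which is singular at t = 0. Continuity covers the
endpoints. -/
theorem eqOn_Icc_of_hasDerivAt_eq {F G F' : ℝ → ℂ} (hF : ContinuousOn F (Icc 0 1))
    (hG : ContinuousOn G (Icc 0 1)) (h0 : F 0 = G 0)
    (hF' : ∀ t ∈ Ioo (0 : ℝ) 1, HasDerivAt F (F' t) t)
    (hG' : ∀ t ∈ Ioo (0 : ℝ) 1, HasDerivAt G (F' t) t) : EqOn F G (Icc 0 1) := by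
  intro t ht
  have hsub : Icc 0 t ⊆ Icc (0 : ℝ) 1 := Icc_subset_Icc_right ht.2
  have h := intervalIntegral.integral_eq_sub_of_hasDeriv_right_of_le (f' := fun _ => (0 : ℂ))
    ht.1 ((hF.sub hG).mono hsub) (fun s hs => by
      have hs' : s ∈ Ioo (0 : ℝ) 1 := ⟨hs.1, hs.2.trans_le ht.2⟩
      simpa using ((hF' s hs').sub (hG' s hs')).hasDerivWithinAt (s := Ioi s))
    intervalIntegrable_const
  simp only [intervalIntegral.integral_zero, Pi.sub_apply, h0, sub_self, sub_zero] at h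
  exact sub_eq_zero.1 h.symm

/-- Two continuous logarithms of the same path agree if they agree at the start. -/
theorem eqOn_Icc_of_exp_eq {F G : ℝ → ℂ} (hF : ContinuousOn F (Icc 0 1))
    (hG : ContinuousOn G (Icc 0 1)) (h0 : F 0 = G 0)
    (hexp : ∀ t ∈ Icc (0 : ℝ) 1, exp (F t) = exp (G t)) : EqOn F G (Icc 0 1) := by
  have hc : ContinuousOn (fun t => ((F t - G t) / (2 * Real.pi * I)).re) (Icc 0 1) :=
    continuous_re.comp_continuousOn ((hF.sub hG).div_const _)
  have hint : ∀ t ∈ Icc (0 : ℝ) 1, ∃ n : ℤ, F t - G t = n * (2 * Real.pi * I) := by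
    intro t ht
    obtain ⟨n, hn⟩ := Complex.exp_eq_exp_iff_exists_int.1 (hexp t ht)
    exact ⟨n, by rw [hn]; ring⟩
  -- The difference divided by 2πi is an integer, and a continuous map from an interval to a
  -- discrete set is constant.
  have hmaps : MapsTo (fun t => ((F t - G t) / (2 * Real.pi * I)).re) (Icc 0 1)
      (range ((↑) : ℤ → ℝ)) := by
    intro t ht
    obtain ⟨n, hn⟩ := hint t ht
    refine ⟨n, ?_⟩
    simp only [hn, mul_div_cancel_right₀ _ two_pi_I_ne_zero, intCast_re]
  intro t ht
  obtain ⟨n, hn⟩ := hint t ht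
  have hdisc : IsDiscrete (range ((↑) : ℤ → ℝ)) := Int.isClosedEmbedding_coe_real.isDiscrete_range
  have := isPreconnected_Icc.constant_of_mapsTo hdisc hc hmaps
    ht (left_mem_Icc.2 zero_le_one)
  simp only [hn, h0, sub_self, zero_div, zero_re, mul_div_cancel_right₀ _ two_pi_I_ne_zero,
    intCast_re, Int.cast_eq_zero] at this
  rw [this] at hn
  simpa [sub_eq_zero] using hn

/-- If the arguments `f i` are monomials in `t`, `exp u` and `exp v`, the derivative of a linear
combination of polylogarithms of order `m + 2` is made up of combinations of order `m + 1`. -/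
theorem sum_polylog_eqOn {ι : Type*} [Fintype ι] {f : ι → ℝ → ℂ} {n γ δ w : ι → ℂ}
    {u' v' Q Qu Qv : ℝ → ℂ} (m : ℕ)
    (hfc : ∀ i, ContinuousOn (f i) (Icc 0 1)) (hf0 : ∀ i, f i 0 = 0)
    (hfm : ∀ i, ∀ t ∈ Icc (0 : ℝ) 1, f i t ∈ cutPlane)
    (hfn : ∀ i, ∀ t ∈ Ioo (0 : ℝ) 1, f i t ≠ 0)
    (hf' : ∀ i, ∀ t ∈ Ioo (0 : ℝ) 1,
      HasDerivAt (f i) (f i t * (n i / t + γ i * u' t + δ i * v' t)) t)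
    (hQc : ContinuousOn Q (Icc 0 1)) (hQ0 : Q 0 = 0)
    (hQ' : ∀ t ∈ Ioo (0 : ℝ) 1, HasDerivAt Q (Qu t * u' t + Qv t * v' t) t)
    (hn : EqOn (fun t => ∑ i, w i * n i * polylog m (f i t)) (fun _ => 0) (Icc 0 1))
    (hu : EqOn (fun t => ∑ i, w i * γ i * polylog m (f i t)) Qu (Icc 0 1))
    (hv : EqOn (fun t => ∑ i, w i * δ i * polylog m (f i t)) Qv (Icc 0 1)) :
    EqOn (fun t => ∑ i, w i * polylog (m + 1) (f i t)) Q (Icc 0 1) := by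
  refine eqOn_Icc_of_hasDerivAt_eq (F' := fun t => Qu t * u' t + Qv t * v' t) ?_ hQc ?_ ?_ hQ'
  · refine continuousOn_finsetSum _ fun i _ => continuousOn_const.mul ?_
    exact (differentiableOn_polylog (m + 1)).continuousOn.comp (hfc i) (hfm i)
  · simp [hf0, polylog_apply_zero, hQ0]
  · intro t ht
    have htI := Ioo_subset_Icc_self ht
    have hsum : HasDerivAt (fun t => ∑ i, w i * polylog (m + 1) (f i t))
        (∑ i, w i * (polylog m (f i t) / f i t * (f i t * (n i / t + γ i * u' t + δ i * v' t)))) t :=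
      HasDerivAt.fun_sum fun i _ =>
        ((hasDerivAt_polylog_succ m (hfm i t htI) (hfn i t ht)).comp t (hf' i t ht)).const_mul _
    refine hsum.congr_deriv ?_
    have e1 := hn htI
    have e2 := hu htI
    have e3 := hv htI
    simp only at e1 e2 e3
    -- The factor f cancels, which leaves the logarithmic derivative; the three hypotheses evaluate
    -- the coefficients of 1/t, u' and v'.
    have : ∀ i, w i * (polylog m (f i t) / f i t * (f i t * (n i / t + γ i * u' t + δ i * v' t)))
        = w i * n i * polylog m (f i t) * (t : ℂ)⁻¹ + w i * γ i * polylog m (f i t) * u' t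
          + w i * δ i * polylog m (f i t) * v' t := by
      intro i
      have := hfn i t ht
      field_simp
    simp only [this, Finset.sum_add_distrib, ← Finset.sum_mul, e1, e2, e3]
    ring

/-- The arguments in Kummer's functional equation. -/
noncomputable def kummerArg (x y : ℂ) : Fin 20 → ℂ :=
  ![-(x ^ 2 * y * (1 - y) / (1 - x)), -(y ^ 2 * x * (1 - x) / (1 - y)),
    x ^ 2 * y / ((1 - y) ^ 2 * (1 - x)), y ^ 2 * x / ((1 - x) ^ 2 * (1 - y)),
    x * y, x * y / ((1 - x) * (1 - y)), -(x * y / (1 - y)), -(x * y / (1 - x)),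
    x * (1 - y), y * (1 - x), x / (1 - y), y / (1 - x),
    -(x * (1 - y) / (1 - x)), -(y * (1 - x) / (1 - y)),
    -(x / ((1 - x) * (1 - y))), -(y / ((1 - x) * (1 - y))),
    x, y, -(x / (1 - x)), -(y / (1 - y))]

/-- The coefficients in Kummer's functional equation. -/
def kummerCoeff : Fin 20 → ℤ :=
  ![1, 1, 1, 1, -6, -6, -6, -6, -3, -3, -3, -3, -3, -3, -3, -3, 6, 6, 6, 6]

/-- The total degrees in `x` and `y` of the arguments. -/
def kummerDeg : Fin 20 → ℕ :=
  ![3, 3, 3, 3, 2, 2, 2, 2, 1, 1, 1, 1, 1, 1, 1, 1, 1, 1, 1, 1]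

/-- The exponents of `1 - x` in the arguments. -/
def kummerXi : Fin 20 → ℤ :=
  ![-1, 1, -1, -2, 0, -1, 0, -1, 0, 1, 0, -1, -1, 1, -1, -1, 0, 0, -1, 0]

/-- The exponents of `1 - y` in the arguments. -/
def kummerEta : Fin 20 → ℤ :=
  ![1, -1, -2, -1, 0, -1, -1, 0, 1, 0, -1, 0, 1, -1, -1, -1, 0, 0, 0, -1]

/-- The constant factors of the arguments along the ray `(t x, t y)`. -/
def kummerLead (x y : ℂ) : Fin 20 → ℂ :=
  ![-(x ^ 2 * y), -(y ^ 2 * x), x ^ 2 * y, y ^ 2 * x, x * y, x * y, -(x * y), -(x * y),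
    x, y, x, y, -x, -y, -x, -y, x, y, -x, -y]

/-- The exponents of `1 - x y`, `1 - x - y`, `1 - x + x y`, `1 - y + x y`, `1 - x`, `1 - y` in the
factorizations of `1 - z`, where `z` runs through the arguments. -/
def kummerFactor : Fin 20 → Fin 6 → ℤ :=
  ![![1, 0, 1, 0, -1, 0], ![1, 0, 0, 1, 0, -1], ![0, 1, 0, 1, -1, -2], ![0, 1, 1, 0, -2, -1],
    ![1, 0, 0, 0, 0, 0], ![0, 1, 0, 0, -1, -1], ![0, 0, 0, 1, 0, -1], ![0, 0, 1, 0, -1, 0],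
    ![0, 0, 1, 0, 0, 0], ![0, 0, 0, 1, 0, 0], ![0, 1, 0, 0, 0, -1], ![0, 1, 0, 0, -1, 0],
    ![1, 0, 0, 0, -1, 0], ![1, 0, 0, 0, 0, -1], ![0, 0, 0, 1, -1, -1], ![0, 0, 1, 0, -1, -1],
    ![0, 0, 0, 0, 1, 0], ![0, 0, 0, 0, 0, 1], ![0, 0, 0, 0, -1, 0], ![0, 0, 0, 0, 0, -1]]

/-- In this factored form the logarithmic derivative in t has constant coefficients, as
`sum_polylog_eqOn` requires. -/
theorem kummerArg_ray (x y : ℂ) (t : ℝ) (i : Fin 20) :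
    kummerArg (t * x) (t * y) i = kummerLead x y i * (t : ℂ) ^ kummerDeg i *
      (1 - t * x) ^ kummerXi i * (1 - t * y) ^ kummerEta i := by
  fin_cases i <;> simp [kummerArg, kummerLead, kummerDeg, kummerXi, kummerEta, zpow_neg,
    div_eq_mul_inv, -mul_eq_mul_right_iff, -mul_eq_mul_left_iff] <;> ring

/-- Since every 1 - z factors over the same six polynomials, the weight-one functions -log(1-z) are
integer combinations of six logarithms, and the functional equation becomes integer linear algebra.
-/
theorem one_sub_kummerArg (x y : ℂ) (hx : 1 - x ≠ 0) (hy : 1 - y ≠ 0) (i : Fin 20) :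
    1 - kummerArg x y i = (1 - x * y) ^ kummerFactor i 0 * (1 - x - y) ^ kummerFactor i 1 *
      (1 - x + x * y) ^ kummerFactor i 2 * (1 - y + x * y) ^ kummerFactor i 3 *
      (1 - x) ^ kummerFactor i 4 * (1 - y) ^ kummerFactor i 5 := by
  fin_cases i <;> simp [kummerArg, kummerFactor, zpow_neg] <;> field_simp <;> ring

/-- Kummer's functional equation for the tetralogarithm, along a ray on which none of the arguments
meets the cut `[1, ∞)`. -/
theorem kummer_tetralog {x y : ℂ} (hx : x ≠ 0) (hy : y ≠ 0)
    (hmem : ∀ t ∈ Icc (0 : ℝ) 1, ∀ i, kummerArg (t * x) (t * y) i ∈ cutPlane) :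
    ∑ i, (kummerCoeff i : ℂ) * polylog 3 (kummerArg x y i)
      = 3 / 2 * log (1 - x) ^ 2 * log (1 - y) ^ 2 := by
  set f : Fin 20 → ℝ → ℂ := fun i t => kummerArg (t * x) (t * y) i with hf
  set u : ℝ → ℂ := fun t => log (1 - t * x) with hu
  set v : ℝ → ℂ := fun t => log (1 - t * y) with hv
  have hxs : ∀ t ∈ Icc (0 : ℝ) 1, 1 - t * x ∈ slitPlane := fun t ht => hmem t ht 16
  have hys : ∀ t ∈ Icc (0 : ℝ) 1, 1 - t * y ∈ slitPlane := fun t ht => hmem t ht 17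
  have hx0 : ∀ t ∈ Icc (0 : ℝ) 1, 1 - t * x ≠ 0 := fun t ht => slitPlane_ne_zero (hxs t ht)
  have hy0 : ∀ t ∈ Icc (0 : ℝ) 1, 1 - t * y ≠ 0 := fun t ht => slitPlane_ne_zero (hys t ht)
  have hlin : ∀ (z : ℂ) (t : ℝ), HasDerivAt (fun t : ℝ => 1 - (t : ℂ) * z) (-z) t := by
    intro z t
    have h0 : HasDerivAt (fun t : ℝ => (t : ℂ)) 1 t := Complex.ofRealCLM.hasDerivAt
    simpa using (h0.mul_const z).const_sub 1
  have hfc : ∀ i, ContinuousOn (f i) (Icc 0 1) := by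
    intro i
    simp only [hf, kummerArg_ray]
    refine ContinuousOn.mul (ContinuousOn.mul (by fun_prop) ?_) ?_
    · exact ContinuousOn.zpow₀ (by fun_prop) _ fun t ht => Or.inl (hx0 t ht)
    · exact ContinuousOn.zpow₀ (by fun_prop) _ fun t ht => Or.inl (hy0 t ht)
  have hf0 : ∀ i, f i 0 = 0 := by
    intro i; fin_cases i <;> simp [hf, kummerArg]
  have hfm : ∀ i, ∀ t ∈ Icc (0 : ℝ) 1, f i t ∈ cutPlane := fun i t ht => hmem t ht i
  have hfn : ∀ i, ∀ t ∈ Ioo (0 : ℝ) 1, f i t ≠ 0 := by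
    intro i t ht
    have htI := Ioo_subset_Icc_self ht
    have ht0 : (t : ℂ) ≠ 0 := by exact_mod_cast ht.1.ne'
    have hlead : kummerLead x y i ≠ 0 := by
      fin_cases i <;> simp [kummerLead, hx, hy]
    simp only [hf, kummerArg_ray]
    exact mul_ne_zero (mul_ne_zero (mul_ne_zero hlead (pow_ne_zero _ ht0))
      (zpow_ne_zero _ (hx0 t htI))) (zpow_ne_zero _ (hy0 t htI))
  have hf' : ∀ i, ∀ t ∈ Ioo (0 : ℝ) 1, HasDerivAt (f i) (f i t * ((kummerDeg i : ℂ) / t +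
      (kummerXi i : ℂ) * (-x / (1 - t * x)) + (kummerEta i : ℂ) * (-y / (1 - t * y)))) t := by
    intro i t ht
    have htI := Ioo_subset_Icc_self ht
    have ht0 : (t : ℂ) ≠ 0 := by exact_mod_cast ht.1.ne'
    have h0 : HasDerivAt (fun t : ℝ => (t : ℂ)) 1 t := Complex.ofRealCLM.hasDerivAt
    have h1 := (h0.fun_pow (kummerDeg i)).const_mul (kummerLead x y i)
    have h2 := (hasDerivAt_zpow (kummerXi i) _ (Or.inl (hx0 t htI))).comp t (hlin x t)
    have h3 := (hasDerivAt_zpow (kummerEta i) _ (Or.inl (hy0 t htI))).comp t (hlin y t)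
    have h4 := (h1.mul h2).mul h3
    have hpow : (kummerDeg i : ℂ) * (t : ℂ) ^ (kummerDeg i - 1) =
        (t : ℂ) ^ kummerDeg i * (kummerDeg i / t) := by
      rcases Nat.eq_zero_or_pos (kummerDeg i) with h | h
      · simp [h]
      · obtain ⟨k, hk⟩ := Nat.exists_eq_succ_of_ne_zero h.ne'
        rw [hk]; field_simp; simp [pow_succ]
    refine (h4.congr_of_eventuallyEq ?_).congr_deriv ?_
    · exact Eventually.of_forall fun s => kummerArg_ray x y s i
    · simp only [hf, kummerArg_ray, Function.comp_apply, Pi.mul_apply, zpow_sub_one₀ (hx0 t htI),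
        zpow_sub_one₀ (hy0 t htI), hpow, mul_one]
      ring
  have huc : ContinuousOn u (Icc 0 1) := ContinuousOn.clog (by fun_prop) hxs
  have hvc : ContinuousOn v (Icc 0 1) := ContinuousOn.clog (by fun_prop) hys
  have hu0 : u 0 = 0 := by simp [hu]
  have hv0 : v 0 = 0 := by simp [hv]
  have hu' : ∀ t ∈ Ioo (0 : ℝ) 1, HasDerivAt u (-x / (1 - t * x)) t := fun t ht =>
    (hlin x t).clog_real (hxs t (Ioo_subset_Icc_self ht))
  have hv' : ∀ t ∈ Ioo (0 : ℝ) 1, HasDerivAt v (-y / (1 - t * y)) t := fun t ht =>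
    (hlin y t).clog_real (hys t (Ioo_subset_Icc_self ht))
  have hlogc : ∀ i, ContinuousOn (fun t => log (1 - f i t)) (Icc 0 1) := fun i =>
    ContinuousOn.clog (continuousOn_const.sub (hfc i)) fun t ht => hmem t ht i
  set p : ℝ → ℂ := fun t => log (1 - f 4 t) with hp
  -- A continuous logarithm of 1 - x - y along the ray. Argument 10 satisfies 1 - z = (1-x-y)/(1-y),
  -- so no assumption that 1 - x - y avoids the cut is needed.
  set q : ℝ → ℂ := fun t => log (1 - f 10 t) + v t with hq
  set r : ℝ → ℂ := fun t => log (1 - f 8 t) with hr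
  set s : ℝ → ℂ := fun t => log (1 - f 9 t) with hs
  have hne : ∀ i, ∀ t ∈ Icc (0 : ℝ) 1, 1 - f i t ≠ 0 := fun i t ht =>
    slitPlane_ne_zero (hmem t ht i)
  -- The factorization lifts to logarithms without multiples of 2πi, because both sides are
  -- continuous and vanish at t = 0.
  have hlog : ∀ i, EqOn (fun t => log (1 - f i t)) (fun t => kummerFactor i 0 * p t +
      kummerFactor i 1 * q t + kummerFactor i 2 * r t + kummerFactor i 3 * s t +
      kummerFactor i 4 * u t + kummerFactor i 5 * v t) (Icc 0 1) := by
    intro i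
    have hpc := hlogc 4
    have hqc := (hlogc 10).add hvc
    have hrc := hlogc 8
    have hsc := hlogc 9
    refine eqOn_Icc_of_exp_eq (hlogc i) ?_ ?_ ?_
    · exact (((((continuousOn_const.mul hpc).add (continuousOn_const.mul hqc)).add
        (continuousOn_const.mul hrc)).add (continuousOn_const.mul hsc)).add
        (continuousOn_const.mul huc)).add (continuousOn_const.mul hvc)
    · simp [hp, hq, hr, hs, hu0, hv0, hf0]
    · intro t ht
      have ep : exp (p t) = 1 - (t * x) * (t * y) := by
        rw [hp, exp_log (hne 4 t ht)]; simp [hf, kummerArg]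
      have eq : exp (q t) = 1 - t * x - t * y := by
        have := hy0 t ht
        rw [hq, exp_add, exp_log (hne 10 t ht), hv, exp_log this]
        simp [hf, kummerArg]; field_simp; ring
      have er : exp (r t) = 1 - t * x + (t * x) * (t * y) := by
        rw [hr, exp_log (hne 8 t ht)]; simp [hf, kummerArg]; ring
      have es : exp (s t) = 1 - t * y + (t * x) * (t * y) := by
        rw [hs, exp_log (hne 9 t ht)]; simp [hf, kummerArg]; ring
      have eu : exp (u t) = 1 - t * x := exp_log (hx0 t ht)
      have ev : exp (v t) = 1 - t * y := exp_log (hy0 t ht)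
      simp only [exp_add, exp_int_mul, ep, eq, er, es, eu, ev]
      rw [exp_log (hne i t ht)]
      exact one_sub_kummerArg _ _ (hx0 t ht) (hy0 t ht) i
  have hbase : ∀ (W : Fin 20 → ℤ) (T : Fin 6 → ℤ), (∀ j, ∑ i, W i * kummerFactor i j = T j) →
      ∀ t ∈ Icc (0 : ℝ) 1, ∑ i, (W i : ℂ) * polylog 0 (f i t) =
        -(T 0 * p t + T 1 * q t + T 2 * r t + T 3 * s t + T 4 * u t + T 5 * v t) := by
    intro W T hT t ht
    have hT' : ∀ j, ∑ i, (W i : ℂ) * kummerFactor i j = T j := fun j => by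
      rw [← hT j]; push_cast; rfl
    simp only [← hT', Finset.sum_mul, ← Finset.sum_add_distrib]
    rw [← Finset.sum_neg_distrib]
    refine Finset.sum_congr rfl fun i _ => ?_
    have h := hlog i ht
    simp only at h
    rw [polylog, h]
    ring
  have step := fun (m : ℕ) (w : Fin 20 → ℂ) (Q Qu Qv : ℝ → ℂ) =>
    sum_polylog_eqOn (f := f) (n := fun i => kummerDeg i) (γ := fun i => kummerXi i)
      (δ := fun i => kummerEta i) (w := w) (u' := fun t => -x / (1 - t * x))
      (v' := fun t => -y / (1 - t * y)) (Q := Q) (Qu := Qu) (Qv := Qv) m hfc hf0 hfm hfn hf'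
  have z0 : ContinuousOn (fun _ : ℝ => (0 : ℂ)) (Icc 0 1) := continuousOn_const
  have z1 : ∀ t ∈ Ioo (0 : ℝ) 1, HasDerivAt (fun _ : ℝ => (0 : ℂ))
      ((fun _ => 0) t * (-x / (1 - t * x)) + (fun _ => 0) t * (-y / (1 - t * y))) t := fun t _ => by
    simpa using hasDerivAt_const t (0 : ℂ)
  have base : ∀ (W : Fin 20 → ℤ) (a b : ℤ), (∀ j, ∑ i, W i * kummerFactor i j =
      ![0, 0, 0, 0, -a, -b] j) →
      EqOn (fun t => ∑ i, (W i : ℂ) * polylog 0 (f i t)) (fun t => a * u t + b * v t) (Icc 0 1) := by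
    intro W a b h t ht
    simp only [hbase W _ h t ht]
    simp
    ring
  -- Rows 0, 1, 2 are the exponents belonging to 1/t, u' and v'. Each differentiation multiplies the
  -- coefficients by one row.
  set e : Fin 3 → Fin 20 → ℤ := ![fun i => kummerDeg i, kummerXi, kummerEta] with he
  have third : ∀ a b c : Fin 3, ∀ A B : ℤ, (∀ j, ∑ i, kummerCoeff i * e a i * e b i * e c i *
      kummerFactor i j = ![0, 0, 0, 0, -A, -B] j) →
      EqOn (fun t => ∑ i, ((kummerCoeff i : ℂ) * e a i * e b i) * e c i * polylog 0 (f i t))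
        (fun t => A * u t + B * v t) (Icc 0 1) := by
    intro a b c A B h
    have := base (fun i => kummerCoeff i * e a i * e b i * e c i) A B h
    push_cast at this
    exact this
  have second : ∀ a b : Fin 3, ∀ A B C : ℤ,
      (∀ j, ∑ i, kummerCoeff i * e a i * e b i * e 0 i * kummerFactor i j =
        ![0, 0, 0, 0, -0, -0] j) →
      (∀ j, ∑ i, kummerCoeff i * e a i * e b i * e 1 i * kummerFactor i j =
        ![0, 0, 0, 0, -(2 * A), -B] j) →
      (∀ j, ∑ i, kummerCoeff i * e a i * e b i * e 2 i * kummerFactor i j =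
        ![0, 0, 0, 0, -B, -(2 * C)] j) →
      EqOn (fun t => ∑ i, (kummerCoeff i : ℂ) * e a i * e b i * polylog 1 (f i t))
        (fun t => A * u t ^ 2 + B * (u t * v t) + C * v t ^ 2) (Icc 0 1) := by
    intro a b A B C h0 h1 h2
    refine step 0 _ _ _ _ ?_ ?_ ?_ ?_ (third a b 1 _ _ h1) (third a b 2 _ _ h2)
    · exact ((continuousOn_const.mul (huc.pow 2)).add (continuousOn_const.mul (huc.mul hvc))).add
        (continuousOn_const.mul (hvc.pow 2))
    · simp [hu0, hv0]
    · intro t ht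
      have du := hu' t ht
      have dv := hv' t ht
      refine ((((du.fun_pow 2).const_mul (A : ℂ)).add ((du.mul dv).const_mul (B : ℂ))).add
        ((dv.fun_pow 2).const_mul (C : ℂ))).congr_deriv ?_
      push_cast
      ring
    · exact (third a b 0 0 0 h0).trans fun t _ => by simp
  -- The weight-two sums with a t-exponent vanish. The others are 3v², 6uv and 3u², the second
  -- partial derivatives of 3/2 u²v²; the next two steps integrate them back.
  have s01 := second 0 1 0 0 0 (by decide) (by decide) (by decide)
  have s02 := second 0 2 0 0 0 (by decide) (by decide) (by decide)
  have s10 := second 1 0 0 0 0 (by decide) (by decide) (by decide)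
  have s20 := second 2 0 0 0 0 (by decide) (by decide) (by decide)
  have s00 := second 0 0 0 0 0 (by decide) (by decide) (by decide)
  have s11 := second 1 1 0 0 3 (by decide) (by decide) (by decide)
  have s12 := second 1 2 0 6 0 (by decide) (by decide) (by decide)
  have s21 := second 2 1 0 6 0 (by decide) (by decide) (by decide)
  have s22 := second 2 2 3 0 0 (by decide) (by decide) (by decide)
  have first0 : EqOn (fun t => ∑ i, (kummerCoeff i : ℂ) * e 0 i * polylog 2 (f i t))
      (fun _ => 0) (Icc 0 1) :=
    step 1 _ _ (fun _ => 0) (fun _ => 0) z0 rfl z1 (s00.trans fun t _ => by simp)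
      (s01.trans fun t _ => by simp) (s02.trans fun t _ => by simp)
  have first1 : EqOn (fun t => ∑ i, (kummerCoeff i : ℂ) * e 1 i * polylog 2 (f i t))
      (fun t => 3 * (u t * v t ^ 2)) (Icc 0 1) := by
    refine step 1 _ _ _ _ ?_ ?_ ?_ (s10.trans fun t _ => by simp) s11 s12
    · exact continuousOn_const.mul (huc.mul (hvc.pow 2))
    · simp [hu0]
    · intro t ht
      refine (((hu' t ht).mul ((hv' t ht).fun_pow 2)).const_mul 3).congr_deriv ?_
      push_cast
      ring
  have first2 : EqOn (fun t => ∑ i, (kummerCoeff i : ℂ) * e 2 i * polylog 2 (f i t))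
      (fun t => 3 * (u t ^ 2 * v t)) (Icc 0 1) := by
    refine step 1 _ _ _ _ ?_ ?_ ?_ (s20.trans fun t _ => by simp) s21 s22
    · exact continuousOn_const.mul ((huc.pow 2).mul hvc)
    · simp [hu0]
    · intro t ht
      refine ((((hu' t ht).fun_pow 2).mul (hv' t ht)).const_mul 3).congr_deriv ?_
      push_cast
      ring
  have final : EqOn (fun t => ∑ i, (kummerCoeff i : ℂ) * polylog 3 (f i t))
      (fun t => 3 / 2 * (u t ^ 2 * v t ^ 2)) (Icc 0 1) := by
    refine step 2 _ _ _ _ ?_ ?_ ?_ first0 first1 first2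
    · exact continuousOn_const.mul ((huc.pow 2).mul (hvc.pow 2))
    · simp [hu0]
    · intro t ht
      refine ((((hu' t ht).fun_pow 2).mul ((hv' t ht).fun_pow 2)).const_mul (3 / 2)).congr_deriv ?_
      push_cast
      ring
  have h := final (right_mem_Icc.2 zero_le_one)
  simp only [hf, hu, hv, ofReal_one, one_mul] at h
  rw [h]
  ring

/-! ### Special values, duplication and inversion -/

theorem zeta_two : zeta 2 = Real.pi ^ 2 / 6 := by
  have h := hasSum_zeta_two
  rw [← hasSum_nat_add_iff' 1] at h
  simpa [zeta] using h.tsum_eq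

theorem zeta_four : zeta 4 = Real.pi ^ 4 / 90 := by
  have h := hasSum_zeta_four
  rw [← hasSum_nat_add_iff' 1] at h
  simpa [zeta] using h.tsum_eq

theorem Li_one_eq_zeta (n : ℕ) : Li n 1 = zeta n := by
  simp [Li, zeta, ofReal_tsum]

theorem Li_conj (n : ℕ) (z : ℂ) : Li n (conj z) = conj (Li n z) := by
  simp only [Li, conj_tsum]
  exact tsum_congr fun k => by simp

theorem Li_even_add_odd {n : ℕ} (hn : 2 ≤ n) {z : ℂ} (hz : ‖z‖ ≤ 1) :
    Li n z = ∑' k : ℕ, z ^ (2 * k + 1) / ((2 * k + 1 : ℕ) : ℂ) ^ n + Li n (z ^ 2) / 2 ^ n := by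
  have hs := summable_Li_closedBall hn hz
  set g : ℕ → ℂ := fun k => z ^ (k + 1) / ((k + 1 : ℕ) : ℂ) ^ n with hg
  have h1 : Summable fun k => g (2 * k) := hs.comp_injective (mul_right_injective₀ two_ne_zero)
  have h2 : Summable fun k => g (2 * k + 1) :=
    hs.comp_injective ((add_left_injective 1).comp (mul_right_injective₀ two_ne_zero))
  have h3 : Li n z = ∑' k, g (2 * k) + ∑' k, g (2 * k + 1) := (tsum_even_add_odd h1 h2).symm
  rw [h3, Li, ← tsum_div_const]
  congr 1
  refine tsum_congr fun k => ?_
  have : ((2 * k + 1 + 1 : ℕ) : ℂ) = 2 * ((k + 1 : ℕ) : ℂ) := by push_cast; ring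
  simp only [hg]
  rw [this, mul_pow, ← pow_mul, div_div, mul_comm (2 ^ n : ℂ)]
  ring_nf

/-- The duplication formula. -/
theorem Li_sq {n : ℕ} (hn : 2 ≤ n) {z : ℂ} (hz : ‖z‖ ≤ 1) :
    Li n z + Li n (-z) = 2 * (Li n (z ^ 2) / 2 ^ n) := by
  rw [Li_even_add_odd hn hz, Li_even_add_odd hn (z := -z) (by simpa using hz), neg_sq]
  have : ∑' k : ℕ, (-z) ^ (2 * k + 1) / ((2 * k + 1 : ℕ) : ℂ) ^ n =
      -∑' k : ℕ, z ^ (2 * k + 1) / ((2 * k + 1 : ℕ) : ℂ) ^ n := by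
    rw [← tsum_neg]
    refine tsum_congr fun k => ?_
    rw [Odd.neg_pow ⟨k, rfl⟩, neg_div]
  rw [this]
  ring

theorem Li_four_sq {z : ℂ} (hz : ‖z‖ ≤ 1) : Li 4 (z ^ 2) = 8 * (Li 4 z + Li 4 (-z)) := by
  rw [Li_sq (by norm_num) hz]; ring

theorem Li_two_neg_one : Li 2 (-1) = -(Real.pi : ℂ) ^ 2 / 12 := by
  have h := Li_sq (n := 2) le_rfl (z := 1) (by simp)
  rw [one_pow, Li_one_eq_zeta, zeta_two] at h
  push_cast at h
  linear_combination h

theorem Li_four_neg_one : Li 4 (-1) = -7 * (Real.pi : ℂ) ^ 4 / 720 := by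
  have h := Li_sq (n := 4) (by norm_num) (z := 1) (by simp)
  rw [one_pow, Li_one_eq_zeta, zeta_four] at h
  push_cast at h
  linear_combination h

theorem Li_four_I : Li 4 I = -7 * (Real.pi : ℂ) ^ 4 / 11520 + beta 4 * I := by
  rw [Li_even_add_odd (by norm_num) (by simp), I_sq, Li_four_neg_one]
  have : ∑' k : ℕ, I ^ (2 * k + 1) / ((2 * k + 1 : ℕ) : ℂ) ^ 4 = beta 4 * I := by
    rw [beta, ofReal_tsum, ← tsum_mul_right]
    refine tsum_congr fun k => ?_
    rw [pow_succ, pow_mul, I_sq]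
    push_cast
    ring
  rw [this]
  ring

theorem Li_four_neg_I : Li 4 (-I) = -7 * (Real.pi : ℂ) ^ 4 / 11520 - beta 4 * I := by
  rw [← conj_I, Li_conj, Li_four_I]
  simp only [map_add, map_mul, map_div₀, map_neg, map_pow, map_ofNat, conj_ofReal, conj_I]
  ring

theorem beta_three : beta 3 = Real.pi ^ 3 / 32 := by
  have h := hasSum_L_function_mod_four_eval_three
  set g : ℕ → ℝ := fun n => 1 / (n : ℝ) ^ 3 * Real.sin (Real.pi * n / 2) with hg
  have h1 : Summable fun k => g (2 * k) :=
    h.summable.comp_injective (mul_right_injective₀ two_ne_zero)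
  have h2 : Summable fun k => g (2 * k + 1) :=
    h.summable.comp_injective ((add_left_injective 1).comp (mul_right_injective₀ two_ne_zero))
  rw [← h.tsum_eq, ← tsum_even_add_odd h1 h2, beta]
  have e1 : ∀ k : ℕ, g (2 * k) = 0 := by
    intro k
    have : Real.pi * ((2 * k : ℕ) : ℝ) / 2 = k * Real.pi := by push_cast; ring
    simp only [hg]
    rw [this, Real.sin_nat_mul_pi, mul_zero]
  simp only [e1, tsum_zero, zero_add]
  refine tsum_congr fun k => ?_
  have : Real.pi * ((2 * k + 1 : ℕ) : ℝ) / 2 = Real.pi / 2 + k * Real.pi := by push_cast; ring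
  simp only [hg]
  rw [this, Real.sin_add_nat_mul_pi, Real.sin_pi_div_two]
  ring

/-- If -exp w were real and at least 1, the imaginary part of w would be an odd multiple of π. -/
theorem neg_exp_mem_cutPlane {w : ℂ} (hw : |w.im| < Real.pi) : -exp w ∈ cutPlane := by
  rw [mem_cutPlane_iff]
  by_contra! h
  obtain ⟨h1, h2⟩ := h
  simp only [neg_re, neg_im, exp_re, exp_im, neg_eq_zero, mul_eq_zero, Real.exp_ne_zero,
    false_or] at h1 h2
  have := (Real.sin_eq_zero_iff_of_lt_of_lt (abs_lt.1 hw).1 (abs_lt.1 hw).2).1 h2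
  rw [this, Real.cos_zero, mul_one] at h1
  linarith [Real.exp_pos w.re]

/-- The inversion formula for the tetralogarithm. -/
theorem polylog_three_inversion {w : ℂ} (hw : |w.im| < Real.pi) :
    polylog 3 (-exp w) + polylog 3 (-exp (-w)) =
      -w ^ 4 / 24 - Real.pi ^ 2 / 12 * w ^ 2 - 7 * Real.pi ^ 4 / 360 := by
  have hm : ∀ t ∈ Icc (0 : ℝ) 1, |((t : ℂ) * w).im| < Real.pi := fun t ht => by
    rw [im_ofReal_mul, abs_mul, abs_of_nonneg ht.1]
    exact (mul_le_of_le_one_left (abs_nonneg _) ht.2).trans_lt hw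
  have h1 : ∀ t ∈ Icc (0 : ℝ) 1, -exp (t * w) ∈ cutPlane := fun t ht => neg_exp_mem_cutPlane (hm t ht)
  have h2 : ∀ t ∈ Icc (0 : ℝ) 1, -exp (-(t * w)) ∈ cutPlane := fun t ht =>
    neg_exp_mem_cutPlane (by simpa using hm t ht)
  have hlin : ∀ t : ℝ, HasDerivAt (fun t : ℝ => (t : ℂ) * w) w t := fun t => by
    have h0 : HasDerivAt (fun t : ℝ => (t : ℂ)) 1 t := Complex.ofRealCLM.hasDerivAt
    simpa using h0.mul_const w
  have d1 : ∀ m : ℕ, ∀ t ∈ Icc (0 : ℝ) 1, HasDerivAt (fun t : ℝ => polylog (m + 1) (-exp (t * w)))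
      (w * polylog m (-exp (t * w))) t := fun m t ht => by
    have := (hasDerivAt_polylog_succ m (h1 t ht) (neg_ne_zero.2 (exp_ne_zero _))).comp t
      (hlin t).cexp.fun_neg
    refine this.congr_deriv ?_
    have := exp_ne_zero (t * w)
    field_simp
  have d2 : ∀ m : ℕ, ∀ t ∈ Icc (0 : ℝ) 1,
      HasDerivAt (fun t : ℝ => polylog (m + 1) (-exp (-(t * w))))
      (-(w * polylog m (-exp (-(t * w))))) t := fun m t ht => by
    have := (hasDerivAt_polylog_succ m (h2 t ht) (neg_ne_zero.2 (exp_ne_zero _))).comp t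
      (hlin t).fun_neg.cexp.fun_neg
    refine this.congr_deriv ?_
    have := exp_ne_zero (-(t * w))
    field_simp
  have hpow : ∀ (n : ℕ) (t : ℝ), HasDerivAt (fun t : ℝ => (t * w) ^ (n + 1))
      ((n + 1) * (t * w) ^ n * w) t := fun n t => by
    simpa using (hlin t).fun_pow (n + 1)
  -- Weight one is 1 + e^w = e^w (1 + e^(-w)), with the branch fixed at t = 0. Three integrations
  -- along tw follow. The constants come from Li_2(-1) and Li_4(-1) in even order; in odd order the
  -- difference vanishes at t = 0.
  have e0 : EqOn (fun t : ℝ => log (1 - -exp (t * w)))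
      (fun t : ℝ => t * w + log (1 - -exp (-(t * w)))) (Icc 0 1) := by
    refine eqOn_Icc_of_exp_eq (ContinuousOn.clog (by fun_prop) h1)
      (ContinuousOn.add (by fun_prop) (ContinuousOn.clog (by fun_prop) h2)) (by simp) ?_
    intro t ht
    rw [exp_add, exp_log (slitPlane_ne_zero (h1 t ht)), exp_log (slitPlane_ne_zero (h2 t ht)),
      sub_neg_eq_add, sub_neg_eq_add, mul_add, ← exp_add]
    simp [add_comm]
  have hneg : (-1 : ℂ) ∈ cutPlane := mem_cutPlane_iff.2 (by norm_num)
  have v1 : polylog 1 (-1) = -(Real.pi : ℂ) ^ 2 / 12 := by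
    rw [polylog_eq_Li_of_norm_le_one le_rfl (by simp) hneg, Li_two_neg_one]
  have v3 : polylog 3 (-1) = -7 * (Real.pi : ℂ) ^ 4 / 720 := by
    rw [polylog_eq_Li_of_norm_le_one (by norm_num) (by simp) hneg, Li_four_neg_one]
  have e1 : EqOn (fun t : ℝ => polylog 1 (-exp (t * w)) + polylog 1 (-exp (-(t * w))))
      (fun t : ℝ => -(t * w) ^ 2 / 2 - (Real.pi : ℂ) ^ 2 / 6) (Icc 0 1) := by
    refine eqOn_Icc_of_hasDerivAt_eq (F' := fun t => -(t * w) * w)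
      (fun t ht => ((d1 0 t ht).add (d2 0 t ht)).continuousAt.continuousWithinAt)
      (by fun_prop) ?_ ?_ ?_
    · simp [v1]; ring
    · intro t ht
      refine ((d1 0 t (Ioo_subset_Icc_self ht)).add (d2 0 t (Ioo_subset_Icc_self ht))).congr_deriv ?_
      have h := e0 (Ioo_subset_Icc_self ht)
      simp only at h
      simp only [polylog, h]
      ring
    · intro t ht
      refine (((hpow 1 t).fun_neg.div_const 2).sub_const _).congr_deriv ?_
      push_cast; ring
  have e2 : EqOn (fun t : ℝ => polylog 2 (-exp (t * w)) - polylog 2 (-exp (-(t * w))))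
      (fun t : ℝ => -(t * w) ^ 3 / 6 - (Real.pi : ℂ) ^ 2 / 6 * (t * w) ^ 1) (Icc 0 1) := by
    refine eqOn_Icc_of_hasDerivAt_eq
      (F' := fun t => (-(t * w) ^ 2 / 2 - (Real.pi : ℂ) ^ 2 / 6) * w)
      (fun t ht => ((d1 1 t ht).sub (d2 1 t ht)).continuousAt.continuousWithinAt)
      (by fun_prop) (by simp) ?_ ?_
    · intro t ht
      refine ((d1 1 t (Ioo_subset_Icc_self ht)).sub (d2 1 t (Ioo_subset_Icc_self ht))).congr_deriv ?_
      have h := e1 (Ioo_subset_Icc_self ht)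
      simp only at h
      rw [← h]
      ring
    · intro t ht
      refine (((hpow 2 t).fun_neg.div_const 6).sub ((hpow 0 t).const_mul _)).congr_deriv ?_
      push_cast; ring
  have e3 : EqOn (fun t : ℝ => polylog 3 (-exp (t * w)) + polylog 3 (-exp (-(t * w))))
      (fun t : ℝ => -(t * w) ^ 4 / 24 - (Real.pi : ℂ) ^ 2 / 12 * (t * w) ^ 2
        - 7 * (Real.pi : ℂ) ^ 4 / 360) (Icc 0 1) := by
    refine eqOn_Icc_of_hasDerivAt_eq
      (F' := fun t => (-(t * w) ^ 3 / 6 - (Real.pi : ℂ) ^ 2 / 6 * (t * w) ^ 1) * w)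
      (fun t ht => ((d1 2 t ht).add (d2 2 t ht)).continuousAt.continuousWithinAt)
      (by fun_prop) ?_ ?_ ?_
    · simp [v3]; ring
    · intro t ht
      refine ((d1 2 t (Ioo_subset_Icc_self ht)).add (d2 2 t (Ioo_subset_Icc_self ht))).congr_deriv ?_
      have h := e2 (Ioo_subset_Icc_self ht)
      simp only at h
      rw [← h]
      ring
    · intro t ht
      refine ((((hpow 3 t).fun_neg.div_const 24).sub ((hpow 1 t).const_mul _)).sub_const
        _).congr_deriv ?_
      push_cast; ring
  have h := e3 (right_mem_Icc.2 zero_le_one)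
  simpa using h

/-! ### Kummer's equation at Gaussian points -/

/-- Multiplying z/w by |w|² clears the denominator, so that avoiding the cut becomes a polynomial
condition. The case w = 0 is harmless, as the quotient is then 0. -/
theorem div_mem_cutPlane {z w : ℂ}
    (h : (z * conj w).re < normSq w ∨ (z * conj w).im ≠ 0) : z / w ∈ cutPlane := by
  rcases eq_or_ne w 0 with rfl | hw
  · simpa using zero_mem_cutPlane
  have hn : 0 < normSq w := normSq_pos.2 hw
  have hz : z / w = ((normSq w)⁻¹ : ℝ) * (z * conj w) := by
    rw [div_eq_mul_inv, inv_def]; push_cast; ring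
  rw [mem_cutPlane_iff, hz, re_ofReal_mul, im_ofReal_mul]
  rcases h with h | h
  · left
    rwa [inv_mul_lt_iff₀ hn, mul_one]
  · right
    exact mul_ne_zero (inv_ne_zero hn.ne') h

theorem neg_div_mem_cutPlane {z w : ℂ}
    (h : -(z * conj w).re < normSq w ∨ (z * conj w).im ≠ 0) : -(z / w) ∈ cutPlane := by
  rw [← neg_div]
  exact div_mem_cutPlane (by rwa [neg_mul, neg_re, neg_im, neg_ne_zero])

/-- Bernstein monomials: a polynomial with nonnegative coefficients in them is nonnegative on [0,
1]. Those of degree six let `linarith` certify the inequalities along the rays. -/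
theorem pow_mul_one_sub_pow_nonneg {t : ℝ} (ht : t ∈ Icc (0 : ℝ) 1) (i j : ℕ) : 0 ≤ t ^ i * (1 - t) ^ j :=
  mul_nonneg (pow_nonneg ht.1 _) (pow_nonneg (sub_nonneg.2 ht.2) _)

set_option maxHeartbeats 2000000 in
theorem kummerArg_I_I_mem (t : ℝ) (ht : t ∈ Icc (0 : ℝ) 1) (i : Fin 20) :
    kummerArg (t * I) (t * I) i ∈ cutPlane := by
  rcases ht.1.eq_or_lt with rfl | h0
  · fin_cases i <;> simp [kummerArg, zero_mem_cutPlane]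
  have b := pow_mul_one_sub_pow_nonneg ht
  fin_cases i <;>
    simp only [kummerArg, Fin.reduceFinMk, Matrix.cons_val] <;>
    first
    | refine neg_div_mem_cutPlane ?_
    | refine div_mem_cutPlane ?_
    | refine mem_cutPlane_iff.2 ?_
  all_goals
    simp [normSq_apply, pow_succ] <;>
    first
    | (left; linarith [b 0 6, b 1 5, b 2 4, b 3 3, b 4 2, b 5 1, b 6 0])
    | linarith [b 0 6, b 1 5, b 2 4, b 3 3, b 4 2, b 5 1, b 6 0]
    | (right; positivity)

set_option maxHeartbeats 2000000 in
theorem kummerArg_I_neg_one_mem (t : ℝ) (ht : t ∈ Icc (0 : ℝ) 1) (i : Fin 20) :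
    kummerArg (t * I) (t * -1) i ∈ cutPlane := by
  rcases ht.1.eq_or_lt with rfl | h0
  · fin_cases i <;> simp [kummerArg, zero_mem_cutPlane]
  have b := pow_mul_one_sub_pow_nonneg ht
  fin_cases i <;>
    simp only [kummerArg, Fin.reduceFinMk, Matrix.cons_val] <;>
    first
    | refine neg_div_mem_cutPlane ?_
    | refine div_mem_cutPlane ?_
    | refine mem_cutPlane_iff.2 ?_
  all_goals
    simp [normSq_apply, pow_succ] <;>
    first
    | (left; linarith [b 0 6, b 1 5, b 2 4, b 3 3, b 4 2, b 5 1, b 6 0])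
    | linarith [b 0 6, b 1 5, b 2 4, b 3 3, b 4 2, b 5 1, b 6 0]
    | (right; exact ⟨h0.ne', (by linarith : (0 : ℝ) < 1 + t).ne'⟩)

set_option maxHeartbeats 2000000 in
theorem kummerArg_neg_one_one_add_I_mem (t : ℝ) (ht : t ∈ Icc (0 : ℝ) 1) (i : Fin 20) :
    kummerArg (t * -1) (t * (1 + I)) i ∈ cutPlane := by
  rcases ht.1.eq_or_lt with rfl | h0
  · fin_cases i <;> simp [kummerArg, zero_mem_cutPlane]
  have b := pow_mul_one_sub_pow_nonneg ht
  fin_cases i <;>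
    simp only [kummerArg, Fin.reduceFinMk, Matrix.cons_val] <;>
    first
    | refine neg_div_mem_cutPlane ?_
    | refine div_mem_cutPlane ?_
    | refine mem_cutPlane_iff.2 ?_
  all_goals
    simp [normSq_apply, pow_succ] <;>
    first
    | (left; linarith [b 0 6, b 1 5, b 2 4, b 3 3, b 4 2, b 5 1, b 6 0])
    | linarith [b 0 6, b 1 5, b 2 4, b 3 3, b 4 2, b 5 1, b 6 0]
    | (right; exact ⟨h0.ne', (by linarith : (0 : ℝ) < 1 + t).ne'⟩)
    | (right; intro h; nlinarith [mul_pos h0 h0])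

/-- Every entry is a unit times a power of 1+i, and likewise at the other two Gaussian points. This
is why so few tetralogarithm values remain after inversion and duplication. -/
theorem kummerArg_I_I : kummerArg I I = ![I, I, (1 + I) / 4, (1 + I) / 4, -1, -I / 2,
    (1 + I) / 2, (1 + I) / 2, 1 + I, 1 + I, -((1 - I) / 2), -((1 - I) / 2), -I, -I, 1 / 2, 1 / 2,
    I, I, (1 - I) / 2, (1 - I) / 2] := by
  funext i
  fin_cases i <;> simp only [kummerArg, Fin.reduceFinMk, Matrix.cons_val] <;>
    apply Complex.ext <;>
    simp [div_re, div_im, normSq_apply, pow_succ] <;> norm_num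

theorem kummerArg_I_neg_one : kummerArg I (-1) = ![-(1 + I), -((1 + I) / 2), (1 + I) / 8,
    -1 / 4, -I, (1 - I) / 4, I / 2, -((1 - I) / 2), 2 * I, -(1 - I), I / 2, -((1 + I) / 2), 1 - I,
    (1 - I) / 2, (1 - I) / 4, (1 + I) / 4, I, -1, (1 - I) / 2, 1 / 2] := by
  funext i
  fin_cases i <;> simp only [kummerArg, Fin.reduceFinMk, Matrix.cons_val] <;>
    apply Complex.ext <;>
    simp [div_re, div_im, normSq_apply, pow_succ] <;> norm_num

theorem kummerArg_neg_one_one_add_I : kummerArg (-1) (1 + I) = ![-((1 - I) / 2), -4,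
    -((1 + I) / 2), 1 / 2, -(1 + I), (1 - I) / 2, -(1 - I), (1 + I) / 2, I, 2 * (1 + I), -I,
    (1 + I) / 2, -I / 2, 2 * (1 - I), I / 2, (1 - I) / 2, -1, 1 + I, 1 / 2, 1 - I] := by
  funext i
  fin_cases i <;> simp only [kummerArg, Fin.reduceFinMk, Matrix.cons_val] <;>
    apply Complex.ext <;>
    simp [div_re, div_im, normSq_apply, pow_succ] <;> norm_num

theorem tetralog_I_I : 14 * polylog 3 I + 2 * polylog 3 ((1 + I) / 4) - 6 * polylog 3 (-1)
    - 6 * polylog 3 (-I / 2) - 12 * polylog 3 ((1 + I) / 2) - 6 * polylog 3 (1 + I)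
    - 6 * polylog 3 (-((1 - I) / 2)) - 6 * polylog 3 (-I) - 6 * polylog 3 2⁻¹
    + 12 * polylog 3 ((1 - I) / 2) = 3 / 2 * log (1 - I) ^ 4 := by
  have h := kummer_tetralog I_ne_zero I_ne_zero kummerArg_I_I_mem
  rw [kummerArg_I_I] at h
  simp only [Fin.sum_univ_succ, kummerCoeff] at h
  simp at h
  linear_combination h

theorem tetralog_I_neg_one : polylog 3 (-(1 + I)) - 2 * polylog 3 (-((1 + I) / 2))
    + polylog 3 ((1 + I) / 8) + polylog 3 (-1 / 4) - 6 * polylog 3 (-I)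
    - 9 * polylog 3 ((1 - I) / 4) - 9 * polylog 3 (I / 2) - 6 * polylog 3 (-((1 - I) / 2))
    - 3 * polylog 3 (2 * I) - 3 * polylog 3 (-(1 - I)) - 3 * polylog 3 (1 - I)
    + 3 * polylog 3 ((1 - I) / 2) - 3 * polylog 3 ((1 + I) / 4) + 6 * polylog 3 I
    + 6 * polylog 3 (-1) + 6 * polylog 3 2⁻¹ = 3 / 2 * log (1 - I) ^ 2 * log 2 ^ 2 := by
  have h := kummer_tetralog I_ne_zero (neg_ne_zero.2 one_ne_zero) kummerArg_I_neg_one_mem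
  rw [kummerArg_I_neg_one, show (1 - -1 : ℂ) = 2 by norm_num] at h
  simp only [Fin.sum_univ_succ, kummerCoeff] at h
  simp [-neg_add_rev, -neg_sub] at h
  linear_combination h

theorem tetralog_neg_one_one_add_I : polylog 3 (-((1 - I) / 2)) + polylog 3 (-4)
    + polylog 3 (-((1 + I) / 2)) + 7 * polylog 3 2⁻¹ - 6 * polylog 3 (-(1 + I))
    - 9 * polylog 3 ((1 - I) / 2) - 6 * polylog 3 (-(1 - I)) - 9 * polylog 3 ((1 + I) / 2)
    - 3 * polylog 3 I - 3 * polylog 3 (2 * (1 + I)) - 3 * polylog 3 (-I)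
    - 3 * polylog 3 (-I / 2) - 3 * polylog 3 (2 * (1 - I)) - 3 * polylog 3 (I / 2)
    + 6 * polylog 3 (-1) + 6 * polylog 3 (1 + I) + 6 * polylog 3 (1 - I)
    = 3 / 2 * log 2 ^ 2 * log (-I) ^ 2 := by
  have h := kummer_tetralog (neg_ne_zero.2 one_ne_zero)
    (by simp [Complex.ext_iff] : (1 + I : ℂ) ≠ 0) kummerArg_neg_one_one_add_I_mem
  rw [kummerArg_neg_one_one_add_I, show (1 - -1 : ℂ) = 2 by norm_num,
    show (1 - (1 + I) : ℂ) = -I by ring] at h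
  simp only [Fin.sum_univ_succ, kummerCoeff] at h
  simp [-neg_add_rev, -neg_sub] at h
  linear_combination h

/-! ### Inversion at arguments outside the unit disc -/

/-- The real part of the inversion polynomial at `p + q i`. -/
noncomputable def inversionRe (p q : ℝ) : ℝ :=
  -(p ^ 4 - 6 * p ^ 2 * q ^ 2 + q ^ 4) / 24 - Real.pi ^ 2 / 12 * (p ^ 2 - q ^ 2)
    - 7 * Real.pi ^ 4 / 360

/-- The imaginary part of the inversion polynomial at `p + q i`. -/
noncomputable def inversionIm (p q : ℝ) : ℝ :=
  -(4 * p ^ 3 * q - 4 * p * q ^ 3) / 24 - Real.pi ^ 2 / 12 * (2 * p * q)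

theorem add_mul_I_pow_two (p q : ℂ) : (p + q * I) ^ 2 = p ^ 2 - q ^ 2 + 2 * p * q * I := by
  linear_combination q ^ 2 * I_sq

theorem add_mul_I_pow_four (p q : ℂ) : (p + q * I) ^ 4 =
    p ^ 4 - 6 * p ^ 2 * q ^ 2 + q ^ 4 + (4 * p ^ 3 * q - 4 * p * q ^ 3) * I := by
  rw [show (p + q * I) ^ 4 = ((p + q * I) ^ 2) ^ 2 by ring, add_mul_I_pow_two]
  linear_combination 4 * p ^ 2 * q ^ 2 * I_sq

/-- Here p + qi is a logarithm of -z, not of z, in accordance with the cut along [1, ∞). For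
instance, 1 + i goes with q = -3π/4. -/
theorem polylog_three_inv {z : ℂ} (p q : ℝ) (hq : |q| < Real.pi) (h : exp (p + q * I) = -z) :
    polylog 3 z = inversionRe p q + inversionIm p q * I - polylog 3 z⁻¹ := by
  have hi := polylog_three_inversion (w := p + q * I) (by simpa using hq)
  rw [exp_neg, h, neg_neg, inv_neg, neg_neg, neg_div, add_mul_I_pow_two,
    add_mul_I_pow_four] at hi
  simp only [inversionRe, inversionIm]
  push_cast
  linear_combination hi

theorem exp_half_log_two_add_pi_div_four :
    exp ((Real.log 2 / 2 : ℝ) + (Real.pi / 4 : ℝ) * I) = 1 + I := by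
  have h2 : √2 * √2 = 2 := Real.mul_self_sqrt (by norm_num)
  rw [exp_add_mul_I, ← ofReal_cos, ← ofReal_sin, ← ofReal_exp, Real.exp_half,
    Real.exp_log two_pos, Real.cos_pi_div_four, Real.sin_pi_div_four]
  apply Complex.ext <;> simp <;> linarith

theorem exp_half_log_two_sub_pi_div_four :
    exp ((Real.log 2 / 2 : ℝ) + (-(Real.pi / 4) : ℝ) * I) = 1 - I := by
  have h := congrArg conj exp_half_log_two_add_pi_div_four
  rw [← exp_conj] at h
  simp only [map_add, map_mul, map_one, conj_ofReal, conj_I] at h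
  rw [sub_eq_add_neg, ← h, ofReal_neg, neg_mul, mul_neg]

theorem exp_half_log_two_sub_three_pi_div_four :
    exp ((Real.log 2 / 2 : ℝ) + (-(3 * Real.pi / 4) : ℝ) * I) = -(1 + I) := by
  have : ((Real.log 2 / 2 : ℝ) + (-(3 * Real.pi / 4) : ℝ) * I : ℂ) =
      ((Real.log 2 / 2 : ℝ) + (Real.pi / 4 : ℝ) * I) - Real.pi * I := by push_cast; ring
  rw [this, exp_sub, exp_half_log_two_add_pi_div_four, exp_pi_mul_I]
  ring

theorem exp_half_log_two_add_three_pi_div_four :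
    exp ((Real.log 2 / 2 : ℝ) + (3 * Real.pi / 4 : ℝ) * I) = -(1 - I) := by
  have h := congrArg conj exp_half_log_two_sub_three_pi_div_four
  rw [← exp_conj] at h
  simp only [map_add, map_neg, map_mul, map_one, conj_ofReal, conj_I] at h
  rw [sub_eq_add_neg, ← h, ofReal_neg, neg_mul_neg]

theorem cexp_log_two : exp (Real.log 2) = 2 := by
  rw [← ofReal_exp, Real.exp_log two_pos, ofReal_ofNat]

theorem log_one_sub_I : log (1 - I) = (Real.log 2 / 2 : ℝ) + (-(Real.pi / 4) : ℝ) * I := by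
  rw [← exp_half_log_two_sub_pi_div_four, log_exp] <;>
    rw [add_im, ofReal_im, im_ofReal_mul, I_im] <;> linarith [Real.pi_pos]

theorem polylog_three_one_add_I : polylog 3 (1 + I) =
    inversionRe (Real.log 2 / 2) (-(3 * Real.pi / 4)) +
      inversionIm (Real.log 2 / 2) (-(3 * Real.pi / 4)) * I - polylog 3 ((1 - I) / 2) := by
  rw [polylog_three_inv _ _ _ exp_half_log_two_sub_three_pi_div_four]
  · congr 2
    apply Complex.ext <;> simp [normSq_apply] <;> norm_num
  · rw [abs_neg, abs_of_pos (by positivity)]; linarith [Real.pi_pos]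

theorem polylog_three_one_sub_I : polylog 3 (1 - I) =
    inversionRe (Real.log 2 / 2) (3 * Real.pi / 4) +
      inversionIm (Real.log 2 / 2) (3 * Real.pi / 4) * I - polylog 3 ((1 + I) / 2) := by
  rw [polylog_three_inv _ _ _ exp_half_log_two_add_three_pi_div_four]
  · congr 2
    apply Complex.ext <;> simp [normSq_apply] <;> norm_num
  · rw [abs_of_pos (by positivity)]; linarith [Real.pi_pos]

theorem polylog_three_neg_one_add_I : polylog 3 (-(1 + I)) =
    inversionRe (Real.log 2 / 2) (Real.pi / 4) +
      inversionIm (Real.log 2 / 2) (Real.pi / 4) * I - polylog 3 (-((1 - I) / 2)) := by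
  rw [polylog_three_inv (Real.log 2 / 2) (Real.pi / 4)]
  · congr 2
    apply Complex.ext <;> simp [normSq_apply] <;> norm_num
  · rw [abs_of_pos (by positivity)]; linarith [Real.pi_pos]
  · rw [exp_half_log_two_add_pi_div_four, neg_neg]

theorem polylog_three_neg_one_sub_I : polylog 3 (-(1 - I)) =
    inversionRe (Real.log 2 / 2) (-(Real.pi / 4)) +
      inversionIm (Real.log 2 / 2) (-(Real.pi / 4)) * I - polylog 3 (-((1 + I) / 2)) := by
  rw [polylog_three_inv (Real.log 2 / 2) (-(Real.pi / 4))]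
  · congr 2
    apply Complex.ext <;> simp [normSq_apply] <;> norm_num
  · rw [abs_neg, abs_of_pos (by positivity)]; linarith [Real.pi_pos]
  · rw [exp_half_log_two_sub_pi_div_four, neg_neg]

theorem polylog_three_two_add_two_I : polylog 3 (2 * (1 + I)) =
    inversionRe (3 * Real.log 2 / 2) (-(3 * Real.pi / 4)) +
      inversionIm (3 * Real.log 2 / 2) (-(3 * Real.pi / 4)) * I - polylog 3 ((1 - I) / 4) := by
  rw [polylog_three_inv (3 * Real.log 2 / 2) (-(3 * Real.pi / 4))]
  · congr 2
    apply Complex.ext <;> simp [normSq_apply] <;> norm_num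
  · rw [abs_neg, abs_of_pos (by positivity)]; linarith [Real.pi_pos]
  · have : ((3 * Real.log 2 / 2 : ℝ) + (-(3 * Real.pi / 4) : ℝ) * I : ℂ) =
      Real.log 2 + ((Real.log 2 / 2 : ℝ) + (-(3 * Real.pi / 4) : ℝ) * I) := by push_cast; ring
    rw [this, exp_add, exp_half_log_two_sub_three_pi_div_four, cexp_log_two]
    ring

theorem polylog_three_two_sub_two_I : polylog 3 (2 * (1 - I)) =
    inversionRe (3 * Real.log 2 / 2) (3 * Real.pi / 4) +
      inversionIm (3 * Real.log 2 / 2) (3 * Real.pi / 4) * I - polylog 3 ((1 + I) / 4) := by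
  rw [polylog_three_inv (3 * Real.log 2 / 2) (3 * Real.pi / 4)]
  · congr 2
    apply Complex.ext <;> simp [normSq_apply] <;> norm_num
  · rw [abs_of_pos (by positivity)]; linarith [Real.pi_pos]
  · have : ((3 * Real.log 2 / 2 : ℝ) + (3 * Real.pi / 4 : ℝ) * I : ℂ) =
      Real.log 2 + ((Real.log 2 / 2 : ℝ) + (3 * Real.pi / 4 : ℝ) * I) := by push_cast; ring
    rw [this, exp_add, exp_half_log_two_add_three_pi_div_four, cexp_log_two]
    ring

theorem polylog_three_two_I : polylog 3 (2 * I) =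
    inversionRe (Real.log 2) (-(Real.pi / 2)) +
      inversionIm (Real.log 2) (-(Real.pi / 2)) * I - polylog 3 (-I / 2) := by
  rw [polylog_three_inv (Real.log 2) (-(Real.pi / 2))]
  · congr 2
    apply Complex.ext <;> simp <;> norm_num
  · rw [abs_neg, abs_of_pos (by positivity)]; linarith [Real.pi_pos]
  · rw [exp_add, cexp_log_two, show ((-(Real.pi / 2) : ℝ) : ℂ) * I = -Real.pi / 2 * I by
      push_cast; ring, exp_neg_pi_div_two_mul_I]
    ring

theorem polylog_three_neg_two : polylog 3 (-2) = inversionRe (Real.log 2) 0 - polylog 3 (-2⁻¹) := by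
  rw [polylog_three_inv (Real.log 2) 0 (by simpa using Real.pi_pos) (by
    rw [ofReal_zero, zero_mul, add_zero, cexp_log_two, neg_neg])]
  simp [inversionIm]

theorem polylog_three_neg_four :
    polylog 3 (-4) = inversionRe (2 * Real.log 2) 0 - polylog 3 (-1 / 4) := by
  rw [polylog_three_inv (2 * Real.log 2) 0 (by simpa using Real.pi_pos)]
  · simp [inversionIm, neg_div]
  · have : ((2 * Real.log 2 : ℝ) + (0 : ℝ) * I : ℂ) = Real.log 2 + Real.log 2 := by
      push_cast; ring
    rw [this, exp_add, cexp_log_two]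
    norm_num

/-! ### Kummer's equation in the limit (-1, -1) -/

/-- The arguments of Kummer's equation at `(-r, -r)`. -/
noncomputable def kummerDiag (r : ℝ) : Fin 20 → ℝ :=
  ![r ^ 3, r ^ 3, -(r / (1 + r)) ^ 3, -(r / (1 + r)) ^ 3, r ^ 2, (r / (1 + r)) ^ 2,
    -(r ^ 2 / (1 + r)), -(r ^ 2 / (1 + r)), -(r * (1 + r)), -(r * (1 + r)), -(r / (1 + r)),
    -(r / (1 + r)), r, r, r / (1 + r) ^ 2, r / (1 + r) ^ 2, -r, -r, r / (1 + r), r / (1 + r)]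

theorem kummerArg_neg_ofReal {r : ℝ} (hr : 0 ≤ r) (i : Fin 20) :
    kummerArg (-r) (-r) i = kummerDiag r i := by
  have h : (1 + r : ℂ) ≠ 0 := by
    have : (1 + r : ℝ) ≠ 0 := by positivity
    exact_mod_cast this
  fin_cases i <;> simp [kummerArg, kummerDiag] <;> field_simp

theorem kummerDiag_lt_one {r : ℝ} (hr : 0 ≤ r) (hr1 : r < 1) (i : Fin 20) :
    kummerDiag r i < 1 := by
  have hq0 : 0 ≤ r / (1 + r) := by positivity
  have hq1 : r / (1 + r) < 1 := by rw [div_lt_one (by positivity)]; linarith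
  have hs : r / (1 + r) ^ 2 < 1 := by rw [div_lt_one (by positivity)]; nlinarith
  have n1 : 0 ≤ r ^ 2 / (1 + r) := by positivity
  have n2 : 0 ≤ r * (1 + r) := by positivity
  have n3 : 0 ≤ (r / (1 + r)) ^ 3 := by positivity
  have p2 := pow_lt_one₀ hr hr1 two_ne_zero
  have p3 := pow_lt_one₀ hr hr1 three_ne_zero
  have q2 := pow_lt_one₀ hq0 hq1 two_ne_zero
  fin_cases i <;> simp only [kummerDiag, Fin.reduceFinMk, Matrix.cons_val] <;> linarith

/-- The point 1 lies on the cut, so the limit is taken from the series, which is continuous on the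
closed disc. -/
theorem tendsto_polylog_three_one {g : ℝ → ℝ} (hg : Tendsto g (𝓝[<] 1) (𝓝 1))
    (h : ∀ᶠ s in 𝓝[<] 1, |g s| < 1) :
    Tendsto (fun s => polylog 3 (g s)) (𝓝[<] 1) (𝓝 (Li 4 1)) := by
  have hc := continuousOn_Li (n := 4) (by norm_num) 1 (by simp)
  have : Tendsto (fun s => Li 4 (g s)) (𝓝[<] 1) (𝓝 (Li 4 1)) := by
    refine hc.tendsto.comp (tendsto_nhdsWithin_iff.2 ⟨?_, ?_⟩)
    · have := (continuous_ofReal.tendsto 1).comp hg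
      rwa [ofReal_one] at this
    · filter_upwards [h] with s hs
      simpa using hs.le
  refine this.congr' ?_
  filter_upwards [h] with s hs
  exact (polylog_eq_Li 3 (by simpa using hs)).symm

theorem tendsto_polylog_three_ofReal {g : ℝ → ℝ} {a : ℝ} (ha : a < 1)
    (hg : Tendsto g (𝓝[<] 1) (𝓝 a)) :
    Tendsto (fun s => polylog 3 (g s)) (𝓝[<] 1) (𝓝 (polylog 3 a)) :=
  (continuousAt_polylog 3 (mem_cutPlane_iff.2 (Or.inl (by simpa using ha)))).tendsto.comp
    ((continuous_ofReal.tendsto a).comp hg)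

/-- At (-1, -1) five arguments equal 1, so Kummer's equation is applied at (-s, -s), where all
arguments are real and less than 1, and s tends to 1 from below. The five coefficients add up to the
-10 in front of `Li 4 1`. -/
theorem tetralog_neg_one_neg_one : -10 * Li 4 1 + 2 * polylog 3 (-8⁻¹) - 12 * polylog 3 4⁻¹
    - 18 * polylog 3 (-2⁻¹) - 6 * polylog 3 (-2) + 12 * polylog 3 (-1) + 12 * polylog 3 2⁻¹
    = 3 / 2 * (Real.log 2 : ℂ) ^ 4 := by
  have hK : ∀ s ∈ Ioo (0 : ℝ) 1, ∑ i, (kummerCoeff i : ℂ) * polylog 3 (kummerDiag s i : ℝ)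
      = 3 / 2 * (Real.log (1 + s) : ℂ) ^ 4 := by
    intro s hs
    have hs0 : (-s : ℂ) ≠ 0 := neg_ne_zero.2 (by exact_mod_cast hs.1.ne')
    have h := kummer_tetralog hs0 hs0 (fun t ht i => by
      have h0 : 0 ≤ t * s := mul_nonneg ht.1 hs.1.le
      have h1 : t * s < 1 := (mul_le_of_le_one_left hs.1.le ht.2).trans_lt hs.2
      have : (t : ℂ) * -s = -((t * s : ℝ) : ℂ) := by push_cast; ring
      rw [this, kummerArg_neg_ofReal h0, mem_cutPlane_iff, ofReal_re]
      exact Or.inl (kummerDiag_lt_one h0 h1 i))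
    simp only [kummerArg_neg_ofReal hs.1.le] at h
    rw [h, ofReal_log (by linarith [hs.1])]
    push_cast
    rw [sub_neg_eq_add]
    ring
  have hlim : ∀ i, Tendsto (fun s : ℝ => kummerDiag s i) (𝓝[<] 1) (𝓝 (kummerDiag 1 i)) := by
    intro i
    have h1 : (1 + 1 : ℝ) ≠ 0 := by norm_num
    refine ContinuousAt.tendsto (f := fun s : ℝ => kummerDiag s i) (x := 1) ?_ |>.mono_left
      nhdsWithin_le_nhds
    fin_cases i <;> simp only [kummerDiag, Fin.reduceFinMk, Matrix.cons_val] <;>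
      fun_prop (disch := norm_num)
  have hpos : ∀ᶠ s : ℝ in 𝓝[<] 1, s ∈ Ioo (0 : ℝ) 1 := Ioo_mem_nhdsLT zero_lt_one
  set V : Fin 20 → ℂ := ![Li 4 1, Li 4 1, polylog 3 (-8⁻¹), polylog 3 (-8⁻¹), Li 4 1,
    polylog 3 4⁻¹, polylog 3 (-2⁻¹), polylog 3 (-2⁻¹), polylog 3 (-2), polylog 3 (-2),
    polylog 3 (-2⁻¹), polylog 3 (-2⁻¹), Li 4 1, Li 4 1, polylog 3 4⁻¹, polylog 3 4⁻¹,
    polylog 3 (-1), polylog 3 (-1), polylog 3 2⁻¹, polylog 3 2⁻¹] with hV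
  have hterm : ∀ i, Tendsto (fun s : ℝ => polylog 3 (kummerDiag s i : ℝ)) (𝓝[<] 1) (𝓝 (V i)) := by
    intro i
    have hi := hlim i
    by_cases h1 : kummerDiag 1 i = 1
    · rw [h1] at hi
      have hVi : V i = Li 4 1 := by
        fin_cases i <;> first | rfl | norm_num [kummerDiag] at h1
      rw [hVi]
      refine tendsto_polylog_three_one hi ?_
      filter_upwards [hpos] with s hs
      refine abs_lt.2 ⟨?_, kummerDiag_lt_one hs.1.le hs.2 i⟩
      have := hs.1
      fin_cases i <;> simp only [kummerDiag, Fin.reduceFinMk, Matrix.cons_val] <;>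
        first
        | linarith [pow_pos this 3, pow_pos this 2]
        | norm_num [kummerDiag] at h1
    · have hlt : kummerDiag 1 i < 1 := by
        fin_cases i <;>
          first
          | (norm_num [kummerDiag]; done)
          | exact absurd (by norm_num [kummerDiag]) h1
      have hVi : V i = polylog 3 (kummerDiag 1 i : ℝ) := by
        fin_cases i <;> simp [kummerDiag] at h1 <;> simp [V, kummerDiag] <;> norm_num
      rw [hVi]
      exact tendsto_polylog_three_ofReal hlt hi
  have hL : Tendsto (fun s : ℝ => ∑ i, (kummerCoeff i : ℂ) * polylog 3 (kummerDiag s i : ℝ))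
      (𝓝[<] 1) (𝓝 (∑ i, (kummerCoeff i : ℂ) * V i)) :=
    tendsto_finsetSum _ fun i _ => (hterm i).const_mul _
  have hR : Tendsto (fun s : ℝ => 3 / 2 * (Real.log (1 + s) : ℂ) ^ 4) (𝓝[<] 1)
      (𝓝 (3 / 2 * (Real.log (1 + 1) : ℂ) ^ 4)) := by
    refine ContinuousAt.tendsto (f := fun s : ℝ => 3 / 2 * (Real.log (1 + s) : ℂ) ^ 4) (x := 1) ?_
      |>.mono_left nhdsWithin_le_nhds
    have : ContinuousAt (fun s : ℝ => Real.log (1 + s)) 1 :=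
      ContinuousAt.log (by fun_prop) (by norm_num)
    exact continuousAt_const.mul ((continuous_ofReal.continuousAt.comp this).pow 4)
  have h := tendsto_nhds_unique (hL.congr' (hpos.mono fun s hs => hK s hs)) hR
  rw [one_add_one_eq_two] at h
  simp only [Fin.sum_univ_succ, kummerCoeff, V] at h
  generalize (Real.log 2 : ℂ) = l at h ⊢
  simp at h
  linear_combination h

/-! ### Reduction to the ladder values and the six relations -/

theorem polylog_three_eq_Li {z : ℂ} (h : z.re ^ 2 + z.im ^ 2 < 1) : polylog 3 z = Li 4 z := by
  refine polylog_eq_Li 3 ?_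
  rw [← sq_lt_one_iff₀ (norm_nonneg z), ← normSq_eq_norm_sq, normSq_apply]
  linarith

theorem Li_four_half_sq {z w : ℂ} (hz : z.re ^ 2 + z.im ^ 2 < 1) (h : z ^ 2 = w) :
    Li 4 w = 8 * (Li 4 z + Li 4 (-z)) := by
  rw [← h]
  refine Li_four_sq ?_
  rw [← sq_le_one_iff₀ (norm_nonneg z), ← normSq_eq_norm_sq, normSq_apply]
  linarith

/-- For purely imaginary z, -z is the conjugate of z, so duplication expresses Li_4(z²) as 16 times
the real part of Li_4(z). This removes √8 and √2 from C. -/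
theorem Li_four_re_of_conj_eq_neg {z w : ℂ} (hz : z.re ^ 2 + z.im ^ 2 < 1) (h : z ^ 2 = w)
    (hc : conj z = -z) : (Li 4 z).re = (Li 4 w).re / 16 := by
  rw [Li_four_half_sq hz h, ← hc, Li_conj, add_conj]
  simp
  ring

theorem A_four : A 4 = (Li 4 2⁻¹).re := by rw [A, one_div]

theorem B_four : B 4 = 8 * (Li 4 ((1 + I) / 2)).re := by
  rw [B, show (2 : ℂ) ^ (((4 : ℕ) : ℤ) - 1) = (8 : ℝ) by norm_num, re_ofReal_mul]

theorem F_four : F 4 = 8 * (Li 4 ((1 + I) / 2)).im := by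
  rw [F, show (2 : ℂ) ^ (((4 : ℕ) : ℤ) - 1) = (8 : ℝ) by norm_num, im_ofReal_mul]

theorem two_thirds_zpow : (2 / 3 : ℂ) ^ (((4 : ℕ) : ℤ) - 1) = (8 / 27 : ℝ) := by norm_num

theorem two_fifths_zpow : (2 / 5 : ℂ) ^ (((4 : ℕ) : ℤ) - 1) = (8 / 125 : ℝ) := by norm_num

theorem C_four : C 4 = 1 / 54 * (Li 4 (-8⁻¹)).re - (Li 4 (-2⁻¹)).re := by
  have s8 : √8 ^ 2 = 8 := Real.sq_sqrt (by norm_num)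
  have s2 : √2 ^ 2 = 2 := Real.sq_sqrt (by norm_num)
  have c8 : ((√8 : ℝ) : ℂ) ^ 2 = 8 := by exact_mod_cast s8
  have c2 : ((√2 : ℝ) : ℂ) ^ 2 = 2 := by exact_mod_cast s2
  rw [C, two_thirds_zpow, sub_re, re_ofReal_mul, show (2 : ℂ) ^ 4 = (16 : ℝ) by norm_num,
    re_ofReal_mul, Li_four_re_of_conj_eq_neg (z := I / (√8 : ℝ)) (w := -8⁻¹),
    Li_four_re_of_conj_eq_neg (z := -I / (√2 : ℝ)) (w := -2⁻¹)]
  · ring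
  · simp [div_pow, s2]; norm_num
  · rw [div_pow, neg_sq, I_sq, c2]; norm_num
  · simp [neg_div]
  · simp [s8]; norm_num
  · rw [div_pow, I_sq, c8]; norm_num
  · simp [neg_div]

theorem D_four : D 4 = 8 / 27 * (Li 4 ((1 + I) / 4)).re - (Li 4 (-I / 2)).re := by
  rw [D, two_thirds_zpow, sub_re, re_ofReal_mul]

theorem G_four : G 4 = 8 / 27 * (Li 4 ((1 + I) / 4)).im - (Li 4 (-I / 2)).im := by
  rw [G, two_thirds_zpow, sub_im, im_ofReal_mul]

theorem E_four : E 4 = 8 / 125 * (Li 4 ((1 - I) / 8)).re - 2 * (Li 4 (-I / 2)).re := by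
  rw [E, two_fifths_zpow, sub_re, re_ofReal_mul]; congr 1; simp

theorem H_four : H 4 = 8 / 125 * (Li 4 ((1 - I) / 8)).im - 2 * (Li 4 (-I / 2)).im := by
  rw [H, two_fifths_zpow, sub_im, im_ofReal_mul]; congr 1; simp

theorem L_four : L ((4 : ℕ) : ℤ) = Real.log 2 ^ 4 / 24 := by
  rw [L, if_neg (by norm_num), Int.toNat_natCast]
  norm_num [Nat.factorial]

theorem L_three : L (((4 : ℕ) : ℤ) - 1) = -Real.log 2 ^ 3 / 6 := by
  rw [show ((4 : ℕ) : ℤ) - 1 = (3 : ℕ) by norm_num, L, if_neg (by norm_num), Int.toNat_natCast]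
  norm_num [Nat.factorial]
  ring

theorem L_two : L (((4 : ℕ) : ℤ) - 2) = Real.log 2 ^ 2 / 2 := by
  rw [show ((4 : ℕ) : ℤ) - 2 = (2 : ℕ) by norm_num, L, if_neg (by norm_num), Int.toNat_natCast]
  norm_num [Nat.factorial]

/-- The ladder relations of order 4. -/
theorem ladder_relations :
    Bbar 4 - 5 / 2 * Abar 4 = 343 / 128 * zeta 4 ∧
      Cbar 4 - 7 / 9 * Abar 4 = 5 / 54 * zeta 4 ∧
      Dbar 4 - 1 / 3 * Abar 4 = -(313 / 3456) * zeta 4 ∧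
      Ebar 4 - 6 / 25 * Abar 4 = -(1547 / 16000) * zeta 4 ∧
      Gbar 4 - 2 / 3 * Fbar 4 - beta 3 * Real.log 2 = -(80 / 27) * beta 4 ∧
      Hbar 4 - 4 / 5 * Fbar 4 - 23 / 25 * beta 3 * Real.log 2 = -(384 / 125) * beta 4 := by
  have l2 : (log 2 : ℂ) = Real.log 2 := by rw [ofReal_log zero_le_two, ofReal_ofNat]
  have lI : log (-I) = (0 : ℝ) + (-(Real.pi / 2) : ℝ) * I := by
    rw [log_neg_I]; push_cast; ring
  have vI : polylog 3 I = Li 4 I :=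
    polylog_eq_Li_of_norm_le_one (by norm_num) (by simp) (mem_cutPlane_iff.2 (by simp))
  have vnI : polylog 3 (-I) = Li 4 (-I) :=
    polylog_eq_Li_of_norm_le_one (by norm_num) (by simp) (mem_cutPlane_iff.2 (by simp))
  have vn1 : polylog 3 (-1) = Li 4 (-1) :=
    polylog_eq_Li_of_norm_le_one (by norm_num) (by simp) (mem_cutPlane_iff.2 (by norm_num))
  -- Up to conjugation, everything is expressed by Li_4 at (1+i)/2, -i/2, (1+i)/4, (1-i)/8, 1/2,
  -- -1/2 and -1/8. Duplication removes 1/4, -1/4 and -(1±i)/2.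
  have p1 : polylog 3 ((1 + I) / 2) = Li 4 ((1 + I) / 2) :=
    polylog_three_eq_Li (by simp; norm_num)
  have p2 : polylog 3 ((1 - I) / 2) = conj (Li 4 ((1 + I) / 2)) := by
    rw [polylog_three_eq_Li (by simp; norm_num), ← Li_conj]; simp [sub_eq_add_neg, map_ofNat]
  have p3 : polylog 3 (I / 2) = conj (Li 4 (-I / 2)) := by
    rw [polylog_three_eq_Li (by simp; norm_num), ← Li_conj]; simp [map_ofNat]
  have p4 : polylog 3 (-I / 2) = Li 4 (-I / 2) := polylog_three_eq_Li (by simp; norm_num)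
  have p5 : polylog 3 ((1 + I) / 4) = Li 4 ((1 + I) / 4) :=
    polylog_three_eq_Li (by simp; norm_num)
  have p6 : polylog 3 ((1 - I) / 4) = conj (Li 4 ((1 + I) / 4)) := by
    rw [polylog_three_eq_Li (by simp; norm_num), ← Li_conj]; simp [sub_eq_add_neg, map_ofNat]
  have p7 : polylog 3 ((1 + I) / 8) = conj (Li 4 ((1 - I) / 8)) := by
    rw [polylog_three_eq_Li (by simp; norm_num), ← Li_conj]; simp [map_ofNat]
  have p8 : polylog 3 2⁻¹ = Li 4 2⁻¹ := polylog_three_eq_Li (by simp; norm_num)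
  have p9 : polylog 3 (-2⁻¹) = Li 4 (-2⁻¹) := polylog_three_eq_Li (by simp; norm_num)
  have p10 : polylog 3 (-8⁻¹) = Li 4 (-8⁻¹) := polylog_three_eq_Li (by simp; norm_num)
  have p11 : polylog 3 4⁻¹ = 8 * (Li 4 2⁻¹ + Li 4 (-2⁻¹)) := by
    rw [polylog_three_eq_Li (by simp; norm_num)]
    exact Li_four_half_sq (by simp; norm_num) (by norm_num)
  have p12 : polylog 3 (-((1 - I) / 2)) = Li 4 (-I / 2) / 8 - conj (Li 4 ((1 + I) / 2)) := by
    rw [polylog_three_eq_Li (by simp; norm_num), ← p2, polylog_three_eq_Li (by simp; norm_num),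
      Li_four_half_sq (z := (1 - I) / 2) (w := -I / 2) (by simp; norm_num)]
    · ring
    · linear_combination I_sq / 4
  have p13 : polylog 3 (-((1 + I) / 2)) = conj (Li 4 (-I / 2)) / 8 - Li 4 ((1 + I) / 2) := by
    rw [polylog_three_eq_Li (by simp; norm_num), ← p3, polylog_three_eq_Li (by simp; norm_num),
      Li_four_half_sq (z := (1 + I) / 2) (w := I / 2) (by simp; norm_num)]
    · ring
    · linear_combination I_sq / 4
  have p14 : polylog 3 (-1 / 4) = 8 * (Li 4 (-I / 2) + conj (Li 4 (-I / 2))) := by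
    rw [polylog_three_eq_Li (by simp; norm_num), ← p3, polylog_three_eq_Li (by simp; norm_num),
      Li_four_half_sq (z := -I / 2) (w := -1 / 4) (by simp; norm_num), show -(-I / 2) = I / 2 by ring]
    linear_combination I_sq / 4
  have k1 := tetralog_I_I
  have k2 := tetralog_I_neg_one
  have k3 := tetralog_neg_one_one_add_I
  have k4 := tetralog_neg_one_neg_one
  rw [polylog_three_one_add_I, log_one_sub_I, vI, vnI, vn1, Li_four_I, Li_four_neg_I,
    Li_four_neg_one, p1, p2, p4, p5, p8, p12, add_mul_I_pow_four] at k1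
  rw [polylog_three_neg_one_add_I, polylog_three_neg_one_sub_I, polylog_three_two_I,
    polylog_three_one_sub_I, log_one_sub_I, l2, vI, vnI, vn1, Li_four_I, Li_four_neg_I,
    Li_four_neg_one, p1, p2, p3, p4, p5, p6, p7, p8, p12, p13, p14, add_mul_I_pow_two] at k2
  rw [polylog_three_neg_one_add_I, polylog_three_neg_one_sub_I, polylog_three_two_add_two_I,
    polylog_three_two_sub_two_I, polylog_three_neg_four, polylog_three_one_add_I,
    polylog_three_one_sub_I, lI, l2, vI, vnI, vn1, Li_four_I, Li_four_neg_I,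
    Li_four_neg_one, p1, p2, p3, p4, p5, p6, p8, p12, p13, p14, add_mul_I_pow_two] at k3
  rw [polylog_three_neg_two, p8, p9, p10, p11, vn1, Li_four_neg_one, Li_one_eq_zeta,
    zeta_four] at k4
  have ia : (Li 4 2⁻¹).im = 0 := by
    rw [← conj_eq_iff_im, ← Li_conj]; simp [map_ofNat]
  have r1 := congrArg re k1
  have i1 := congrArg im k1
  have r2 := congrArg re k2
  have i2 := congrArg im k2
  have r3 := congrArg re k3
  have r4 := congrArg re k4
  have hre : ∀ (x : ℝ) (n : ℕ), ((x : ℂ) ^ n).re = x ^ n := fun x n => by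
    rw [← ofReal_pow, ofReal_re]
  have him : ∀ (x : ℝ) (n : ℕ), ((x : ℂ) ^ n).im = 0 := fun x n => by
    rw [← ofReal_pow, ofReal_im]
  clear k1 k2 k3 k4 p1 p2 p3 p4 p5 p6 p7 p8 p9 p10 p11 p12 p13 p14 vI vnI vn1 lI l2
  simp only [add_re, add_im, sub_re, sub_im, mul_re, mul_im, neg_re, neg_im, div_ofNat_re,
    div_ofNat_im, ofReal_re, ofReal_im, re_ofNat, im_ofNat, I_re, I_im, conj_re, conj_im, hre, him,
    mul_zero, zero_mul, mul_one, add_zero, zero_add, sub_zero, zero_sub, neg_zero, zero_div] at r1 r2 r3 r4 i1 i2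
  simp only [inversionRe, inversionIm] at r1 r2 r3 r4 i1 i2
  simp only [Abar, Bbar, Cbar, Dbar, Ebar, Fbar, Gbar, Hbar, A_four, B_four, C_four, D_four,
    E_four, F_four, G_four, H_four, zeta_two, zeta_four, beta_three, L_two, L_three, L_four]
  -- In `r3 - 3 * r1` the values at (1+i)/4 and -i/2 cancel, which gives the relation for B. Then
  -- `r4` gives C, `r1` gives D, and `r2` brings in (1-i)/8 for E. The imaginary parts give G and H.
  refine ⟨?_, ?_, ?_, ?_, ?_, ?_⟩
  · linear_combination -(r3 - 3 * r1) / 10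
  · linear_combination r4 / 108
  · linear_combination 4 / 27 * r1 + (r3 - 3 * r1) / 45
  · linear_combination 8 / 125 * r2 + 48 / 125 * r1 + 42 / 625 * (r3 - 3 * r1)
  · linear_combination 4 / 27 * i1 + 8 / 9 * ia
  · linear_combination -(8 / 125) * i2 + 24 / 125 * i1 + 192 / 125 * ia

/-! ### Formulas of BBP type -/

theorem S_eq_odd_add_even (p : ℕ) (a : Fin 8 → ℤ) : S 4 p a =
    ∑' m : ℕ, (a (Fin.ofNat 8 (2 * m)) : ℝ) /
      ((2 : ℝ) ^ ((p * (2 * m + 1) + p) / 2) * ((2 * m + 1 : ℕ) : ℝ) ^ 4) +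
    ∑' m : ℕ, (a (Fin.ofNat 8 (2 * m + 1)) : ℝ) /
      ((2 : ℝ) ^ ((p * (2 * m + 1 + 1) + p) / 2) * ((2 * m + 1 + 1 : ℕ) : ℝ) ^ 4) := by
  have hs := summable_S 4 p (by norm_num) a
  set g : ℕ → ℝ := fun j => (a (Fin.ofNat 8 j) : ℝ) /
      ((2 : ℝ) ^ ((p * (j + 1) + p) / 2) * ((j + 1 : ℕ) : ℝ) ^ 4)
  have h1 : Summable fun k => g (2 * k) := hs.comp_injective (mul_right_injective₀ two_ne_zero)
  have h2 : Summable fun k => g (2 * k + 1) :=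
    hs.comp_injective ((add_left_injective 1).comp (mul_right_injective₀ two_ne_zero))
  exact (tsum_even_add_odd h1 h2).symm

/-- The real part of the sum of the odd terms of `Li_4(z)`. -/
theorem tsum_odd_re {z w : ℂ} (hz : ‖z‖ < 1) (h : z ^ 2 = w) :
    ∑' m : ℕ, (z ^ (2 * m + 1)).re / ((2 * m + 1 : ℕ) : ℝ) ^ 4 =
      (Li 4 z).re - (Li 4 w).re / 16 := by
  have hs : Summable fun m : ℕ => z ^ (2 * m + 1) / ((2 * m + 1 : ℕ) : ℂ) ^ 4 :=
    (summable_Li 4 hz).comp_injective (i := fun m => 2 * m) (mul_right_injective₀ two_ne_zero)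
  have h1 := congrArg re (Li_even_add_odd (n := 4) (by norm_num) hz.le)
  rw [h, add_re, re_tsum hs, show (2 : ℂ) ^ 4 = (16 : ℝ) by norm_num, div_ofReal_re] at h1
  rw [h1, add_sub_cancel_right]
  refine tsum_congr fun m => ?_
  rw [show (((2 * m + 1 : ℕ) : ℂ)) ^ 4 = (((2 * m + 1 : ℕ) : ℝ) ^ 4 : ℝ) by push_cast; rfl,
    div_ofReal_re]

theorem hasSum_even_re {w : ℂ} (hw : ‖w‖ < 1) :
    HasSum (fun m : ℕ => (w ^ (m + 1)).re / ((2 * m + 1 + 1 : ℕ) : ℝ) ^ 4) ((Li 4 w).re / 16) := by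
  have h := (hasSum_re (summable_Li 4 hw).hasSum).div_const 16
  refine h.congr_fun fun m => ?_
  rw [show (((m + 1 : ℕ) : ℂ)) ^ 4 = (((m + 1 : ℕ) : ℝ) ^ 4 : ℝ) by push_cast; rfl,
    div_ofReal_re, show ((2 * m + 1 + 1 : ℕ) : ℝ) = 2 * ((m + 1 : ℕ) : ℝ) by push_cast; ring]
  ring

theorem ofNat_eight_mul_add (q n : ℕ) : Fin.ofNat 8 (8 * q + n) = Fin.ofNat 8 n := by
  ext; simp [Fin.ofNat, Nat.add_mod]

/-- Eighth powers of (1+i)/2 and fourth powers of ±1/2 and i/2 equal 1/16, so the coefficients have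
period 8. Odd indices come from (1+i)/2 alone. Values at the other points sit on even indices k =
2n, where n^(-4) = 16 k^(-4); so does the even part of the series at (1+i)/2, whose square is i/2.
-/
theorem S_four_one (u a b c : ℤ) :
    S 4 1 ![u, a - b, -u, a + b - c - u, -u, a - b, u, a + b + c + u] =
      u * (Li 4 ((1 + I) / 2)).re + (a * (Li 4 2⁻¹).re + b * (Li 4 (-2⁻¹)).re
        + c * (Li 4 (I / 2)).re) / 16 := by
  have hz : ‖(1 + I) / 2‖ < 1 := by
    rw [← sq_lt_one_iff₀ (norm_nonneg _), ← normSq_eq_norm_sq, normSq_apply]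
    simp; norm_num
  have hz2 : ((1 + I) / 2) ^ 2 = I / 2 := by linear_combination I_sq / 4
  have hz8 : ((1 + I) / 2) ^ 8 = (16⁻¹ : ℝ) := by
    rw [show ((1 + I) / 2) ^ 8 = (((1 + I) / 2) ^ 2) ^ 4 by ring, hz2, div_pow, I_pow_four]
    norm_num
  have hodd : ∑' m : ℕ, ((![u, a - b, -u, a + b - c - u, -u, a - b, u, a + b + c + u] : Fin 8 → ℤ)
      (Fin.ofNat 8 (2 * m)) : ℝ) /
      ((2 : ℝ) ^ ((1 * (2 * m + 1) + 1) / 2) * ((2 * m + 1 : ℕ) : ℝ) ^ 4) =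
      u * ((Li 4 ((1 + I) / 2)).re - (Li 4 (I / 2)).re / 16) := by
    rw [← tsum_odd_re hz hz2, ← tsum_mul_left]
    refine tsum_congr fun m => ?_
    rw [mul_div_assoc', ← div_div]
    congr 1
    obtain ⟨q, s, hs, rfl⟩ : ∃ q s, s < 4 ∧ m = 4 * q + s :=
      ⟨m / 4, m % 4, Nat.mod_lt _ (by norm_num), (Nat.div_add_mod m 4).symm⟩
    rw [show 2 * (4 * q + s) = 8 * q + 2 * s by ring, ofNat_eight_mul_add,
      show (1 * (8 * q + 2 * s + 1) + 1) / 2 = 4 * q + (s + 1) by omega, add_assoc (8 * q),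
      pow_add _ (8 * q), pow_mul, hz8, ← ofReal_pow, re_ofReal_mul, pow_add, pow_mul]
    interval_cases s <;> simp [pow_succ, Fin.ofNat] <;> norm_num <;> ring
  have n1 : ‖(2⁻¹ : ℂ)‖ < 1 := by rw [norm_inv, RCLike.norm_ofNat]; norm_num
  have n3 : ‖I / 2‖ < 1 := by rw [norm_div, norm_I, RCLike.norm_ofNat]; norm_num
  have heven : ∑' m : ℕ, ((![u, a - b, -u, a + b - c - u, -u, a - b, u, a + b + c + u] : Fin 8 → ℤ)
      (Fin.ofNat 8 (2 * m + 1)) : ℝ) /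
      ((2 : ℝ) ^ ((1 * (2 * m + 1 + 1) + 1) / 2) * ((2 * m + 1 + 1 : ℕ) : ℝ) ^ 4) =
      a * ((Li 4 2⁻¹).re / 16) + b * ((Li 4 (-2⁻¹)).re / 16)
        + (c + u) * ((Li 4 (I / 2)).re / 16) := by
    refine HasSum.tsum_eq ?_
    refine ((((hasSum_even_re n1).mul_left (a : ℝ)).add
      ((hasSum_even_re (by rwa [norm_neg])).mul_left (b : ℝ))).add
      ((hasSum_even_re n3).mul_left (c + u : ℝ))).congr_fun fun m => ?_
    rw [mul_div_assoc', mul_div_assoc', mul_div_assoc', ← add_div, ← add_div, ← div_div]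
    congr 1
    obtain ⟨q, s, hs, rfl⟩ : ∃ q s, s < 4 ∧ m = 4 * q + s :=
      ⟨m / 4, m % 4, Nat.mod_lt _ (by norm_num), (Nat.div_add_mod m 4).symm⟩
    have e1 : (2⁻¹ : ℂ) ^ 4 = (16⁻¹ : ℝ) := by norm_num
    have e2 : (-2⁻¹ : ℂ) ^ 4 = (16⁻¹ : ℝ) := by norm_num
    have e3 : (I / 2 : ℂ) ^ 4 = (16⁻¹ : ℝ) := by rw [div_pow, I_pow_four]; norm_num
    rw [show 2 * (4 * q + s) + 1 = 8 * q + (2 * s + 1) by ring, ofNat_eight_mul_add,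
      show (1 * (8 * q + (2 * s + 1) + 1) + 1) / 2 = 4 * q + (s + 1) by omega, add_assoc (4 * q),
      pow_add (2⁻¹ : ℂ), pow_add (-2⁻¹ : ℂ), pow_add (I / 2), pow_mul, pow_mul (-2⁻¹ : ℂ),
      pow_mul (I / 2), e1, e2, e3, ← ofReal_pow, re_ofReal_mul, re_ofReal_mul, re_ofReal_mul,
      pow_add (2 : ℝ), pow_mul]
    interval_cases s <;> simp [pow_succ, Fin.ofNat] <;> norm_num <;> ring
  rw [S_eq_odd_add_even, hodd, heven]
  ring

/-- The same splitting with ratio 2^(-12) per period. The denominator at k = 1 is 2³, while the real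
part of (1+i)/4 is 1/4; hence the entry 2u. -/
theorem S_four_three (u b : ℤ) :
    S 4 3 ![2 * u, -b, -(2 * u), b - 2 * u, -(2 * u), -b, 2 * u, b + 2 * u] =
      u * (Li 4 ((1 + I) / 4)).re + b * (Li 4 (-8⁻¹)).re / 32 := by
  have hz : ‖(1 + I) / 4‖ < 1 := by
    rw [← sq_lt_one_iff₀ (norm_nonneg _), ← normSq_eq_norm_sq, normSq_apply]
    simp; norm_num
  have hz2 : ((1 + I) / 4) ^ 2 = I / 8 := by linear_combination I_sq / 16
  have hz8 : ((1 + I) / 4) ^ 8 = (4096⁻¹ : ℝ) := by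
    rw [show ((1 + I) / 4) ^ 8 = (((1 + I) / 4) ^ 2) ^ 4 by ring, hz2, div_pow, I_pow_four]
    norm_num
  have n2 : ‖(-8⁻¹ : ℂ)‖ < 1 := by rw [norm_neg, norm_inv, RCLike.norm_ofNat]; norm_num
  have n3 : ‖I / 8‖ < 1 := by rw [norm_div, norm_I, RCLike.norm_ofNat]; norm_num
  have hodd : ∑' m : ℕ, ((![2 * u, -b, -(2 * u), b - 2 * u, -(2 * u), -b, 2 * u, b + 2 * u] :
      Fin 8 → ℤ) (Fin.ofNat 8 (2 * m)) : ℝ) /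
      ((2 : ℝ) ^ ((3 * (2 * m + 1) + 3) / 2) * ((2 * m + 1 : ℕ) : ℝ) ^ 4) =
      u * ((Li 4 ((1 + I) / 4)).re - (Li 4 (I / 8)).re / 16) := by
    rw [← tsum_odd_re hz hz2, ← tsum_mul_left]
    refine tsum_congr fun m => ?_
    rw [mul_div_assoc', ← div_div]
    congr 1
    obtain ⟨q, s, hs, rfl⟩ : ∃ q s, s < 4 ∧ m = 4 * q + s :=
      ⟨m / 4, m % 4, Nat.mod_lt _ (by norm_num), (Nat.div_add_mod m 4).symm⟩
    rw [show 2 * (4 * q + s) = 8 * q + 2 * s by ring, ofNat_eight_mul_add,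
      show (3 * (8 * q + 2 * s + 1) + 3) / 2 = 12 * q + (3 * s + 3) by omega, add_assoc (8 * q),
      pow_add _ (8 * q), pow_mul, hz8, ← ofReal_pow, re_ofReal_mul, pow_add, pow_mul]
    interval_cases s <;> simp [pow_succ, Fin.ofNat] <;> norm_num <;> ring
  have heven : ∑' m : ℕ, ((![2 * u, -b, -(2 * u), b - 2 * u, -(2 * u), -b, 2 * u, b + 2 * u] :
      Fin 8 → ℤ) (Fin.ofNat 8 (2 * m + 1)) : ℝ) /
      ((2 : ℝ) ^ ((3 * (2 * m + 1 + 1) + 3) / 2) * ((2 * m + 1 + 1 : ℕ) : ℝ) ^ 4) =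
      b / 2 * ((Li 4 (-8⁻¹)).re / 16) + u * ((Li 4 (I / 8)).re / 16) := by
    refine HasSum.tsum_eq ?_
    refine (((hasSum_even_re n2).mul_left (b / 2 : ℝ)).add
      ((hasSum_even_re n3).mul_left (u : ℝ))).congr_fun fun m => ?_
    rw [mul_div_assoc', mul_div_assoc', ← add_div, ← div_div]
    congr 1
    obtain ⟨q, s, hs, rfl⟩ : ∃ q s, s < 4 ∧ m = 4 * q + s :=
      ⟨m / 4, m % 4, Nat.mod_lt _ (by norm_num), (Nat.div_add_mod m 4).symm⟩
    have e2 : (-8⁻¹ : ℂ) ^ 4 = (4096⁻¹ : ℝ) := by norm_num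
    have e3 : (I / 8 : ℂ) ^ 4 = (4096⁻¹ : ℝ) := by rw [div_pow, I_pow_four]; norm_num
    rw [show 2 * (4 * q + s) + 1 = 8 * q + (2 * s + 1) by ring, ofNat_eight_mul_add,
      show (3 * (8 * q + (2 * s + 1) + 1) + 3) / 2 = 12 * q + (3 * s + 4) by omega,
      add_assoc (4 * q), pow_add (-8⁻¹ : ℂ), pow_add (I / 8), pow_mul, pow_mul (I / 8), e2, e3,
      ← ofReal_pow, re_ofReal_mul, re_ofReal_mul, pow_add (2 : ℝ), pow_mul]
    interval_cases s <;> simp [pow_succ, Fin.ofNat] <;> norm_num <;> ring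
  rw [S_eq_odd_add_even, hodd, heven]
  ring

theorem S_mul_left (n p : ℕ) (k : ℤ) (a : Fin 8 → ℤ) :
    S n p (fun i => k * a i) = k * S n p a := by
  rw [S, S, ← tsum_mul_left]
  refine tsum_congr fun j => ?_
  rw [Int.cast_mul, mul_div_assoc]

/-- The polylogarithmic expressions for `π⁴`, `π² log² 2` and `log⁴ 2`. -/
theorem bbp_polylog :
    41 * Real.pi ^ 4 = 27648 * (Li 4 ((1 + I) / 2)).re + (-1022976 * (Li 4 2⁻¹).re
        - 497664 * (Li 4 (-2⁻¹)).re - 1492992 * (Li 4 (I / 2)).re) / 16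
        + (27648 * (Li 4 ((1 + I) / 4)).re + 18432 * (Li 4 (-8⁻¹)).re / 32) ∧
    123 * (Real.pi ^ 2 * Real.log 2 ^ 2) = 46464 * (Li 4 ((1 + I) / 2)).re
        + (-3986304 * (Li 4 2⁻¹).re - 2536704 * (Li 4 (-2⁻¹)).re - 5342976 * (Li 4 (I / 2)).re) / 16
        + (98944 * (Li 4 ((1 + I) / 4)).re + 93952 * (Li 4 (-8⁻¹)).re / 32) ∧
    615 * Real.log 2 ^ 4 = 56064 * (Li 4 ((1 + I) / 2)).re + (-7269888 * (Li 4 2⁻¹).re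
        - 5260032 * (Li 4 (-2⁻¹)).re - 8695296 * (Li 4 (I / 2)).re) / 16
        + (161024 * (Li 4 ((1 + I) / 4)).re + 194816 * (Li 4 (-8⁻¹)).re / 32) := by
  obtain ⟨hB, hC, hD, -⟩ := ladder_relations
  have hI : (Li 4 (-I / 2)).re = (Li 4 (I / 2)).re := by
    rw [show -I / 2 = conj (I / 2) by simp [map_ofNat], Li_conj, conj_re]
  simp only [Abar, Bbar, Cbar, Dbar, A_four, B_four, C_four, D_four, zeta_two, zeta_four, L_two,
    L_four, hI] at hB hC hD
  -- The multipliers invert the 3×3 system for π⁴, π² log² 2 and log⁴ 2.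
  refine ⟨?_, ?_, ?_⟩
  · linear_combination -3456 * hB - 31104 * hC - 93312 * hD
  · linear_combination 3 * (-1936 * hB - 52848 * hC - 111312 * hD)
  · linear_combination 3 * (-2336 * hB - 109584 * hC - 181152 * hD)

theorem bbp_pi_pow_four : 41 * Real.pi ^ 4 =
    S 4 1 (fun i => 27648 * ![1, -19, -1, -2, -1, -19, 1, -108] i)
      + S 4 3 (fun i => 18432 * ![3, -1, -3, -2, -3, -1, 3, 4] i) := by
  have h1 := S_four_one 27648 (-1022976) (-497664) (-1492992)
  have h3 := S_four_three 27648 18432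
  rw [show (fun i => 27648 * ![1, -19, -1, -2, -1, -19, 1, -108] i : Fin 8 → ℤ) = _ from ?_,
    h1, show (fun i => 18432 * ![3, -1, -3, -2, -3, -1, 3, 4] i : Fin 8 → ℤ) = _ from ?_, h3]
  · rw [bbp_polylog.1]; push_cast; ring
  · ext i; fin_cases i <;> norm_num
  · ext i; fin_cases i <;> norm_num

theorem bbp_pi_sq_mul_log_sq : 123 * (Real.pi ^ 2 * Real.log 2 ^ 2) =
    S 4 1 ![46464, -1449600, -46464, -1226496, -46464, -1449600, 46464, -11819520]
      + S 4 3 ![197888, -93952, -197888, -103936, -197888, -93952, 197888, 291840] := by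
  have h1 := S_four_one 46464 (-3986304) (-2536704) (-5342976)
  have h3 := S_four_three 98944 93952
  rw [show (![46464, -1449600, -46464, -1226496, -46464, -1449600, 46464, -11819520] :
      Fin 8 → ℤ) = _ from ?_, h1, show (![197888, -93952, -197888, -103936, -197888, -93952, 197888,
      291840] : Fin 8 → ℤ) = _ from ?_, h3]
  · rw [bbp_polylog.2.1]; push_cast; ring
  · ext i; fin_cases i <;> norm_num
  · ext i; fin_cases i <;> norm_num

theorem bbp_log_pow_four : 615 * Real.log 2 ^ 4 =
    S 4 1 (fun i => 768 * ![73, -2617, -73, -5066, -73, -2617, 73, -27564] i)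
      + S 4 3 (fun i => 256 * ![1258, -761, -1258, -497, -1258, -761, 1258, 2019] i) := by
  have h1 := S_four_one 56064 (-7269888) (-5260032) (-8695296)
  have h3 := S_four_three 161024 194816
  rw [show (fun i => 768 * ![73, -2617, -73, -5066, -73, -2617, 73, -27564] i : Fin 8 → ℤ) = _
    from ?_, h1, show (fun i => 256 * ![1258, -761, -1258, -497, -1258, -761, 1258, 2019] i :
      Fin 8 → ℤ) = _ from ?_, h3]
  · rw [bbp_polylog.2.2]; push_cast; ring
  · ext i; fin_cases i <;> norm_num
  · ext i; fin_cases i <;> norm_num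

theorem bbp_formulas : 615 / 256 * Real.log 2 ^ 4 =
        3 * S 4 1 ![73, -2617, -73, -5066, -73, -2617, 73, -27564]
          + S 4 3 ![1258, -761, -1258, -497, -1258, -761, 1258, 2019] ∧
      41 / 9216 * Real.pi ^ 4 =
        3 * S 4 1 ![1, -19, -1, -2, -1, -19, 1, -108]
          + 2 * S 4 3 ![3, -1, -3, -2, -3, -1, 3, 4] := by
  have h1 := bbp_log_pow_four
  have h2 := bbp_pi_pow_four
  rw [S_mul_left, S_mul_left] at h1 h2
  push_cast at h1 h2
  constructor
  · linear_combination h1 / 256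
  · linear_combination h2 / 9216

/-! ### A Hoare logic for the register machine -/

/-- `Hoare W P p N Q`: started in a state with property `P` and with all registers below `W`, the
program `p` halts in a state with property `Q` after at most `N` instructions, and all registers
stay below `W`. -/
def Hoare {r : ℕ} (W : ℕ) (P : (Fin r → ℕ) → Prop) (p : Prog r) (N : ℕ)
    (Q : (Fin r → ℕ) → Prop) : Prop :=
  ∀ σ : Fin r → ℕ, (∀ i, σ i < W) → P σ → ∃ (τ : Fin r → ℕ) (t s : ℕ), Runs p σ τ t s ∧
    -- With all operands below W, one instruction costs at most (1 + W.size)².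
    (∀ i, τ i < W) ∧ Q τ ∧ t ≤ N * (1 + W.size) ^ 2 ∧ s ≤ r * W.size

namespace Hoare

variable {r W N N' : ℕ} {P Q R : (Fin r → ℕ) → Prop} {p q : Prog r}

theorem bits_le {σ : Fin r → ℕ} (h : ∀ i, σ i < W) : bits σ ≤ r * W.size := by
  calc bits σ ≤ ∑ _i : Fin r, W.size := Finset.sum_le_sum fun i _ => Nat.size_le_size (h i).le
    _ = r * W.size := by simp

theorem seq (h : Hoare W P p N R) (h' : Hoare W R q N' Q) : Hoare W P (.seq p q) (N + N') Q := by
  intro σ hσ hP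
  obtain ⟨τ, t, s, hr, hτ, hR, ht, hs⟩ := h σ hσ hP
  obtain ⟨ρ, t', s', hr', hρ, hQ, ht', hs'⟩ := h' τ hτ hR
  exact ⟨ρ, _, _, hr.seq hr', hρ, hQ, by linarith, max_le hs hs'⟩

theorem conseq {P' Q' : (Fin r → ℕ) → Prop} (h : Hoare W P p N Q) (hP : ∀ σ, P' σ → P σ)
    (hN : N ≤ N') (hQ : ∀ σ, Q σ → Q' σ) : Hoare W P' p N' Q' := by
  intro σ hσ hP'
  obtain ⟨τ, t, s, hr, hτ, hR, ht, hs⟩ := h σ hσ (hP σ hP')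
  exact ⟨τ, t, s, hr, hτ, hQ τ hR, ht.trans (Nat.mul_le_mul_right _ hN), hs⟩

/-- The rule for loops, with an invariant `I` and a variant `μ`. -/
theorem while_do {x : Fin r} (I : (Fin r → ℕ) → Prop) (μ : (Fin r → ℕ) → ℕ) {n : ℕ}
    (h : ∀ k, Hoare W (fun σ => I σ ∧ σ x ≠ 0 ∧ μ σ = k) p N (fun τ => I τ ∧ μ τ < k)) :
    Hoare W (fun σ => I σ ∧ μ σ ≤ n) (.while x p) (1 + n * (N + 1)) (fun τ => I τ ∧ τ x = 0) := by
  induction n with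
  | zero =>
    rintro σ hσ ⟨hI, hμ⟩
    by_cases hx : σ x = 0
    · exact ⟨σ, _, _, .while_zero hx, hσ, ⟨hI, hx⟩,
        Nat.one_le_iff_ne_zero.2 (by positivity), bits_le hσ⟩
    · obtain ⟨τ, t, s, -, -, ⟨-, hlt⟩, -⟩ := h _ σ hσ ⟨hI, hx, rfl⟩
      omega
  | succ n ih =>
    rintro σ hσ ⟨hI, hμ⟩
    by_cases hx : σ x = 0
    · refine ⟨σ, _, _, .while_zero hx, hσ, ⟨hI, hx⟩, ?_, bits_le hσ⟩
      exact Nat.one_le_iff_ne_zero.2 (by positivity)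
    · obtain ⟨τ, t, s, hr, hτ, ⟨hI', hlt⟩, ht, hs⟩ := h _ σ hσ ⟨hI, hx, rfl⟩
      obtain ⟨ρ, t', s', hr', hρ, hQ, ht', hs'⟩ := ih τ hτ ⟨hI', by omega⟩
      refine ⟨ρ, _, _, .while_ne hx hr hr', hρ, hQ, ?_, max_le hs hs'⟩
      have : 1 ≤ (1 + W.size) ^ 2 := Nat.one_le_iff_ne_zero.2 (by positivity)
      calc 1 + t + t' ≤ (1 + W.size) ^ 2 + N * (1 + W.size) ^ 2
          + (1 + n * (N + 1)) * (1 + W.size) ^ 2 := by omega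
        _ = _ := by ring

end Hoare

/-- Assignments. -/
inductive Cmd (r : ℕ)
  | const (x : Fin r) (n : ℕ)
  | arith (o : Op) (x y z : Fin r)

namespace Cmd

variable {r : ℕ}

def prog : Cmd r → Prog r
  | const x n => .const x n
  | arith o x y z => .arith o x y z

def target : Cmd r → Fin r
  | const x _ => x
  | arith _ x _ _ => x

def val (σ : Fin r → ℕ) : Cmd r → ℕ
  | const _ n => n
  | arith o _ y z => o.eval (σ y) (σ z)

/-- A nonempty sequence of assignments. -/
def block : Cmd r → List (Cmd r) → Prog r
  | a, [] => a.prog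
  | a, b :: l => .seq a.prog (block b l)

/-- The weakest precondition of a sequence of assignments. -/
def wp (W : ℕ) (Q : (Fin r → ℕ) → Prop) : List (Cmd r) → (Fin r → ℕ) → Prop
  | [], σ => Q σ
  | a :: l, σ => a.val σ < W ∧ wp W Q l (Function.update σ a.target (a.val σ))

end Cmd

theorem Hoare.cmd {r W : ℕ} {P Q : (Fin r → ℕ) → Prop} (a : Cmd r)
    (h : ∀ σ, (∀ i, σ i < W) → P σ → a.val σ < W ∧ Q (Function.update σ a.target (a.val σ))) :
    Hoare W P a.prog 1 Q := by
  intro σ hσ hP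
  obtain ⟨hv, hQ⟩ := h σ hσ hP
  have hτ : ∀ i, Function.update σ a.target (a.val σ) i < W := fun i => by
    by_cases hi : i = a.target
    · subst hi; simpa using hv
    · simpa [hi] using hσ i
  have hs : ∀ {n}, n < W → n.size ≤ W.size := fun hn => Nat.size_le_size hn.le
  cases a with
  | const x n =>
    refine ⟨_, _, _, .const x n σ, hτ, hQ, ?_, max_le (bits_le hσ) (bits_le hτ)⟩
    have := hs (show n < W from hv)
    nlinarith
  | arith o x y z =>
    refine ⟨_, _, _, .arith o x y z σ, hτ, hQ, ?_, max_le (bits_le hσ) (bits_le hτ)⟩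
    rw [one_mul, sq]
    exact Nat.mul_le_mul (Nat.add_le_add_left (hs (hσ y)) 1) (Nat.add_le_add_left (hs (hσ z)) 1)

theorem Hoare.block {r W : ℕ} {P Q : (Fin r → ℕ) → Prop} (a : Cmd r) (l : List (Cmd r))
    (h : ∀ σ, (∀ i, σ i < W) → P σ → Cmd.wp W Q (a :: l) σ) :
    Hoare W P (Cmd.block a l) (l.length + 1) Q := by
  induction l generalizing a P with
  | nil => exact Hoare.cmd a h
  | cons b l ih =>
    have := (Hoare.cmd (W := W) (P := P) (Q := Cmd.wp W Q (b :: l)) a h).seq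
      (ih (P := Cmd.wp W Q (b :: l)) b fun σ _ h => h)
    rwa [add_comm] at this

/-! ### Modular exponentiation -/

/-- `r11 := 16 ^ r13 mod r10` by repeated squaring. -/
def powMod : Prog 16 :=
  .seq (Cmd.block (.const 11 1) [.const 12 16, .arith .mod 12 12 10])
    (.while 13 (Cmd.block (.const 14 2) [.arith .mod 15 13 14, .arith .div 13 13 14,
      .arith .mul 14 15 12, .arith .mul 12 12 12, .arith .mod 12 12 10, .const 1 1,
      .arith .sub 15 1 15, .arith .add 14 14 15, .arith .mul 11 11 14, .arith .mod 11 11 10]))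

/-- One squaring step preserves s b^e modulo m. The expression e % 2 * b + (1 - e % 2) is b or 1
according to the lowest bit of e, so the program needs no branching. -/
theorem powMod_step (m b s e : ℕ) :
    (s * (e % 2 * b + (1 - e % 2)) % m) * (b * b % m) ^ (e / 2) % m = s * b ^ e % m := by
  have h : s * b ^ e = s * (e % 2 * b + (1 - e % 2)) * (b * b) ^ (e / 2) := by
    conv_lhs => rw [← Nat.div_add_mod e 2, pow_add, pow_mul]
    rcases Nat.mod_two_eq_zero_or_one e with h | h <;> rw [h] <;> ring
  rw [h]
  exact ((Nat.mod_modEq _ m).mul ((Nat.mod_modEq _ m).pow _))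

theorem size_eq_log {n : ℕ} (hn : n ≠ 0) : n.size = Nat.log 2 n + 1 := by
  refine le_antisymm (Nat.size_le.2 (Nat.lt_pow_succ_log_self one_lt_two n)) ?_
  exact Nat.lt_size.2 (Nat.pow_log_le_self 2 hn)

theorem size_div_two (n : ℕ) : (n / 2).size = n.size - 1 := by
  rcases eq_or_ne (n / 2) 0 with h | h
  · have : n.size ≤ 1 := Nat.size_le.2 (by omega)
    rw [h, Nat.size_zero]; omega
  · have h1 : 0 < Nat.log 2 n := Nat.log_pos one_lt_two (by omega)
    rw [size_eq_log h, size_eq_log (by omega), Nat.log_div_base]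
    omega

/-- The registers that `powMod` leaves unchanged. -/
def Frame (V E a n M m : ℕ) (σ : Fin 16 → ℕ) : Prop :=
  σ 4 = V ∧ σ 5 = E ∧ σ 6 = a ∧ σ 7 = n ∧ σ 9 = M ∧ σ 10 = m

/-- The invariant is r11 · r12^r13 ≡ 16^e modulo m with both residues reduced; m² < W leaves room
for their product. Each pass shortens the exponent by one bit, so `W.size` bounds the number of
passes. -/
theorem hoare_powMod {W V E a n M m e : ℕ} (hm : 1 < m) (hW : m * m < W) (hW' : 16 < W) :
    Hoare W (fun σ => Frame V E a n M m σ ∧ σ 13 = e) powMod (4 + W.size * 12)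
      (fun τ => Frame V E a n M m τ ∧ τ 11 = 16 ^ e % m) := by
  have hmW : m < W := by nlinarith
  have hloop := Hoare.while_do (W := W) (x := 13) (N := 11) (n := W.size)
    (p := (Cmd.block (.const 14 2) [.arith .mod 15 13 14, .arith .div 13 13 14,
      .arith .mul 14 15 12, .arith .mul 12 12 12, .arith .mod 12 12 10, .const 1 1,
      .arith .sub 15 1 15, .arith .add 14 14 15, .arith .mul 11 11 14, .arith .mod 11 11 10]))
    (fun σ : Fin 16 → ℕ => Frame V E a n M m σ ∧ σ 11 < m ∧ σ 12 < m ∧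
      σ 11 * σ 12 ^ σ 13 % m = 16 ^ e % m) (fun σ => (σ 13).size) (fun k => by
      refine Hoare.block _ _ ?_
      rintro σ hσ ⟨⟨⟨h4, h5, h6, h7, h9, h10⟩, h11, h12, hinv⟩, h13, rfl⟩
      have he := hσ 13
      have hs : (σ 13 / 2).size < (σ 13).size := by
        have := Nat.size_pos.2 (Nat.pos_of_ne_zero h13)
        rw [size_div_two]; omega
      simp only [Cmd.wp, Cmd.val, Cmd.target, Op.eval, Function.update_apply, Frame, Fin.reduceEq,
        reduceIte, h4, h5, h6, h7, h9, h10, and_self, true_and]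
      generalize σ 13 = f at *
      generalize σ 12 = b at *
      generalize σ 11 = s at *
      have hfac : f % 2 * b + (1 - f % 2) < m := by
        rcases Nat.mod_two_eq_zero_or_one f with h | h <;> rw [h] <;> omega
      have hfb : f % 2 * b < W := by omega
      have hbb : b * b < W := (Nat.mul_le_mul h12.le h12.le).trans_lt hW
      have hsf : s * (f % 2 * b + (1 - f % 2)) < W := (Nat.mul_le_mul h11.le hfac.le).trans_lt hW
      have hm0 : 0 < m := by omega
      have h1 := Nat.mod_lt (b * b) hm0
      have h2 := Nat.mod_lt (s * (f % 2 * b + (1 - f % 2))) hm0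
      have h3 := powMod_step m b s f
      refine ⟨by omega, by omega, by omega, hfb, hbb, by omega, by omega, by omega, by omega, hsf,
        by omega, ⟨h2, h1, h3.trans hinv⟩, hs⟩)
  refine ((Hoare.block _ _ ?_).seq hloop).conseq (fun _ h => h) (by simp; omega) ?_
  · rintro σ hσ ⟨⟨h4, h5, h6, h7, h9, h10⟩, h13⟩
    have h1 := Nat.mod_lt 16 (by omega : 0 < m)
    have h2 : e.size ≤ W.size := Nat.size_le_size (h13 ▸ (hσ 13).le)
    simp only [Cmd.wp, Cmd.val, Cmd.target, Op.eval, Function.update_apply, Frame, Fin.reduceEq,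
      reduceIte, h4, h5, h6, h7, h9, h10, h13, and_self, true_and]
    refine ⟨by omega, hW', by omega, ⟨hm, h1, ?_⟩, h2⟩
    rw [one_mul, ← Nat.pow_mod]
  · rintro τ ⟨⟨hF, h11, h12, hinv⟩, h13⟩
    rw [h13, pow_zero, mul_one, Nat.mod_eq_of_lt h11] at hinv
    exact ⟨hF, hinv⟩

/-! ### Summation of one series -/

/-- The series `(a - b) ∑ 16 ^ (-w n) / (8 n + r) ^ 4`. -/
structure Item where
  w : ℕ
  r : ℕ
  a : ℕ
  b : ℕ

/-- `⌊16 ^ (E - w n) / (Q (8 n + r) ^ 4)⌋ mod V` -/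
def Item.quot (i : Item) (Q V E n : ℕ) : ℕ :=
  16 ^ (E - i.w * n) % (Q * (8 * n + i.r) ^ 4 * V) / (Q * (8 * n + i.r) ^ 4)

/-- `r13 := r8 - 1`, `r9 := Q (8 r7 + r) ^ 4`, `r10 := r9 r4` -/
def Item.setup (Q : ℕ) (i : Item) : Prog 16 :=
  Cmd.block (.const 14 1) [.arith .sub 13 8 14, .const 14 8, .arith .mul 9 14 7,
    .const 14 i.r, .arith .add 9 9 14, .arith .mul 9 9 9, .arith .mul 9 9 9, .const 14 Q,
    .arith .mul 9 14 9, .arith .mul 10 9 4]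

/-- Adds the multiple `a - b` of `r11 / r9` to `r6` modulo `r4`, increments `r7` and sets `r8`. -/
def Item.update (i : Item) : Prog 16 :=
  Cmd.block (.arith .div 11 11 9) [.const 14 i.a, .arith .mul 14 14 11, .arith .sub 11 4 11,
    .const 15 i.b, .arith .mul 15 15 11, .arith .add 6 6 14, .arith .add 6 6 15,
    .arith .mod 6 6 4, .const 14 1, .arith .add 7 7 14, .const 14 i.w, .arith .mul 14 14 7,
    .arith .sub 8 5 14]

/-- Adds the terms of the series to `r6`, modulo `r4`; the exponents are less than `r5`. -/
def Item.prog (Q : ℕ) (i : Item) : Prog 16 :=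
  .seq (Cmd.block (.const 7 0) [.arith .add 8 5 7])
    (.while 8 (.seq (i.setup Q) (.seq powMod i.update)))

/-- Register 8 holds E + 1 - wn, one more than the exponent: under truncated subtraction it vanishes
exactly when wn > E, and so serves as the loop condition. -/
theorem Item.hoare_setup {W Q V E n s : ℕ} (i : Item) (hQ : 1 ≤ Q) (hV : 1 ≤ V) (hr : 1 ≤ i.r)
    (hW : Q * (8 * n + i.r) ^ 4 * V < W) (hW' : 8 < W) :
    Hoare W (fun σ => σ 4 = V ∧ σ 5 = E + 1 ∧ σ 6 = s ∧ σ 7 = n ∧ σ 8 = E + 1 - i.w * n)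
      (i.setup Q) 11 (fun τ => Frame V (E + 1) s n (Q * (8 * n + i.r) ^ 4)
        (Q * (8 * n + i.r) ^ 4 * V) τ ∧ τ 13 = E - i.w * n) := by
  refine Hoare.block _ _ ?_
  rintro σ hσ ⟨h4, h5, h6, h7, h8⟩
  simp only [Cmd.wp, Cmd.val, Cmd.target, Op.eval, Function.update_apply, Frame, Fin.reduceEq,
    reduceIte, h4, h5, h6, h7, h8, true_and]
  have h8W : E + 1 - i.w * n < W := h8 ▸ hσ 8
  rw [show (8 * n + i.r) * (8 * n + i.r) = (8 * n + i.r) ^ 2 by ring,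
    show (8 * n + i.r) ^ 2 * (8 * n + i.r) ^ 2 = (8 * n + i.r) ^ 4 by ring]
  have b1 : 8 * n + i.r ≤ (8 * n + i.r) ^ 4 := Nat.le_self_pow (by norm_num) _
  have b2 : (8 * n + i.r) ^ 2 ≤ (8 * n + i.r) ^ 4 := Nat.pow_le_pow_right (by omega) (by norm_num)
  have b0 : 0 < (8 * n + i.r) ^ 4 := by positivity
  generalize (8 * n + i.r) ^ 4 = Y at *
  have b3 : Y ≤ Q * Y := Nat.le_mul_of_pos_left _ hQ
  have b4 : Q ≤ Q * Y := Nat.le_mul_of_pos_right _ b0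
  have b5 : Q * Y ≤ Q * Y * V := Nat.le_mul_of_pos_right _ hV
  refine ⟨by omega, by omega, hW', by omega, by omega, by omega, by omega, by omega, by omega,
    by omega, hW, by omega⟩

theorem Item.quot_lt {Q V : ℕ} (i : Item) (E n : ℕ) (hQ : 1 ≤ Q) (hV : 1 ≤ V) (hr : 1 ≤ i.r) :
    i.quot Q V E n < V := by
  have : 0 < Q * (8 * n + i.r) ^ 4 := by positivity
  rw [Item.quot, Nat.div_lt_iff_lt_mul this, mul_comm V]
  exact Nat.mod_lt _ (by positivity)

/-- As registers hold natural numbers, -bq is added in the form b(V - q), which is congruent to it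
modulo V. The bound V(1 + 2C) covers the sum before reduction. -/
theorem Item.hoare_update {W Q V E n s C : ℕ} (i : Item) (hQ : 1 ≤ Q) (hV : 1 ≤ V) (hr : 1 ≤ i.r)
    (hw : 1 ≤ i.w) (hwC : i.w ≤ C) (haC : i.a ≤ C) (hbC : i.b ≤ C) (hs : s < V) (hn : i.w * n ≤ E)
    (hC : 1 ≤ C) (hW : V * (1 + 2 * C) < W) (hW' : C * (E + 1) < W) :
    Hoare W (fun σ => Frame V (E + 1) s n (Q * (8 * n + i.r) ^ 4)
        (Q * (8 * n + i.r) ^ 4 * V) σ ∧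
        σ 11 = 16 ^ (E - i.w * n) % (Q * (8 * n + i.r) ^ 4 * V))
      i.update 14 (fun τ => τ 4 = V ∧ τ 5 = E + 1 ∧
        τ 6 = (s + i.a * i.quot Q V E n + i.b * (V - i.quot Q V E n)) % V ∧ τ 7 = n + 1 ∧
        τ 8 = E + 1 - i.w * (n + 1)) := by
  refine Hoare.block _ _ ?_
  rintro σ hσ ⟨⟨h4, h5, h6, h7, h9, -⟩, h11⟩
  have hE : E + 1 < W := h5 ▸ hσ 5
  have hq := i.quot_lt E n hQ hV hr
  simp only [Cmd.wp, Cmd.val, Cmd.target, Op.eval, Function.update_apply, Fin.reduceEq,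
    reduceIte, h4, h5, h6, h7, h9, h11, and_self, true_and, and_true]
  rw [show 16 ^ (E - i.w * n) % (Q * (8 * n + i.r) ^ 4 * V) / (Q * (8 * n + i.r) ^ 4) =
    i.quot Q V E n from rfl]
  generalize i.quot Q V E n = q at *
  have b1 : i.a * q ≤ C * V := Nat.mul_le_mul haC hq.le
  have b2 : i.b * (V - q) ≤ C * V := Nat.mul_le_mul hbC (Nat.sub_le _ _)
  have b3 : V * (1 + 2 * C) = V + 2 * (C * V) := by ring
  have b4 : C ≤ C * V := Nat.le_mul_of_pos_right _ hV
  have b5 := Nat.mod_lt (s + i.a * q + i.b * (V - q)) hV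
  have hn1 : n + 1 ≤ E + 1 := Nat.succ_le_succ ((Nat.le_mul_of_pos_left n hw).trans hn)
  have b6 : i.w * (n + 1) ≤ C * (E + 1) := Nat.mul_le_mul hwC hn1
  exact ⟨by omega, by omega, by omega, by omega, by omega, by omega, by omega, by omega,
    by omega, by omega, by omega, by omega, by omega, by omega⟩

/-- The relation A between the number of terms and the accumulator is left abstract, to separate the
machine from the error estimate. The squared bound in `hW` is for the products of residues in
`powMod`. Register 8 decreases by w ≥ 1, so there are at most E + 1 passes. -/
theorem Item.hoare {W Q V E C : ℕ} (i : Item) (hQ : 1 ≤ Q) (hV : 2 ≤ V) (hw : 1 ≤ i.w)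
    (hr : 1 ≤ i.r) (hQC : Q ≤ C) (hwC : i.w ≤ C) (hrC : i.r ≤ C) (haC : i.a ≤ C) (hbC : i.b ≤ C)
    (hC : 16 ≤ C) (hW : (C * (8 * (E + 1) + C) ^ 4 * V) ^ 2 < W) {A : ℕ → ℕ → Prop}
    (hA : ∀ n s, A n s → i.w * n ≤ E →
      A (n + 1) ((s + i.a * i.quot Q V E n + i.b * (V - i.quot Q V E n)) % V)) :
    Hoare W (fun σ => σ 4 = V ∧ σ 5 = E + 1 ∧ σ 6 < V ∧ A 0 (σ 6)) (i.prog Q)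
      (3 + (E + 1) * (30 + W.size * 12))
      (fun τ => τ 4 = V ∧ τ 5 = E + 1 ∧ τ 6 < V ∧ ∃ n ≤ E + 1, E < i.w * n ∧ A n (τ 6)) := by
  obtain ⟨b1, b2, b3⟩ : V * (1 + 2 * C) < W ∧ C * (E + 1) < W ∧ 16 < W := by
    set Y := 8 * (E + 1) + C with hY
    have h1 : Y ^ 2 ≤ Y ^ 4 := Nat.pow_le_pow_right (by omega) (by norm_num)
    have h2 : C * Y ≤ Y * Y := Nat.mul_le_mul_right _ (by omega)
    have h3 : 1 * (Y * Y) * V ≤ C * Y ^ 4 * V := by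
      rw [← sq]
      exact Nat.mul_le_mul_right _ (Nat.mul_le_mul (by omega) h1)
    have h4 : C * 24 * V ≤ Y * Y * V :=
      Nat.mul_le_mul_right _ (Nat.mul_le_mul (by omega) (by omega))
    have h5 : C * Y ≤ Y * Y * V := h2.trans (Nat.le_mul_of_pos_right _ (by omega))
    have h6 : C * Y ^ 4 * V ≤ (C * Y ^ 4 * V) ^ 2 := Nat.le_self_pow (by norm_num) _
    have h7 : C * (E + 1) ≤ C * Y := Nat.mul_le_mul_left _ (by omega)
    have h8 : V ≤ C * V := Nat.le_mul_of_pos_left _ (by omega)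
    have h9 : V * (1 + 2 * C) = V + 2 * (C * V) := by ring
    have h10 : C * 1 ≤ C * Y := Nat.mul_le_mul_left _ (by omega)
    have h11 : C * 24 * V = 24 * (C * V) := by ring
    have h12 : 1 * (Y * Y) * V = Y * Y * V := by ring
    omega
  have body : ∀ n s, s < V → i.w * n ≤ E →
      Hoare W (fun σ => σ 4 = V ∧ σ 5 = E + 1 ∧ σ 6 = s ∧ σ 7 = n ∧ σ 8 = E + 1 - i.w * n)
        (.seq (i.setup Q) (.seq powMod i.update)) (29 + W.size * 12) (fun τ => τ 4 = V ∧
        τ 5 = E + 1 ∧ τ 6 = (s + i.a * i.quot Q V E n + i.b * (V - i.quot Q V E n)) % V ∧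
        τ 7 = n + 1 ∧ τ 8 = E + 1 - i.w * (n + 1)) := by
    intro n s hs hn
    have hnE : n ≤ E := (Nat.le_mul_of_pos_left n hw).trans hn
    have hM : 0 < Q * (8 * n + i.r) ^ 4 := by positivity
    have hm : Q * (8 * n + i.r) ^ 4 * V ≤ C * (8 * (E + 1) + C) ^ 4 * V := by gcongr; omega
    have hm1 : 1 * 2 ≤ Q * (8 * n + i.r) ^ 4 * V := Nat.mul_le_mul hM hV
    have hmm : Q * (8 * n + i.r) ^ 4 * V * (Q * (8 * n + i.r) ^ 4 * V) < W :=
      (Nat.mul_le_mul hm hm).trans_lt (by rwa [← sq])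
    have hmW : Q * (8 * n + i.r) ^ 4 * V < W := lt_of_le_of_lt (Nat.le_mul_self _) hmm
    exact ((i.hoare_setup hQ (by omega) hr hmW (by omega)).seq
      ((hoare_powMod hm1 hmm b3).seq (i.hoare_update hQ (by omega) hr hw hwC haC hbC hs hn
        (by omega) b1 b2))).conseq (fun _ h => h) (by omega) (fun _ h => h)
  have hloop := Hoare.while_do (W := W) (x := 8) (N := 29 + W.size * 12) (n := E + 1)
    (p := .seq (i.setup Q) (.seq powMod i.update))
    (fun σ : Fin 16 → ℕ => σ 4 = V ∧ σ 5 = E + 1 ∧ σ 6 < V ∧ σ 7 ≤ E + 1 ∧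
      σ 8 = E + 1 - i.w * σ 7 ∧ A (σ 7) (σ 6)) (fun σ => σ 8) (fun k => by
      rintro σ hσ ⟨⟨h4, h5, h6, h7, h8, hAσ⟩, h0, rfl⟩
      have hn : i.w * σ 7 ≤ E := by omega
      have hnE : σ 7 ≤ E := (Nat.le_mul_of_pos_left _ hw).trans hn
      obtain ⟨τ, t, s, hr', hτ, ⟨g4, g5, g6, g7, g8⟩, ht, hs⟩ :=
        body _ _ h6 hn σ hσ ⟨h4, h5, rfl, rfl, h8⟩
      refine ⟨τ, t, s, hr', hτ, ⟨⟨g4, g5, ?_, by omega, by rw [g8, g7], ?_⟩, ?_⟩, ht, hs⟩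
      · rw [g6]; exact Nat.mod_lt _ (by omega)
      · rw [g6, g7]; exact hA _ _ hAσ hn
      · rw [g8, h8, mul_add]; omega)
  refine ((Hoare.block _ _ ?_).seq hloop).conseq (fun _ h => h) ?_ ?_
  · rintro σ hσ ⟨h4, h5, h6, hAσ⟩
    have hE : E + 1 < W := h5 ▸ hσ 5
    simp only [Cmd.wp, Cmd.val, Cmd.target, Op.eval, Function.update_apply, Fin.reduceEq,
      reduceIte, h4, h5, true_and, mul_zero, add_zero, Nat.sub_zero]
    exact ⟨by omega, hE, ⟨h6, by omega, hAσ⟩, le_rfl⟩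
  · simp only [List.length_cons, List.length_nil]
    rw [show 29 + W.size * 12 + 1 = 30 + W.size * 12 by omega]
    omega
  · rintro τ ⟨⟨h4, h5, h6, h7, h8, hAτ⟩, h0⟩
    exact ⟨h4, h5, h6, τ 7, h7, by omega, hAτ⟩

/-! ### The error of the computation -/

/-- `s` is within `e` of `y` modulo `V`. -/
def NearMod (V s : ℕ) (y e : ℝ) : Prop := ∃ k : ℤ, |(s : ℝ) + k * V - y| ≤ e

theorem NearMod.mono {V s : ℕ} {y y' e e' : ℝ} (h : NearMod V s y e) (hy : |y - y'| ≤ e' - e) :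
    NearMod V s y' e' := by
  obtain ⟨k, hk⟩ := h
  refine ⟨k, ?_⟩
  calc |(s : ℝ) + k * V - y'| = |((s : ℝ) + k * V - y) + (y - y')| := by congr 1; ring
    _ ≤ e' := (abs_add_le _ _).trans (by linarith)

namespace Item

/-- The `n`-th term of the series, divided by `Q`. -/
noncomputable def term (i : Item) (Q n : ℕ) : ℝ :=
  1 / (16 ^ (i.w * n) * (Q * (8 * n + i.r) ^ 4))

/-- The only error is that of the floor, less than 1, times |a - b| ≤ a + b. All reductions change
the value by multiples of V. -/
theorem nearMod_step {Q V E n s : ℕ} {y e : ℝ} (i : Item) (hQ : 1 ≤ Q) (hV : 1 ≤ V)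
    (hr : 1 ≤ i.r) (hn : i.w * n ≤ E) (h : NearMod V s y e) :
    NearMod V ((s + i.a * i.quot Q V E n + i.b * (V - i.quot Q V E n)) % V)
      (y + (i.a - i.b) * (16 ^ E * i.term Q n)) (e + (i.a + i.b)) := by
  obtain ⟨k, hk⟩ := h
  have hq := (i.quot_lt E n hQ hV hr).le
  have hM : (0 : ℝ) < (Q * (8 * n + i.r) ^ 4 : ℕ) := by
    have : 0 < Q * (8 * n + i.r) ^ 4 := by positivity
    exact_mod_cast this
  set f := 16 ^ (E - i.w * n) / (Q * (8 * n + i.r) ^ 4) with hf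
  -- Reducing modulo MV before dividing by M gives the floor modulo V, so the full power of 16 is
  -- never needed.
  have hqf : i.quot Q V E n = f % V := by rw [quot, Nat.mod_mul_right_div_self]
  have hfq : (f : ℝ) = i.quot Q V E n + V * (f / V : ℕ) := by
    rw [hqf]; exact_mod_cast (Nat.mod_add_div f V).symm
  have hz : 16 ^ E * i.term Q n = (16 ^ (E - i.w * n) : ℕ) / (Q * (8 * n + i.r) ^ 4 : ℕ) := by
    obtain ⟨j, rfl⟩ := Nat.exists_eq_add_of_le hn
    rw [term, Nat.add_sub_cancel_left, pow_add]
    push_cast at hM ⊢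
    field_simp
  have h1 : (f : ℝ) ≤ 16 ^ E * i.term Q n := by rw [hz]; exact Nat.cast_div_le
  have h2 : 16 ^ E * i.term Q n < f + 1 := by
    rw [hz, div_lt_iff₀ hM]
    exact_mod_cast Nat.lt_mul_of_div_lt (Nat.lt_succ_self f) (by exact_mod_cast hM)
  generalize 16 ^ E * i.term Q n = z at *
  generalize i.quot Q V E n = q at *
  set T := s + i.a * q + i.b * (V - q) with hT
  have hTr : (T : ℝ) = s + i.a * q + i.b * (V - q) := by rw [hT]; push_cast [hq]; ring
  have hmod : ((T % V : ℕ) : ℝ) = T - V * (T / V : ℕ) := by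
    have : ((T % V + V * (T / V) : ℕ) : ℝ) = T := by rw [Nat.mod_add_div]
    push_cast at this ⊢
    linarith
  generalize T / V = v at *
  generalize f / V = u at *
  -- The multiples of V: v from reducing the sum, b from writing V - q, and (a - b) u from reducing
  -- the quotient.
  refine ⟨k + v - i.b + (i.a - i.b) * u, ?_⟩
  rw [hmod, hTr]
  push_cast
  have hab : |((i.a : ℝ) - i.b) * (f - z)| ≤ i.a + i.b := by
    rw [abs_mul]
    calc |((i.a : ℝ) - i.b)| * |f - z| ≤ (i.a + i.b) * 1 := by
          gcongr
          · rw [abs_le]; constructor <;> linarith [i.a.cast_nonneg (α := ℝ), i.b.cast_nonneg (α := ℝ)]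
          · rw [abs_le]; constructor <;> linarith
      _ = _ := mul_one _
  have h3 := (abs_add_le ((s : ℝ) + k * V - y) (((i.a : ℝ) - i.b) * (f - z))).trans
    (add_le_add hk hab)
  refine le_of_eq_of_le (congrArg _ ?_) h3
  linear_combination ((i.a : ℝ) - i.b) * -hfq

theorem term_nonneg (i : Item) (Q n : ℕ) : 0 ≤ i.term Q n := by
  rw [term]; positivity

theorem term_add_le (i : Item) {Q m : ℕ} (n : ℕ) (hQ : 1 ≤ Q) (hw : 1 ≤ i.w) (hr : 1 ≤ i.r) :
    i.term Q (n + m) ≤ (16 ^ (i.w * m))⁻¹ * (1 / 16) ^ n := by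
  have h1 : (1 : ℝ) ≤ Q * (8 * (n + m : ℕ) + i.r) ^ 4 := by
    have : 1 ≤ Q * (8 * (n + m) + i.r) ^ 4 := Nat.one_le_iff_ne_zero.2 (by positivity)
    exact_mod_cast this
  have h2 : (16 : ℝ) ^ (i.w * m) * 16 ^ n ≤ 16 ^ (i.w * (n + m)) := by
    rw [← pow_add]
    exact pow_le_pow_right₀ (by norm_num) (by nlinarith)
  rw [term, one_div_pow, inv_mul_eq_div, div_div, mul_comm _ ((16 : ℝ) ^ (i.w * m))]
  refine one_div_le_one_div_of_le (by positivity) (h2.trans ?_)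
  exact le_mul_of_one_le_right (by positivity) h1

theorem summable_term (i : Item) {Q : ℕ} (hQ : 1 ≤ Q) (hw : 1 ≤ i.w) (hr : 1 ≤ i.r) :
    Summable (i.term Q) :=
  Summable.of_nonneg_of_le (i.term_nonneg Q) (fun n => i.term_add_le (m := 0) n hQ hw hr)
    ((summable_geometric_of_lt_one (by norm_num) (by norm_num)).mul_left _)

/-- Once wn > E the scaled tail is dominated by a geometric series and costs no more than one
further rounding. -/
theorem tail_le (i : Item) {Q E n : ℕ} (hQ : 1 ≤ Q) (hw : 1 ≤ i.w) (hr : 1 ≤ i.r)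
    (hn : E < i.w * n) :
    |16 ^ E * ∑ j ∈ Finset.range n, i.term Q j - 16 ^ E * ∑' j, i.term Q j| ≤ 1 := by
  have hs := i.summable_term hQ hw hr
  rw [← hs.sum_add_tsum_nat_add n, abs_sub_comm, mul_add, add_sub_cancel_left, abs_of_nonneg]
  · have hg := (hasSum_geometric_of_lt_one (r := (1 / 16 : ℝ)) (by norm_num) (by norm_num)).mul_left
      ((16 : ℝ) ^ (i.w * n))⁻¹
    have h1 := hasSum_le (fun j => i.term_add_le (m := n) j hQ hw hr)
      ((summable_nat_add_iff n).2 hs).hasSum hg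
    have h2 : (16 : ℝ) ^ E * (16 * (16 ^ (i.w * n))⁻¹) ≤ 1 := by
      rw [← mul_assoc, ← pow_succ, ← div_eq_mul_inv, div_le_one (by positivity)]
      exact pow_le_pow_right₀ (by norm_num) hn
    calc 16 ^ E * ∑' j, i.term Q (j + n) ≤ 16 ^ E * ((16 ^ (i.w * n))⁻¹ * (1 - 1 / 16)⁻¹) := by
          gcongr
      _ ≤ 16 ^ E * (16 * (16 ^ (i.w * n))⁻¹) := by
          rw [mul_comm 16]; gcongr; norm_num
      _ ≤ 1 := h2
  · have : 0 ≤ ∑' j, i.term Q (j + n) := tsum_nonneg fun j => i.term_nonneg Q _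
    positivity

/-- The parameters of the series are admissible and bounded by `C`. -/
def Bounded (C : ℕ) (i : Item) : Prop :=
  1 ≤ i.w ∧ 1 ≤ i.r ∧ i.w ≤ C ∧ i.r ≤ C ∧ i.a ≤ C ∧ i.b ≤ C

/-- At most E + 1 roundings and one tail, each weighted by a + b, account for the factor E + 2. -/
theorem hoare_nearMod {W Q V E C : ℕ} {y e : ℝ} (i : Item) (hQ : 1 ≤ Q) (hV : 2 ≤ V)
    (hi : i.Bounded C) (hQC : Q ≤ C) (hC : 16 ≤ C)
    (hW : (C * (8 * (E + 1) + C) ^ 4 * V) ^ 2 < W) :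
    Hoare W (fun σ => σ 4 = V ∧ σ 5 = E + 1 ∧ σ 6 < V ∧ NearMod V (σ 6) y e) (i.prog Q)
      (3 + (E + 1) * (30 + W.size * 12))
      (fun τ => τ 4 = V ∧ τ 5 = E + 1 ∧ τ 6 < V ∧
        NearMod V (τ 6) (y + (i.a - i.b) * (16 ^ E * ∑' n, i.term Q n))
          (e + (i.a + i.b) * (E + 2))) := by
  obtain ⟨hw, hr, hwC, hrC, haC, hbC⟩ := hi
  refine (i.hoare hQ hV hw hr hQC hwC hrC haC hbC hC hW (A := fun n s => NearMod V s
    (y + (i.a - i.b) * (16 ^ E * ∑ j ∈ Finset.range n, i.term Q j)) (e + (i.a + i.b) * n))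
    ?_).conseq ?_ le_rfl ?_
  · intro n s h hn
    have := i.nearMod_step hQ (by omega) hr hn h
    convert this using 1
    · rw [Finset.sum_range_succ]; ring
    · push_cast; ring
  · rintro σ ⟨h4, h5, h6, h⟩
    exact ⟨h4, h5, h6, by simpa using h⟩
  · rintro τ ⟨h4, h5, h6, n, hn, hn', h⟩
    refine ⟨h4, h5, h6, h.mono ?_⟩
    have ht := i.tail_le hQ hw hr hn'
    have hab : |((i.a : ℝ) - i.b)| ≤ i.a + i.b := by
      rw [abs_le]; constructor <;> linarith [i.a.cast_nonneg (α := ℝ), i.b.cast_nonneg (α := ℝ)]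
    have hnE : (n : ℝ) ≤ E + 1 := by exact_mod_cast hn
    rw [add_sub_add_left_eq_sub, ← mul_sub, abs_mul]
    calc _ ≤ ((i.a : ℝ) + i.b) * 1 := by gcongr
      _ ≤ (i.a + i.b) * (E + 2 - n) := by gcongr; linarith
      _ = _ := by ring

end Item

/-! ### The whole computation -/

/-- Evaluates a list of series, and outputs the leading digit of the result. -/
def sumProg (Q : ℕ) : List Item → Prog 16
  | [] => Cmd.block (.const 14 16) [.arith .mul 0 6 14, .arith .div 0 0 4]
  | i :: l => .seq (i.prog Q) (sumProg Q l)

theorem hoare_sumProg {W Q V E C : ℕ} (l : List Item) (hQ : 1 ≤ Q) (hV : 2 ≤ V)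
    (hl : ∀ i ∈ l, i.Bounded C) (hQC : Q ≤ C) (hC : 16 ≤ C)
    (hW : (C * (8 * (E + 1) + C) ^ 4 * V) ^ 2 < W) (hVW : 16 * V < W) (y e : ℝ) :
    Hoare W (fun σ => σ 4 = V ∧ σ 5 = E + 1 ∧ σ 6 < V ∧ NearMod V (σ 6) y e) (sumProg Q l)
      (3 + l.length * (3 + (E + 1) * (30 + W.size * 12)))
      (fun τ => ∃ s < V, τ 0 = s * 16 / V ∧
        NearMod V s (y + 16 ^ E * (l.map fun i => ((i.a : ℝ) - i.b) * ∑' n, i.term Q n).sum)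
          (e + (l.map fun i => (i.a : ℝ) + i.b).sum * (E + 2))) := by
  induction l generalizing y e with
  | nil =>
    refine (Hoare.block _ _ ?_).conseq (fun _ h => h) (by simp) (fun _ h => h)
    rintro σ hσ ⟨h4, h5, h6, h⟩
    simp only [Cmd.wp, Cmd.val, Cmd.target, Op.eval, Function.update_apply, Fin.reduceEq,
      reduceIte, h4]
    refine ⟨by omega, by omega, (Nat.div_le_self _ _).trans_lt (by omega), σ 6, h6, rfl, ?_⟩
    simpa using h
  | cons i l ih =>
    rw [List.forall_mem_cons] at hl
    refine ((i.hoare_nearMod hQ hV hl.1 hQC hC hW).seq (ih hl.2 _ _)).conseq (fun _ h => h)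
      (by rw [List.length_cons]; exact le_of_eq (by ring)) ?_
    rintro τ ⟨s, hs, h0, h⟩
    refine ⟨s, hs, h0, ?_⟩
    convert h using 1
    · rw [List.map_cons, List.sum_cons]; ring
    · rw [List.map_cons, List.sum_cons]; ring

/-- `r2 := ⌊log₂ (r0 + 1)⌋` -/
def logProg : Prog 16 :=
  .seq (Cmd.block (.const 14 1) [.arith .add 1 0 14, .const 15 2, .arith .div 1 1 15, .const 2 0])
    (.while 1 (Cmd.block (.const 14 1) [.arith .add 2 2 14, .const 15 2, .arith .div 1 1 15]))

/-- Bit length exceeds ⌊log₂⌋ by one, so the halvings are counted from (d + 1)/2 on. The sum of the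
counter and the bit length of r1 is invariant. -/
theorem hoare_logProg {W d : ℕ} (hW : d + 2 < W) :
    Hoare W (fun σ => σ 0 = d) logProg (6 + Nat.log 2 (d + 1) * 5)
      (fun τ => τ 0 = d ∧ τ 2 = Nat.log 2 (d + 1)) := by
  have hsz : (d + 1).size = Nat.log 2 (d + 1) + 1 := size_eq_log d.succ_ne_zero
  have hlog : Nat.log 2 (d + 1) < d + 1 := Nat.log_lt_self 2 d.succ_ne_zero
  have hloop := Hoare.while_do (W := W) (x := 1) (N := 4) (n := Nat.log 2 (d + 1))
    (p := Cmd.block (.const 14 1) [.arith .add 2 2 14, .const 15 2, .arith .div 1 1 15])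
    (fun σ : Fin 16 → ℕ => σ 0 = d ∧ σ 2 + (σ 1).size = Nat.log 2 (d + 1))
    (fun σ => (σ 1).size) (fun k => by
      refine Hoare.block _ _ ?_
      rintro σ hσ ⟨⟨h0, h2⟩, h1, rfl⟩
      have hs := size_div_two (σ 1)
      have hp := Nat.size_pos.2 (Nat.pos_of_ne_zero h1)
      have := hσ 1
      simp only [Cmd.wp, Cmd.val, Cmd.target, Op.eval, Function.update_apply, Fin.reduceEq,
        reduceIte, h0, true_and]
      exact ⟨by omega, by omega, by omega, by omega, by omega, by omega⟩)
  refine ((Hoare.block _ _ ?_).seq hloop).conseq (fun _ h => h) (by simp; omega) ?_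
  · rintro σ hσ h0
    have hs := size_div_two (d + 1)
    simp only [Cmd.wp, Cmd.val, Cmd.target, Op.eval, Function.update_apply, Fin.reduceEq,
        reduceIte, h0, true_and]
    exact ⟨by omega, by omega, by omega, by omega, by omega, by omega, by omega⟩
  · rintro τ ⟨⟨h0, h2⟩, h1⟩
    rw [h1, Nat.size_zero] at h2
    exact ⟨h0, h2⟩

/-- The exponent c is fixed for each machine, so the c-th power is unrolled into c multiplications.
-/
theorem wp_replicate_mul {W : ℕ} {Q : (Fin 16 → ℕ) → Prop} {c d k X : ℕ} {σ : Fin 16 → ℕ}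
    (h0 : σ 0 = d) (h2 : σ 2 = k) (h3 : σ 3 = X) (hk : 1 ≤ k) (hW : X * k ^ c < W)
    (h : ∀ τ : Fin 16 → ℕ, τ 0 = d → τ 2 = k → τ 3 = X * k ^ c → Q τ) :
    Cmd.wp W Q (List.replicate c (.arith .mul 3 3 2)) σ := by
  induction c generalizing X σ with
  | zero => exact h σ h0 h2 (by simpa using h3)
  | succ c ih =>
    rw [List.replicate_succ]
    simp only [Cmd.wp, Cmd.val, Cmd.target, Op.eval, h2, h3]
    have e : X * k * k ^ c = X * k ^ (c + 1) := by ring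
    refine ⟨lt_of_le_of_lt ?_ hW, ih (X := X * k) ?_ ?_ ?_ (by rwa [e]) (by simpa only [e] using h)⟩
    · rw [← e]; exact Nat.le_mul_of_pos_right _ (by positivity)
    · simpa using h0
    · simpa using h2
    · simp

/-- With `ℓ = ⌊log₂ (r0 + 1)⌋` and `X = ℓ ^ c + ℓ + k`, `r4 := 256 ^ X`, `r5 := 2 X + r0` and
`r6 := 0`. -/
def setupProg (c k : ℕ) : Prog 16 :=
  .seq logProg (.seq (Cmd.block (.const 3 1) (List.replicate c (.arith .mul 3 3 2)))
    (.seq (Cmd.block (.arith .add 3 3 2) [.const 14 k, .arith .add 3 3 14, .arith .add 5 3 3,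
      .arith .add 5 5 0, .const 4 1, .const 6 0])
    (.while 3 (Cmd.block (.const 14 256) [.arith .mul 4 4 14, .const 14 1, .arith .sub 3 3 14]))))

/-- Since 256^X = 16^(2X), there are 2X guard digits. In X the power ℓ^c pays for the required
precision, ℓ for the number of terms, and k for constants. -/
theorem hoare_setupProg {W c k d X : ℕ} (hd : 1 ≤ d)
    (hX : X = Nat.log 2 (d + 1) ^ c + Nat.log 2 (d + 1) + k) (hX0 : 2 ≤ X)
    (hW : 256 ^ X < W) (hW' : 2 * X + d < W) :
    Hoare W (fun σ => σ 0 = d) (setupProg c k) (15 + c + 10 * X)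
      (fun τ => τ 4 = 256 ^ X ∧ τ 5 = 2 * X + d ∧ τ 6 = 0) := by
  have hl : 1 ≤ Nat.log 2 (d + 1) := Nat.log_pos one_lt_two (by omega)
  have h256 : 256 ^ 1 ≤ 256 ^ X := Nat.pow_le_pow_right (by norm_num) (by omega)
  have hloop := Hoare.while_do (W := W) (x := 3) (N := 4) (n := X)
    (p := Cmd.block (.const 14 256) [.arith .mul 4 4 14, .const 14 1, .arith .sub 3 3 14])
    (fun σ : Fin 16 → ℕ => σ 5 = 2 * X + d ∧ σ 6 = 0 ∧ σ 4 * 256 ^ (σ 3) = 256 ^ X)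
    (fun σ => σ 3) (fun n => by
      refine Hoare.block _ _ ?_
      rintro σ hσ ⟨⟨h5, h6, h4⟩, h3, rfl⟩
      obtain ⟨j, hj⟩ := Nat.exists_eq_succ_of_ne_zero h3
      have hjW := hσ 3
      rw [hj, Nat.succ_eq_add_one, pow_succ', ← mul_assoc] at h4
      have hle : σ 4 * 256 ≤ 256 ^ X := h4 ▸ Nat.le_mul_of_pos_right _ (by positivity)
      simp only [Cmd.wp, Cmd.val, Cmd.target, Op.eval, Function.update_apply, Fin.reduceEq,
        reduceIte, h5, h6, hj, true_and, Nat.succ_eq_add_one, Nat.add_sub_cancel]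
      exact ⟨by omega, by omega, by omega, by omega, h4, by omega⟩)
  have hlog := @hoare_logProg W d (by omega)
  generalize Nat.log 2 (d + 1) = l at *
  have hpow : 1 ≤ l ^ c := Nat.one_le_pow _ _ hl
  refine (hlog.seq ((Hoare.block (Q := fun τ => τ 0 = d ∧ τ 2 = l ∧ τ 3 = l ^ c) _ _ ?_).seq
    ((Hoare.block _ _ ?_).seq hloop))).conseq (fun _ h => h) (by simp; omega) ?_
  · rintro σ hσ ⟨h0, h2⟩
    refine ⟨by simp only [Cmd.val]; omega, ?_⟩
    refine wp_replicate_mul (d := d) (k := l) (X := 1) ?_ ?_ ?_ hl (by omega) ?_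
    · simpa [Cmd.target] using h0
    · simpa [Cmd.target] using h2
    · simp [Cmd.target, Cmd.val]
    · intro τ h0 h2 h3
      exact ⟨h0, h2, by simpa using h3⟩
  · rintro σ hσ ⟨h0, h2, h3⟩
    simp only [Cmd.wp, Cmd.val, Cmd.target, Op.eval, Function.update_apply, Fin.reduceEq,
      reduceIte, h0, h2, h3, ← hX, one_mul, and_true, le_refl]
    exact ⟨by omega, by omega, by omega, by omega, by omega, by omega, by omega, by omega⟩
  · rintro τ ⟨⟨h5, h6, h4⟩, h3⟩
    rw [h3, pow_zero, mul_one] at h4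
    exact ⟨h4, h5, h6⟩

/-- The leading digit of a good approximation is acceptable. -/
theorem acceptableDigit_of_nearMod {x e : ℝ} {d m P s : ℕ} (hx : 1 / 16 ≤ x) (hs : s < 16 ^ P)
    (h : NearMod (16 ^ P) s (16 ^ (P + d) * x) e) (he : e * 16 ^ (m + 1) < 16 ^ P) :
    AcceptableDigit 16 x (d + 1) m (s * 16 / 16 ^ P) := by
  obtain ⟨k, hk⟩ := h
  have hV : (0 : ℝ) < 16 ^ P := by positivity
  have hsV : (s : ℝ) < 16 ^ P := by exact_mod_cast hs
  have he0 : 0 ≤ e := (abs_nonneg _).trans hk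
  push_cast at hk
  -- Acceptability demands y ≥ 0. Here x ≥ 1/16 enters: the scaled number is at least V/16, which
  -- exceeds the error e, so k cannot be negative.
  have hk0 : 0 ≤ k := by
    have h1 : (16 : ℝ) ^ P * (1 / 16) ≤ 16 ^ (P + d) * x := by
      rw [pow_add, mul_assoc]
      gcongr
      exact hx.trans (le_mul_of_one_le_left (by linarith) (one_le_pow₀ (by norm_num)))
    have h2 : e * 16 ≤ e * 16 ^ (m + 1) := by
      gcongr
      exact le_self_pow₀ (by norm_num) (by omega)
    have h3 := (abs_le.1 hk).1
    have h4 : (0 : ℝ) < (1 + k) * 16 ^ P := by linarith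
    have h5 : (0 : ℝ) < 1 + k := pos_of_mul_pos_left h4 hV.le
    have h6 : 0 < 1 + k := by exact_mod_cast h5
    omega
  lift k to ℕ using hk0
  -- The approximation with its scaling undone; the multiple k of V affects only earlier digits.
  refine ⟨(s + k * 16 ^ P) / 16 ^ (P + d), by positivity, ?_, ?_⟩
  · have hE : (0 : ℝ) < 16 ^ (P + d) := by positivity
    rw [show (s + k * 16 ^ P) / 16 ^ (P + d) - x =
      (s + k * 16 ^ P - 16 ^ (P + d) * x) / 16 ^ (P + d) by field_simp, abs_div, abs_of_pos hE,
      div_lt_div_iff₀ hE (by positivity), one_mul]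
    push_cast at hk ⊢
    calc _ ≤ e * 16 ^ (d + 1 + m) := by gcongr
      _ = e * 16 ^ (m + 1) * 16 ^ d := by ring
      _ < 16 ^ P * 16 ^ d := by gcongr
      _ = _ := by rw [pow_add]
  · have h1 : (s + k * 16 ^ P : ℝ) / 16 ^ (P + d) * ((16 : ℕ) : ℝ) ^ (d + 1 - 1 + 1) =
        (((s + k * 16 ^ P) * 16 : ℕ) : ℝ) / ((16 ^ P : ℕ) : ℝ) := by
      rw [Nat.add_sub_cancel, pow_add, pow_succ]
      push_cast
      field_simp
    have h2 : (s + k * 16 ^ P) * 16 / 16 ^ P = s * 16 / 16 ^ P + k * 16 := by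
      rw [show (s + k * 16 ^ P) * 16 = s * 16 + k * 16 * 16 ^ P by ring,
        Nat.add_mul_div_right _ _ (by positivity)]
    have h3 : s * 16 / 16 ^ P < 16 := by
      rw [Nat.div_lt_iff_lt_mul (by positivity)]
      omega
    rw [Real.digits, h1, Nat.floor_div_eq_div, h2]
    rw [Fin.val_ofNat, Nat.add_mul_mod_self_right, Nat.mod_eq_of_lt h3]

/-- There are 2X + d passes for each of n series, O(X) instructions in a pass and O(X²) time for an
instruction on numbers of 35X + 1 bits. With X ≤ GY the product is of order d Y⁴. -/
theorem time_bound {G X Y d c n : ℕ} (hG : 1 ≤ G) (hX : X ≤ G * Y) (hY : 1 ≤ Y) (hd : 1 ≤ d) :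
    (15 + c + 10 * X + (3 + n * (3 + (2 * X + d) * (30 + (35 * X + 1) * 12))))
      * (1 + (35 * X + 1)) ^ 2 ≤
    (18 + c + 10 * G + n * (3 + 1386 * G ^ 2)) * (37 * G) ^ 2 * (d * Y ^ 4) := by
  have hGY : 1 ≤ G * Y := Nat.mul_pos hG hY
  have h1 : 1 + (35 * X + 1) ≤ 37 * G * Y := by nlinarith
  have h2 : 30 + (35 * X + 1) * 12 ≤ 462 * (G * Y) := by omega
  have hdY : d ≤ d * Y := Nat.le_mul_of_pos_right _ hY
  have hYd : Y ≤ d * Y := Nat.le_mul_of_pos_left _ hd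
  have h3 : 2 * X + d ≤ 3 * G * (d * Y) := by nlinarith
  have h4 : d * Y ≤ d * Y * Y := Nat.le_mul_of_pos_right _ hY
  have h5 : (2 * X + d) * (30 + (35 * X + 1) * 12) ≤ 1386 * G ^ 2 * (d * Y * Y) :=
    (Nat.mul_le_mul h3 h2).trans (le_of_eq (by ring))
  have h6 : 15 + c + 10 * X + (3 + n * (3 + (2 * X + d) * (30 + (35 * X + 1) * 12))) ≤
      (18 + c + 10 * G + n * (3 + 1386 * G ^ 2)) * (d * Y * Y) := by
    have e1 : (18 + c) * 1 ≤ (18 + c) * (d * Y * Y) := Nat.mul_le_mul_left _ (by omega)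
    have e2 : G * Y ≤ G * (d * Y * Y) := Nat.mul_le_mul_left _ (by omega)
    have e3 : n * (3 + (2 * X + d) * (30 + (35 * X + 1) * 12)) ≤
        n * ((3 + 1386 * G ^ 2) * (d * Y * Y)) := Nat.mul_le_mul_left _ (by nlinarith)
    calc _ ≤ (18 + c) * (d * Y * Y) + 10 * (G * (d * Y * Y))
          + n * ((3 + 1386 * G ^ 2) * (d * Y * Y)) := by omega
      _ = _ := by ring
  calc _ ≤ (18 + c + 10 * G + n * (3 + 1386 * G ^ 2)) * (d * Y * Y) * (37 * G * Y) ^ 2 := by gcongr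
    _ = _ := by ring

theorem exists_bounded (l : List Item) (h : ∀ i ∈ l, 1 ≤ i.w ∧ 1 ≤ i.r) (Q : ℕ) :
    ∃ C, 16 ≤ C ∧ Q ≤ C ∧ ∀ i ∈ l, i.Bounded C := by
  induction l with
  | nil => exact ⟨16 + Q, by omega, by omega, by simp⟩
  | cons i l ih =>
    rw [List.forall_mem_cons] at h
    obtain ⟨C, hC, hQ, hl⟩ := ih h.2
    refine ⟨C + i.w + i.r + i.a + i.b, by omega, by omega, List.forall_mem_cons.2
      ⟨⟨h.1.1, h.1.2, by omega, by omega, by omega, by omega⟩, fun j hj => ?_⟩⟩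
    obtain ⟨h1, h2, h3, h4, h5, h6⟩ := hl j hj
    exact ⟨h1, h2, by omega, by omega, by omega, by omega⟩

/-- Linear combinations of the series are in SC*. -/
theorem scStar_of_sum {x : ℝ} {Q : ℕ} (l : List Item) (hQ : 1 ≤ Q)
    (hl : ∀ i ∈ l, 1 ≤ i.w ∧ 1 ≤ i.r) (hx : 1 / 16 ≤ x)
    (h : (l.map fun i => ((i.a : ℝ) - i.b) * ∑' n, i.term Q n).sum = x) : SCStar 16 x := by
  intro c
  obtain ⟨C, hC, hQC, hlC⟩ := exists_bounded l hl Q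
  obtain ⟨D, hD⟩ := exists_nat_gt (l.map fun i => (i.a : ℝ) + i.b).sum
  -- Since k < 2^k ≤ 2^X, this choice makes 2^X exceed both 32 + C and 4D.
  set k := 32 + C + 5 * D with hk
  set G := 2 + k with hG
  set T := (18 + c + 10 * G + l.length * (3 + 1386 * G ^ 2)) * (37 * G) ^ 2 with hT
  -- 576 = 16 · 36: sixteen registers of 35X + 1 ≤ 36X bits. The exponent 4(c + 1) comes from Y⁴
  -- with Y = ℓ^(c+1).
  refine ⟨15, .seq (setupProg c k) (sumProg Q l), T + 576 * G, 4 * (c + 1), fun d hd => ?_⟩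
  have hlpos : 1 ≤ Nat.log 2 (d + 1) := Nat.log_pos one_lt_two (by omega)
  have hdlt : d + 1 < 2 ^ (Nat.log 2 (d + 1) + 1) := Nat.lt_pow_succ_log_self one_lt_two _
  obtain ⟨X, hX⟩ : ∃ X, X = Nat.log 2 (d + 1) ^ c + Nat.log 2 (d + 1) + k := ⟨_, rfl⟩
  have hsetup := hoare_setupProg (W := 2 ^ (35 * X)) hd hX (by omega)
  generalize Nat.log 2 (d + 1) = ℓ at *
  obtain ⟨E, hE⟩ : ∃ E, E + 1 = 2 * X + d := ⟨2 * X + d - 1, by omega⟩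
  have hX2 : X < 2 ^ X := Nat.lt_two_pow_self
  have hk2 : 2 ^ k ≤ 2 ^ X := Nat.pow_le_pow_right (by norm_num) (by omega)
  have hk3 : k < 2 ^ k := Nat.lt_two_pow_self
  have hℓ2 : 2 ^ (ℓ + 1) ≤ 2 ^ X := Nat.pow_le_pow_right (by norm_num) (by omega)
  have hE4 : E + 1 ≤ 3 * 2 ^ X := by omega
  have hXX : 2 ^ X * 2 ^ X = 2 ^ (2 * X) := by rw [two_mul, pow_add]
  have h32 : (32 + C) * 2 ^ X ≤ 2 ^ X * 2 ^ X := Nat.mul_le_mul_right _ (by omega)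
  have h8 : 8 * (E + 1) + C ≤ 2 ^ (2 * X) := by
    rw [← hXX]
    refine le_trans ?_ h32
    rw [add_mul]
    have : C * 1 ≤ C * 2 ^ X := Nat.mul_le_mul_left _ (by omega)
    omega
  have hV : 256 ^ X = 2 ^ (8 * X) := by rw [pow_mul]; norm_num
  -- The exponents add up to 2(1 + 4·2 + 8) = 34, which is why W = 2^(35X) suffices.
  have hW : (C * (8 * (E + 1) + C) ^ 4 * 256 ^ X) ^ 2 < 2 ^ (35 * X) := by
    calc (C * (8 * (E + 1) + C) ^ 4 * 256 ^ X) ^ 2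
        ≤ (2 ^ X * (2 ^ (2 * X)) ^ 4 * 2 ^ (8 * X)) ^ 2 := by rw [hV]; gcongr; omega
      _ = 2 ^ (34 * X) := by ring
      _ < _ := Nat.pow_lt_pow_right (by norm_num) (by omega)
  have hVW : 256 ^ X * 256 ≤ 2 ^ (35 * X) := by
    rw [hV, show 256 = 2 ^ 8 by norm_num, ← pow_add]
    exact Nat.pow_le_pow_right (by norm_num) (by omega)
  have h35 : 2 ^ (2 * X) ≤ 2 ^ (35 * X) := Nat.pow_le_pow_right (by norm_num) (by omega)
  have h256 : 256 ^ 1 ≤ 256 ^ X := Nat.pow_le_pow_right (by norm_num) (by omega)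
  obtain ⟨τ, t, s, hrun, -, ⟨a, ha, h0, hnear⟩, ht, hs⟩ :=
    ((hsetup (by omega) (by omega)).seq ((hoare_sumProg (W := 2 ^ (35 * X)) (V := 256 ^ X) (E := E)
      l hQ (by omega) hlC hQC hC hW (by omega) 0 0).conseq (fun σ hσ => ⟨hσ.1, hσ.2.1.trans hE.symm,
        by rw [hσ.2.2]; positivity, 0, by simp [hσ.2.2]⟩) le_rfl (fun _ h => h)))
      (Function.update 0 0 d) (fun i => by
        by_cases hi : i = 0
        · subst hi; simp; omega
        · simp [hi]) (by simp)
  have hY : 1 ≤ ℓ ^ (c + 1) := Nat.one_le_pow _ _ hlpos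
  have hXY : X ≤ G * ℓ ^ (c + 1) := by
    have h1 : ℓ ^ c ≤ ℓ ^ (c + 1) := Nat.pow_le_pow_right hlpos (by omega)
    have h2 : ℓ ≤ ℓ ^ (c + 1) := Nat.le_self_pow (by omega) _
    have h3 : k * 1 ≤ k * ℓ ^ (c + 1) := Nat.mul_le_mul_left _ hY
    rw [hG, add_mul]
    omega
  have hY4 : ℓ ^ (4 * (c + 1)) = (ℓ ^ (c + 1)) ^ 4 := by rw [← pow_mul, mul_comm 4]
  rw [Nat.size_pow] at ht hs
  refine ⟨τ, t, s, hrun, ?_, ?_, ?_⟩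
  · rw [hE] at ht
    refine ht.trans ((time_bound (by omega) hXY hY hd).trans ?_)
    rw [hY4]
    exact Nat.mul_le_mul_right _ (by omega)
  · have h1 : ℓ ^ (c + 1) ≤ (ℓ ^ (c + 1)) ^ 4 := Nat.le_self_pow (by norm_num) _
    have h2 : G * ℓ ^ (c + 1) ≤ G * (ℓ ^ (c + 1)) ^ 4 := Nat.mul_le_mul_left _ h1
    have h3 : 1 * 1 ≤ G * ℓ ^ (c + 1) := Nat.mul_le_mul (by omega) hY
    rw [hY4, add_mul, mul_assoc 576]
    omega
  · have hd1 : d - 1 + 1 = d := by omega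
    have hP : (256 : ℕ) ^ X = 16 ^ (2 * X) := by rw [pow_mul]; norm_num
    rw [zero_add, zero_add, h, hP, show E = 2 * X + (d - 1) by omega] at hnear
    rw [h0, hP, ← hd1]
    refine acceptableDigit_of_nearMod hx (hP ▸ ha) hnear ?_
    rw [show 2 * X + (d - 1) = E by omega]
    -- Half of the 2X guard digits absorb the accumulated error, the other half the precision m + 1.
    have h1 : D * (E + 2) * 16 ^ (ℓ ^ c + 1) < 16 ^ (2 * X) := by
      have h2 : D * (E + 2) < 16 ^ X := by
        calc D * (E + 2) ≤ D * (4 * 2 ^ X) := Nat.mul_le_mul_left _ (by omega)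
          _ = 4 * D * 2 ^ X := by ring
          _ < 2 ^ X * 2 ^ X := Nat.mul_lt_mul_of_pos_right (by omega) (by positivity)
          _ = 4 ^ X := by rw [← mul_pow]; norm_num
          _ ≤ 16 ^ X := Nat.pow_le_pow_left (by norm_num) _
      calc D * (E + 2) * 16 ^ (ℓ ^ c + 1) ≤ D * (E + 2) * 16 ^ X :=
            Nat.mul_le_mul_left _ (Nat.pow_le_pow_right (by norm_num) (by omega))
        _ < 16 ^ X * 16 ^ X := Nat.mul_lt_mul_of_pos_right h2 (by positivity)
        _ = _ := by rw [two_mul, pow_add]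
    have h2 : (D * (E + 2) * 16 ^ (ℓ ^ c + 1) : ℝ) < 16 ^ (2 * X) := by exact_mod_cast h1
    refine lt_of_le_of_lt ?_ h2
    gcongr

/-! ### Application to the sums S_{4,p} -/

/-- The series for the residue classes modulo 8 of the index in `S_{4,p}`, multiplied by `2^16`. -/
def residueItems (p : ℕ) (a : Fin 8 → ℤ) : List Item :=
  List.ofFn fun j : Fin 8 => ⟨p, j + 1, (a j).toNat * 2 ^ (16 - (p * (j + 2)) / 2),
    (-a j).toNat * 2 ^ (16 - (p * (j + 2)) / 2)⟩

/-- For k = 8m + j + 1 the exponent ⌊(pk + p)/2⌋ is 4pm + ⌊p(j + 2)/2⌋. The first part is a power of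
16; for p ≤ 3 the second is at most 13, so the factor 2^16 makes the coefficients integral and
reappears in Q. -/
theorem sum_residueItems {p q : ℕ} (hp : p ≤ 3) (hq : 1 ≤ q) (a : Fin 8 → ℤ) :
    ((residueItems p a).map fun i => ((i.a : ℝ) - i.b) * ∑' n, i.term (q * 2 ^ 16) n).sum =
      S 4 p a / q := by
  have hs := summable_S 4 p (by norm_num) a
  rw [S, Nat.sumByResidueClasses hs 8, residueItems, List.map_ofFn, List.sum_ofFn, Finset.sum_div]
  refine Finset.sum_congr rfl fun (j : Fin 8) _ => ?_
  have hj : (ZMod.val (n := 8) j : ℕ) = (j : ℕ) := rfl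
  simp only [Function.comp_apply, Item.term]
  rw [← tsum_mul_left, ← tsum_div_const]
  refine tsum_congr fun m => ?_
  have hjm : Fin.ofNat 8 (ZMod.val (n := 8) j + 8 * m) = j := by
    rw [hj]; ext; simp [Fin.ofNat]
  have he : (p * ((j : ℕ) + 2)) / 2 ≤ 16 := by
    have : p * ((j : ℕ) + 2) ≤ 3 * 9 := Nat.mul_le_mul hp (by omega)
    omega
  have hab : (((a j).toNat * 2 ^ (16 - (p * (j + 2)) / 2) : ℕ) : ℝ)
      - (((-a j).toNat * 2 ^ (16 - (p * (j + 2)) / 2) : ℕ) : ℝ) =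
      a j * 2 ^ (16 - (p * (j + 2)) / 2) := by
    have h1 : (a j : ℝ) = ((a j).toNat : ℝ) - ((-a j).toNat : ℝ) := by
      exact_mod_cast (Int.toNat_sub_toNat_neg (a j)).symm
    rw [h1]; push_cast; ring
  have hexp : (p * (ZMod.val (n := 8) j + 8 * m + 1) + p) / 2 = 4 * (p * m) + (p * (j + 2)) / 2 := by
    rw [hj, show p * ((j : ℕ) + 8 * m + 1) + p = p * (j + 2) + 2 * (4 * (p * m)) by ring,
      Nat.add_mul_div_left _ _ two_pos, add_comm]
  rw [hab, hjm, hexp, pow_add, pow_mul (2 : ℝ) 4, hj]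
  have h16 : (2 : ℝ) ^ 16 = 2 ^ (16 - (p * ((j : ℕ) + 2)) / 2) * 2 ^ ((p * ((j : ℕ) + 2)) / 2) := by
    rw [← pow_add, Nat.sub_add_cancel he]
  have hq' : (q : ℝ) ≠ 0 := by positivity
  have hk : ((j : ℕ) + 8 * m + 1 : ℝ) ≠ 0 := by positivity
  rw [Nat.cast_mul, Nat.cast_pow, Nat.cast_ofNat, h16]
  push_cast
  rw [show (8 * (m : ℝ) + ((j : ℕ) + 1)) = (j : ℕ) + 8 * m + 1 by ring,
    show (2 : ℝ) ^ 4 = 16 by norm_num]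
  field_simp

/-- The factor q goes into the denominators Q of the terms, so dividing by it needs no separate
computation. -/
theorem scStar_of_S {x : ℝ} {q : ℕ} {a b : Fin 8 → ℤ} (hq : 1 ≤ q) (hx : 1 / 16 ≤ x)
    (h : q * x = S 4 1 a + S 4 3 b) : SCStar 16 x := by
  refine scStar_of_sum (Q := q * 2 ^ 16) (residueItems 1 a ++ residueItems 3 b)
    (Nat.mul_pos hq (by norm_num)) ?_ hx ?_
  · intro i hi
    rw [List.mem_append, residueItems, residueItems, List.mem_ofFn, List.mem_ofFn] at hi
    rcases hi with ⟨j, rfl⟩ | ⟨j, rfl⟩ <;> exact ⟨by norm_num, by simp⟩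
  · have hq' : (q : ℝ) ≠ 0 := by positivity
    rw [List.map_append, List.sum_append, sum_residueItems (by norm_num) hq,
      sum_residueItems (by norm_num) hq, ← add_div, ← h, mul_div_cancel_left₀ _ hq']

theorem scStar_pi_pow_four : SCStar 16 (Real.pi ^ 4) := by
  refine scStar_of_S (q := 41) (by norm_num) ?_ (by exact_mod_cast bbp_pi_pow_four)
  have := one_le_pow₀ (n := 4) (by linarith [Real.pi_gt_three] : 1 ≤ Real.pi)
  linarith

theorem half_lt_log_two : 1 / 2 < Real.log 2 := by linarith [Real.log_two_gt_d9]

theorem scStar_pi_sq_mul_log_sq : SCStar 16 (Real.pi ^ 2 * Real.log 2 ^ 2) := by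
  refine scStar_of_S (q := 123) (by norm_num) ?_ (by exact_mod_cast bbp_pi_sq_mul_log_sq)
  have h1 := one_le_pow₀ (n := 2) (by linarith [Real.pi_gt_three] : 1 ≤ Real.pi)
  have h2 := pow_le_pow_left₀ (by norm_num) half_lt_log_two.le 2
  nlinarith

theorem scStar_log_pow_four : SCStar 16 (Real.log 2 ^ 4) := by
  refine scStar_of_S (q := 615) (by norm_num) ?_ (by exact_mod_cast bbp_log_pow_four)
  have := pow_le_pow_left₀ (by norm_num) half_lt_log_two.le 4
  linarith

end

theorem mainTheorem5 :
    -- the six ladder relations of order 4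
    (Bbar 4 - 5 / 2 * Abar 4 = 343 / 128 * zeta 4 ∧
      Cbar 4 - 7 / 9 * Abar 4 = 5 / 54 * zeta 4 ∧
      Dbar 4 - 1 / 3 * Abar 4 = -(313 / 3456) * zeta 4 ∧
      Ebar 4 - 6 / 25 * Abar 4 = -(1547 / 16000) * zeta 4 ∧
      Gbar 4 - 2 / 3 * Fbar 4 - beta 3 * Real.log 2 = -(80 / 27) * beta 4 ∧
      Hbar 4 - 4 / 5 * Fbar 4 - 23 / 25 * beta 3 * Real.log 2 = -(384 / 125) * beta 4) ∧
    -- the series for `log⁴ 2` and `π⁴`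
    (615 / 256 * Real.log 2 ^ 4 =
        3 * S 4 1 ![73, -2617, -73, -5066, -73, -2617, 73, -27564]
          + S 4 3 ![1258, -761, -1258, -497, -1258, -761, 1258, 2019] ∧
      41 / 9216 * Real.pi ^ 4 =
        3 * S 4 1 ![1, -19, -1, -2, -1, -19, 1, -108]
          + 2 * S 4 3 ![3, -1, -3, -2, -3, -1, 3, 4]) ∧
    -- membership in SC*, for hexadecimal digits
    (SCStar 16 (Real.pi ^ 4) ∧
      SCStar 16 (Real.pi ^ 2 * Real.log 2 ^ 2) ∧
      SCStar 16 (Real.log 2 ^ 4)) := by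
  exact ⟨ladder_relations, bbp_formulas, scStar_pi_pow_four, scStar_pi_sq_mul_log_sq,
    scStar_log_pow_four⟩
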